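/- Notation. Let $d\in\mathbf N$. For $t,s>0$ let $\Sigma_t^s(\mathbf R^d)$ be the Beurling type Gelfand--Shilov space of all $\varphi\in C^\infty(\mathbf R^d)$ such that $$\|\varphi\|_h=\sup_{\alpha,\beta\in\mathbf N^d,\ x\in\mathbf R^d}\frac{|x^\alpha D^\beta\varphi(x)|}{h^{|\alpha+\beta|}\,\alpha!^t\,\beta!^s}<\infty\quad\text{for all }h>0,\qquad D^\beta=(-i)^{|\beta|}\partial^\beta,$$ with the Fréchet topology given by the norms $\|\cdot\|_h$, $h>0$, and let $(\Sigma_t^s)'(\mathbf R^d)$ be its topological dual, i.e. the space of continuous conjugate linear functionals $\varphi\mapsto(u,\varphi)$ (this pairing extends $(u,\varphi)=\int u\,\overline\varphi\,dx$). Put $\widehat\varphi(\xi)=(2\pi)^{-d/2}\int\varphi(x)e^{-i\langle x,\xi\rangle}dx$; for $u\in(\Sigma_t^s)'(\mathbf R^d)$ the Fourier transform $\widehat u\in(\Sigma_s^t)'(\mathbf R^d)$ is defined by $(\widehat u,\widehat\varphi)=(u,\varphi)$, $\varphi\in\Sigma_t^s(\mathbf R^d)$. For $\psi\in\Sigma_t^s(\mathbf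 R^d)\setminus 0$ put $V_\psi u(x,\xi)=(2\pi)^{-d/2}(u,M_\xi T_x\psi)$, where $M_\xi T_x\psi(y)=e^{i\langle y,\xi\rangle}\psi(y-x)$. The wave front set $\mathrm{WF}^{t,s}(u)\subseteq\mathbf R^{2d}\setminus0$ with respect to the window $\psi$ is defined as follows: $(x_0,\xi_0)\ne0$ does not belong to $\mathrm{WF}^{t,s}(u)$ if and only if there is an open set $U\subseteq\mathbf R^{2d}\setminus0$ containing $(x_0,\xi_0)$ such that $$\sup_{\lambda>0,\ (x,\xi)\in U}e^{r\lambda}|V_\psi u(\lambda^tx,\lambda^s\xi)|<\infty\quad\text{for all }r>0.$$ The set $V_s(u)\subseteq\mathbf R^d\setminus0$ is defined as follows: $\eta\ne0$ does not belong to $V_s(u)$ if and only if $\widehat u$ is a continuous function and there is an open conic set $\Gamma\subseteq\mathbf R^d\setminus0$ containing $\eta$ such that $\sup_{\xi\in\Gamma}e^{r|\xi|^{1/s}}|\widehat u(\xi)|<\infty$ for all $r>0$. **Proposition.** Let $s>1$, $t>0$, and let $c_\alpha\in\mathbf C$, $\alpha\in\mathbf N^d$, satisfy $$\sum_{\alpha\in\mathbf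 N^d}|c_\alpha|\,r^{|\alpha|}\alpha!^s<\infty\quad\text{for all }r>0.$$ Then the series $u=\sum_\alpha c_\alpha D^\alpha\delta_0$ converges (tested on every $\varphi\in\Sigma_t^s(\mathbf R^d)$, with $(D^\alpha\delta_0,\varphi)=\overline{D^\alpha\varphi(0)}$) to an element $u\in(\Sigma_t^s)'(\mathbf R^d)$. The series $f(x)=\sum_\alpha c_\alpha x^\alpha$ converges absolutely at every $x\in\mathbf R^d$; as a series of ultradistributions it converges (tested on every $\varphi\in\Sigma_s^t(\mathbf R^d)$) to an element of $(\Sigma_s^t)'(\mathbf R^d)$, namely the one given by the function $f$, $(f,\varphi)=\int f\,\overline\varphi\,dx$. Moreover $$\mathrm{WF}^{t,s}(u)=\{0\}\times V_s(u)\qquad\text{and}\qquad\mathrm{WF}^{s,t}(f)=V_s(u)\times\{0\},$$ whatever nonzero windows in $\Sigma_t^s(\mathbf R^d)$ and $\Sigma_s^t(\mathbf R^d)$, respectively, are used to define these wave front sets. Finally, $V_s(u)$ is the set of directions in which $f$ fails to decay super-exponentially: a point $x_0\in\mathbf R^d\setminus0$ is not in $V_s(u)$ if and only if there is an open set $U\subseteq\mathbf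 R^d\setminus0$ containing $x_0$ such that $$\sup_{x\in U,\ \lambda>0}e^{r\lambda}|f(\lambda^sx)|<\infty\quad\text{for all }r>0.$$ -/

import Mathlib

open scoped ContDiff

noncomputable section

namespace GelfandShilov

/-- `d`-dimensional Euclidean space. -/
abbrev E (d : ℕ) : Type := EuclideanSpace ℝ (Fin d)

/-- Multi-indices. -/
abbrev MIdx (d : ℕ) : Type := Fin d → ℕ

/-- The length `|α| = α₁ + ⋯ + α_d`. -/
def deg {d : ℕ} (α : MIdx d) : ℕ := ∑ i, α i

/-- The factorial `α! = α₁! ⋯ α_d!`, as a real number. -/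
def mfact {d : ℕ} (α : MIdx d) : ℝ := ∏ i, (Nat.factorial (α i) : ℝ)

/-- The monomial `x ^ α`. -/
def mono {d : ℕ} (x : E d) (α : MIdx d) : ℝ := ∏ i, x i ^ α i

/-- The partial derivative `∂ᵢ f`. -/
def pderiv {d : ℕ} (i : Fin d) (f : E d → ℂ) : E d → ℂ :=
  fun x => fderiv ℝ f x (EuclideanSpace.single i 1)

/-- `∂ᵢ ^ (α i)` applied successively for the indices `i` in a list. -/
def listDeriv {d : ℕ} (L : List (Fin d)) (α : MIdx d) (f : E d → ℂ) : E d → ℂ :=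
  L.foldr (fun i g => (pderiv i)^[α i] g) f

/-- The partial derivative `∂ ^ α f = ∂₁ ^ α₁ ⋯ ∂_d ^ α_d f`. -/
def mderiv {d : ℕ} (α : MIdx d) (f : E d → ℂ) : E d → ℂ :=
  listDeriv (List.finRange d) α f

/-- `D ^ α f = (-i) ^ |α| ∂ ^ α f`. -/
def Dop {d : ℕ} (α : MIdx d) (f : E d → ℂ) : E d → ℂ :=
  fun x => (-Complex.I) ^ deg α * mderiv α f x

section derivFacts

variable {d : ℕ}

theorem contDiff_pderiv (i : Fin d) {f : E d → ℂ} (hf : ContDiff ℝ ∞ f) :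
    ContDiff ℝ ∞ (pderiv i f) :=
  (hf.fderiv_right (m := ∞) (by simp)).clm_apply contDiff_const

theorem pderiv_add (i : Fin d) {f g : E d → ℂ} (hf : ContDiff ℝ ∞ f) (hg : ContDiff ℝ ∞ g) :
    pderiv i (f + g) = pderiv i f + pderiv i g := by
  funext x
  simp only [pderiv, Pi.add_apply]
  rw [fderiv_add (hf.differentiable (by simp) x) (hg.differentiable (by simp) x)]
  rfl

theorem pderiv_smul (i : Fin d) (c : ℂ) {f : E d → ℂ} (hf : ContDiff ℝ ∞ f) :
    pderiv i (c • f) = c • pderiv i f := by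
  funext x
  simp only [pderiv, Pi.smul_apply]
  rw [fderiv_const_smul (hf.differentiable (by simp) x)]
  rfl

theorem pderiv_comm (i j : Fin d) {f : E d → ℂ} (hf : ContDiff ℝ ∞ f) :
    pderiv i (pderiv j f) = pderiv j (pderiv i f) := by
  funext x
  have hd : DifferentiableAt ℝ (fderiv ℝ f) x :=
    (hf.fderiv_right (m := ∞) (by simp)).differentiable (by simp) x
  have key : ∀ v w : E d, fderiv ℝ (fun y => fderiv ℝ f y v) x w = fderiv ℝ (fderiv ℝ f) x w v := by
    intro v w
    rw [fderiv_clm_apply hd (differentiableAt_const v)]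
    simp
  change fderiv ℝ (fun y => fderiv ℝ f y _) x _ = fderiv ℝ (fun y => fderiv ℝ f y _) x _
  rw [key, key]
  exact (hf.contDiffAt.isSymmSndFDerivAt
    (by rw [minSmoothness_of_isRCLikeNormedField]; exact WithTop.coe_le_coe.2 (le_top : (2 : ℕ∞) ≤ ⊤))).eq _ _

theorem contDiff_iterate (i : Fin d) (n : ℕ) {f : E d → ℂ} (hf : ContDiff ℝ ∞ f) :
    ContDiff ℝ ∞ ((pderiv i)^[n] f) := by
  induction n with
  | zero => exact hf
  | succ n ih => rw [Function.iterate_succ_apply']; exact contDiff_pderiv i ih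

theorem iterate_add' (i : Fin d) (n : ℕ) {f g : E d → ℂ} (hf : ContDiff ℝ ∞ f)
    (hg : ContDiff ℝ ∞ g) :
    (pderiv i)^[n] (f + g) = (pderiv i)^[n] f + (pderiv i)^[n] g := by
  induction n with
  | zero => rfl
  | succ n ih =>
    rw [Function.iterate_succ_apply', ih,
      pderiv_add i (contDiff_iterate i n hf) (contDiff_iterate i n hg)]
    simp only [Function.iterate_succ_apply']

theorem iterate_smul' (i : Fin d) (n : ℕ) (c : ℂ) {f : E d → ℂ} (hf : ContDiff ℝ ∞ f) :
    (pderiv i)^[n] (c • f) = c • (pderiv i)^[n] f := by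
  induction n with
  | zero => rfl
  | succ n ih =>
    rw [Function.iterate_succ_apply', ih, pderiv_smul i c (contDiff_iterate i n hf)]
    simp only [Function.iterate_succ_apply']

theorem iterate_comm (i j : Fin d) (n : ℕ) {f : E d → ℂ} (hf : ContDiff ℝ ∞ f) :
    (pderiv i)^[n] (pderiv j f) = pderiv j ((pderiv i)^[n] f) := by
  induction n with
  | zero => rfl
  | succ n ih =>
    rw [Function.iterate_succ_apply', ih, pderiv_comm i j (contDiff_iterate i n hf),
      Function.iterate_succ_apply']

theorem contDiff_listDeriv (L : List (Fin d)) (α : MIdx d) {f : E d → ℂ}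
    (hf : ContDiff ℝ ∞ f) : ContDiff ℝ ∞ (listDeriv L α f) := by
  induction L with
  | nil => exact hf
  | cons i L ih => exact contDiff_iterate i (α i) ih

theorem listDeriv_add (L : List (Fin d)) (α : MIdx d) {f g : E d → ℂ}
    (hf : ContDiff ℝ ∞ f) (hg : ContDiff ℝ ∞ g) :
    listDeriv L α (f + g) = listDeriv L α f + listDeriv L α g := by
  induction L with
  | nil => rfl
  | cons i L ih =>
    change (pderiv i)^[α i] (listDeriv L α (f + g)) = _
    rw [ih, iterate_add' i _ (contDiff_listDeriv L α hf) (contDiff_listDeriv L α hg)]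
    rfl

theorem listDeriv_smul (L : List (Fin d)) (α : MIdx d) (c : ℂ) {f : E d → ℂ}
    (hf : ContDiff ℝ ∞ f) : listDeriv L α (c • f) = c • listDeriv L α f := by
  induction L with
  | nil => rfl
  | cons i L ih =>
    change (pderiv i)^[α i] (listDeriv L α (c • f)) = _
    rw [ih, iterate_smul' i _ c (contDiff_listDeriv L α hf)]
    rfl

theorem listDeriv_comm (L : List (Fin d)) (α : MIdx d) (j : Fin d) {f : E d → ℂ}
    (hf : ContDiff ℝ ∞ f) : listDeriv L α (pderiv j f) = pderiv j (listDeriv L α f) := by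
  induction L with
  | nil => rfl
  | cons i L ih =>
    change (pderiv i)^[α i] (listDeriv L α (pderiv j f)) = _
    rw [ih, iterate_comm i j _ (contDiff_listDeriv L α hf)]
    rfl

theorem listDeriv_single_not_mem (L : List (Fin d)) (α : MIdx d) (j : Fin d) (hj : j ∉ L)
    (f : E d → ℂ) : listDeriv L (α + Pi.single j 1) f = listDeriv L α f := by
  induction L with
  | nil => rfl
  | cons i L ih =>
    simp only [List.mem_cons, not_or] at hj
    change (pderiv i)^[(α + Pi.single j 1 : MIdx d) i] (listDeriv L (α + Pi.single j 1) f) = _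
    rw [ih hj.2]
    simp [Ne.symm hj.1, listDeriv]

theorem listDeriv_single_mem (L : List (Fin d)) (hL : L.Nodup) (α : MIdx d) (j : Fin d)
    (hj : j ∈ L) {f : E d → ℂ} (hf : ContDiff ℝ ∞ f) :
    listDeriv L (α + Pi.single j 1) f = pderiv j (listDeriv L α f) := by
  induction L with
  | nil => simp at hj
  | cons i L ih =>
    rw [List.nodup_cons] at hL
    change (pderiv i)^[(α + Pi.single j 1 : MIdx d) i] (listDeriv L (α + Pi.single j 1) f) =
      pderiv j ((pderiv i)^[α i] (listDeriv L α f))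
    by_cases hij : i = j
    · subst hij
      rw [listDeriv_single_not_mem L α i hL.1]
      simp [Function.iterate_succ_apply']
    · have hj' : j ∈ L := by
        rcases List.mem_cons.1 hj with h | h
        · exact absurd h.symm hij
        · exact h
      rw [ih hL.2 hj', iterate_comm i j _ (contDiff_listDeriv L α hf)]
      simp [hij]

theorem contDiff_mderiv (α : MIdx d) {f : E d → ℂ} (hf : ContDiff ℝ ∞ f) :
    ContDiff ℝ ∞ (mderiv α f) := contDiff_listDeriv _ α hf

theorem mderiv_add (α : MIdx d) {f g : E d → ℂ} (hf : ContDiff ℝ ∞ f) (hg : ContDiff ℝ ∞ g) :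
    mderiv α (f + g) = mderiv α f + mderiv α g := listDeriv_add _ α hf hg

theorem mderiv_smul (α : MIdx d) (c : ℂ) {f : E d → ℂ} (hf : ContDiff ℝ ∞ f) :
    mderiv α (c • f) = c • mderiv α f := listDeriv_smul _ α c hf

theorem mderiv_pderiv (α : MIdx d) (i : Fin d) {f : E d → ℂ} (hf : ContDiff ℝ ∞ f) :
    mderiv α (pderiv i f) = mderiv (α + Pi.single i 1) f := by
  rw [mderiv, listDeriv_comm _ α i hf, mderiv,
    listDeriv_single_mem _ (List.nodup_finRange d) α i (List.mem_finRange i) hf]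

/-- Translation of a function, `T_a f (y) = f (y - a)`. -/
def translate (a : E d) (f : E d → ℂ) : E d → ℂ := fun y => f (y - a)

/-- Modulation of a function, `M_ξ f (y) = exp (i ⟨y, ξ⟩) f (y)`. -/
def modulate (ξ : E d) (f : E d → ℂ) : E d → ℂ :=
  fun y => Complex.exp (Complex.I * ((inner ℝ y ξ : ℝ) : ℂ)) * f y

theorem listDeriv_translate (L : List (Fin d)) (a : E d) (α : MIdx d) (f : E d → ℂ) :
    listDeriv L α (translate a f) = translate a (listDeriv L α f) := by
  have h1 : ∀ (i : Fin d) (g : E d → ℂ), pderiv i (translate a g) = translate a (pderiv i g) := by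
    intro i g
    funext x
    change fderiv ℝ (fun y => g (y - a)) x _ = fderiv ℝ g (x - a) _
    rw [fderiv_comp_sub]
  have h2 : ∀ (i : Fin d) (n : ℕ) (g : E d → ℂ),
      (pderiv i)^[n] (translate a g) = translate a ((pderiv i)^[n] g) := by
    intro i n g
    induction n with
    | zero => rfl
    | succ n ih => simp only [Function.iterate_succ_apply']; rw [ih, h1]
  induction L with
  | nil => rfl
  | cons i L ih =>
    change (pderiv i)^[α i] (listDeriv L α (translate a f)) = _
    rw [ih, h2]
    rfl

theorem contDiff_phase (ξ : E d) :
    ContDiff ℝ ∞ (fun y : E d => Complex.exp (Complex.I * ((inner ℝ y ξ : ℝ) : ℂ))) := by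
  have h : ContDiff ℝ ∞ (fun y : E d => ((inner ℝ y ξ : ℝ) : ℂ)) :=
    Complex.ofRealCLM.contDiff.comp (contDiff_id.inner ℝ contDiff_const)
  exact (contDiff_const.mul h).cexp

theorem contDiff_modulate (ξ : E d) {f : E d → ℂ} (hf : ContDiff ℝ ∞ f) :
    ContDiff ℝ ∞ (modulate ξ f) := (contDiff_phase ξ).mul hf

/-- The operator `∂ᵢ + i ξᵢ`, the conjugate of `∂ᵢ` by a modulation. -/
def qderiv (ξ : E d) (i : Fin d) (f : E d → ℂ) : E d → ℂ :=
  pderiv i f + (Complex.I * (ξ i : ℂ)) • f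

theorem contDiff_qderiv (ξ : E d) (i : Fin d) {f : E d → ℂ} (hf : ContDiff ℝ ∞ f) :
    ContDiff ℝ ∞ (qderiv ξ i f) :=
  (contDiff_pderiv i hf).add (contDiff_const.smul hf)

theorem pderiv_modulate (ξ : E d) (i : Fin d) {f : E d → ℂ} (hf : ContDiff ℝ ∞ f) :
    pderiv i (modulate ξ f) = modulate ξ (qderiv ξ i f) := by
  funext x
  have h0 : HasFDerivAt (fun y : E d => (inner ℝ y ξ : ℝ)) (innerSL ℝ ξ) x := by
    have : (fun y : E d => (inner ℝ y ξ : ℝ)) = fun y => innerSL ℝ ξ y := by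
      funext y
      simp [real_inner_comm]
    rw [this]
    exact (innerSL ℝ ξ).hasFDerivAt
  have h1 : HasFDerivAt (fun y : E d => ((inner ℝ y ξ : ℝ) : ℂ))
      (Complex.ofRealCLM.comp (innerSL ℝ ξ)) x := Complex.ofRealCLM.hasFDerivAt.comp x h0
  have h2 := ((h1.const_mul Complex.I).cexp).mul (hf.differentiable (by simp) x).hasFDerivAt
  have h3 : fderiv ℝ (modulate ξ f) x = _ := h2.fderiv
  change fderiv ℝ (modulate ξ f) x _ = _
  rw [h3]
  simp [EuclideanSpace.inner_single_right, modulate, qderiv, pderiv]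
  ring

/-- Iterated `∂ᵢ + i ξᵢ` over a list. -/
def listQ (ξ : E d) (L : List (Fin d)) (α : MIdx d) (f : E d → ℂ) : E d → ℂ :=
  L.foldr (fun i g => (qderiv ξ i)^[α i] g) f

theorem contDiff_iterateQ (ξ : E d) (i : Fin d) (n : ℕ) {f : E d → ℂ} (hf : ContDiff ℝ ∞ f) :
    ContDiff ℝ ∞ ((qderiv ξ i)^[n] f) := by
  induction n with
  | zero => exact hf
  | succ n ih => rw [Function.iterate_succ_apply']; exact contDiff_qderiv ξ i ih

theorem contDiff_listQ (ξ : E d) (L : List (Fin d)) (α : MIdx d) {f : E d → ℂ}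
    (hf : ContDiff ℝ ∞ f) : ContDiff ℝ ∞ (listQ ξ L α f) := by
  induction L with
  | nil => exact hf
  | cons i L ih => exact contDiff_iterateQ ξ i (α i) ih

theorem listDeriv_modulate (ξ : E d) (L : List (Fin d)) (α : MIdx d) {f : E d → ℂ}
    (hf : ContDiff ℝ ∞ f) :
    listDeriv L α (modulate ξ f) = modulate ξ (listQ ξ L α f) := by
  have h2 : ∀ (i : Fin d) (n : ℕ) (g : E d → ℂ), ContDiff ℝ ∞ g →
      (pderiv i)^[n] (modulate ξ g) = modulate ξ ((qderiv ξ i)^[n] g) := by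
    intro i n g hg
    induction n with
    | zero => rfl
    | succ n ih =>
      simp only [Function.iterate_succ_apply']
      rw [ih, pderiv_modulate ξ i (contDiff_iterateQ ξ i n hg)]
  induction L with
  | nil => rfl
  | cons i L ih =>
    change (pderiv i)^[α i] (listDeriv L α (modulate ξ f)) = _
    rw [ih, h2 i _ _ (contDiff_listQ ξ L α hf)]
    rfl

theorem norm_modulate (ξ : E d) (f : E d → ℂ) (y : E d) : ‖modulate ξ f y‖ = ‖f y‖ := by
  rw [modulate, norm_mul, mul_comm Complex.I, Complex.norm_exp_ofReal_mul_I, one_mul]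

end derivFacts

/-- The denominator `h ^ |α + β| α! ^ t β! ^ s` in the Gelfand-Shilov norms. -/
def gsWeight {d : ℕ} (t s h : ℝ) (α β : MIdx d) : ℝ :=
  h ^ deg (α + β) * mfact α ^ t * mfact β ^ s

theorem mfact_pos {d : ℕ} (α : MIdx d) : 0 < mfact α :=
  Finset.prod_pos fun i _ => by exact_mod_cast Nat.factorial_pos (α i)

theorem gsWeight_pos {d : ℕ} (t s : ℝ) {h : ℝ} (hh : 0 < h) (α β : MIdx d) :
    0 < gsWeight t s h α β := by
  have h1 := Real.rpow_pos_of_pos (mfact_pos α) t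
  have h2 := Real.rpow_pos_of_pos (mfact_pos β) s
  unfold gsWeight
  positivity

/-- The functions of the Beurling type Gelfand-Shilov space: the smooth `f` such that for all
`h > 0` the quotients `|x ^ α D ^ β f (x)| / (h ^ |α + β| α! ^ t β! ^ s)` are bounded in
`α`, `β`, `x` (note that `|D ^ β f| = |∂ ^ β f|`). -/
def gsSubmodule (d : ℕ) (t s : ℝ) : Submodule ℂ (E d → ℂ) where
  carrier := {f | ContDiff ℝ ∞ f ∧ ∀ h : ℝ, 0 < h → ∃ C : ℝ, ∀ (α β : MIdx d) (x : E d),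
    |mono x α| * ‖mderiv β f x‖ ≤ C * gsWeight t s h α β}
  zero_mem' := by
    refine ⟨contDiff_const, fun h _ => ⟨0, fun α β x => ?_⟩⟩
    have h0 : mderiv β (0 : E d → ℂ) = 0 := by
      have := mderiv_smul β 0 (f := (0 : E d → ℂ)) contDiff_const
      simpa using this
    simp [h0]
  add_mem' := by
    rintro f g ⟨hf, hf'⟩ ⟨hg, hg'⟩
    refine ⟨hf.add hg, fun h hh => ?_⟩
    obtain ⟨C, hC⟩ := hf' h hh
    obtain ⟨C', hC'⟩ := hg' h hh
    refine ⟨C + C', fun α β x => ?_⟩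
    rw [mderiv_add β hf hg, Pi.add_apply]
    calc |mono x α| * ‖mderiv β f x + mderiv β g x‖
        ≤ |mono x α| * (‖mderiv β f x‖ + ‖mderiv β g x‖) := by
          gcongr
          exact norm_add_le _ _
      _ ≤ _ := by linarith [hC α β x, hC' α β x]
  smul_mem' := by
    rintro c f ⟨hf, hf'⟩
    refine ⟨contDiff_const.smul hf, fun h hh => ?_⟩
    obtain ⟨C, hC⟩ := hf' h hh
    refine ⟨‖c‖ * C, fun α β x => ?_⟩
    rw [mderiv_smul β c hf, Pi.smul_apply, norm_smul]
    calc |mono x α| * (‖c‖ * ‖mderiv β f x‖) = ‖c‖ * (|mono x α| * ‖mderiv β f x‖) := by ring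
      _ ≤ ‖c‖ * (C * gsWeight t s h α β) :=
          mul_le_mul_of_nonneg_left (hC α β x) (norm_nonneg c)
      _ = _ := by ring

/-- The Beurling type Gelfand-Shilov space `Σ_t^s(ℝ^d)`. -/
def GS (d : ℕ) (t s : ℝ) : Type := gsSubmodule d t s

instance (d : ℕ) (t s : ℝ) : AddCommGroup (GS d t s) :=
  inferInstanceAs (AddCommGroup (gsSubmodule d t s))

instance (d : ℕ) (t s : ℝ) : Module ℂ (GS d t s) :=
  inferInstanceAs (Module ℂ (gsSubmodule d t s))

/-- The function underlying an element of `Σ_t^s(ℝ^d)`. -/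
def GS.fn {d : ℕ} {t s : ℝ} (f : GS d t s) : E d → ℂ := f.1

/-- The quotients whose supremum is the Gelfand-Shilov norm with parameter `h`. -/
def gsQuot {d : ℕ} (t s h : ℝ) (f : E d → ℂ) (p : MIdx d × MIdx d × E d) : ℝ :=
  |mono p.2.2 p.1| * ‖mderiv p.2.1 f p.2.2‖ / gsWeight t s h p.1 p.2.1

theorem gsQuot_nonneg {d : ℕ} (t s : ℝ) {h : ℝ} (hh : 0 < h) (f : E d → ℂ)
    (p : MIdx d × MIdx d × E d) : 0 ≤ gsQuot t s h f p := by
  have := gsWeight_pos t s hh p.1 p.2.1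
  unfold gsQuot
  positivity

theorem GS.bddAbove {d : ℕ} {t s : ℝ} (f : GS d t s) {h : ℝ} (hh : 0 < h) :
    BddAbove (Set.range (gsQuot t s h f.fn)) := by
  obtain ⟨C, hC⟩ := f.2.2 h hh
  refine ⟨C, ?_⟩
  rintro _ ⟨p, rfl⟩
  exact (div_le_iff₀ (gsWeight_pos t s hh _ _)).2 (hC p.1 p.2.1 p.2.2)

/-- The norm `‖f‖ = sup |x ^ α D ^ β f (x)| / (h ^ |α + β| α! ^ t β! ^ s)` on `Σ_t^s(ℝ^d)`,
for `h > 0`. -/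
def gsSeminorm (d : ℕ) (t s : ℝ) (h : Set.Ioi (0 : ℝ)) : Seminorm ℂ (GS d t s) :=
  Seminorm.of (fun f => ⨆ p, gsQuot t s h f.fn p)
    (by
      intro f g
      refine ciSup_le fun p => ?_
      have h1 := le_ciSup (f.bddAbove h.2) p
      have h2 := le_ciSup (g.bddAbove h.2) p
      refine le_trans ?_ (add_le_add h1 h2)
      have hw := gsWeight_pos t s h.2 p.1 p.2.1
      have h3 : mderiv p.2.1 (f + g).fn = mderiv p.2.1 f.fn + mderiv p.2.1 g.fn :=
        mderiv_add p.2.1 f.2.1 g.2.1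
      simp only [gsQuot]
      rw [← add_div, h3, Pi.add_apply, ← mul_add]
      gcongr
      exact norm_add_le _ _)
    (by
      intro c f
      rw [Real.mul_iSup_of_nonneg (norm_nonneg c)]
      congr 1
      funext p
      have h3 : mderiv p.2.1 (c • f).fn = c • mderiv p.2.1 f.fn := mderiv_smul p.2.1 c f.2.1
      simp only [gsQuot]
      rw [h3, Pi.smul_apply, norm_smul]
      ring)

/-- The Fréchet topology of `Σ_t^s(ℝ^d)`, defined by the norms with parameters `h > 0`. -/
instance (d : ℕ) (t s : ℝ) : TopologicalSpace (GS d t s) :=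
  (SeminormFamily.moduleFilterBasis (𝕜 := ℂ) (gsSeminorm d t s)).topology

theorem gs_withSeminorms (d : ℕ) (t s : ℝ) : WithSeminorms (gsSeminorm d t s) := ⟨rfl⟩

/-- The space `(Σ_t^s)'(ℝ^d)` of Gelfand-Shilov ultradistributions: the continuous conjugate
linear functionals on `Σ_t^s(ℝ^d)`, where `u φ` is the pairing `(u, φ)` that extends the `L²`
inner product `∫ u conj(φ)`. -/
abbrev GSDual (d : ℕ) (t s : ℝ) : Type := GS d t s →SL[starRingEnd ℂ] ℂ

theorem exists_weight {s h : ℝ} (hs : 0 < s) (hh : 0 < h) (A : ℝ) :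
    ∃ (w : ℕ → ℝ) (K : ℝ), 1 ≤ K ∧ (∀ m, h ^ m * (m.factorial : ℝ) ^ s ≤ w m) ∧
      (∀ m, A * w m ≤ w (m + 1)) ∧ ∀ m, w m ≤ K * (h ^ m * (m.factorial : ℝ) ^ s) := by
  let c : ℕ → ℝ := fun j => max 1 (A / (h * ((j + 1 : ℕ) : ℝ) ^ s))
  let k : ℕ → ℝ := fun m => ∏ j ∈ Finset.range m, c j
  have hc : ∀ j, 1 ≤ c j := fun j => le_max_left _ _
  have hk1 : ∀ m, 1 ≤ k m := fun m => by
    induction m with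
    | zero => simp [k]
    | succ m ih =>
      have h1 : k (m + 1) = k m * c m := Finset.prod_range_succ _ _
      rw [h1]
      exact one_le_mul_of_one_le_of_one_le ih (hc m)
  have hks : ∀ m, k (m + 1) = k m * c m := fun m => Finset.prod_range_succ _ _
  have hpos : ∀ m : ℕ, 0 < h ^ m * (m.factorial : ℝ) ^ s := fun m =>
    mul_pos (pow_pos hh m) (Real.rpow_pos_of_pos (by exact_mod_cast m.factorial_pos) s)
  have hmono : Monotone k := monotone_nat_of_le_succ fun m => by
    rw [hks]
    exact le_mul_of_one_le_right (by linarith [hk1 m]) (hc m)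
  have hN : ∃ N : ℕ, ∀ m, N ≤ m → c m = 1 := by
    have ht : Filter.Tendsto (fun j : ℕ => h * ((j + 1 : ℕ) : ℝ) ^ s) Filter.atTop Filter.atTop :=
      (((tendsto_rpow_atTop hs).comp
        (tendsto_natCast_atTop_atTop.comp (Filter.tendsto_add_atTop_nat 1)))).const_mul_atTop hh
    obtain ⟨N, hN⟩ := Filter.eventually_atTop.1 (ht.eventually_ge_atTop A)
    refine ⟨N, fun m hm => max_eq_left ?_⟩
    have h1 : 0 < h * ((m + 1 : ℕ) : ℝ) ^ s :=
      mul_pos hh (Real.rpow_pos_of_pos (by positivity) s)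
    exact (div_le_one h1).2 (hN m hm)
  obtain ⟨N, hN⟩ := hN
  have hkN : ∀ m, k m ≤ k N := by
    intro m
    rcases le_total m N with hm | hm
    · exact hmono hm
    · induction m, hm using Nat.le_induction with
      | base => exact le_rfl
      | succ m hm ih => rw [hks, hN m hm, mul_one]; exact ih
  refine ⟨fun m => k m * (h ^ m * (m.factorial : ℝ) ^ s), k N, hk1 N, fun m => ?_, fun m => ?_,
    fun m => ?_⟩
  · exact le_mul_of_one_le_left (hpos m).le (hk1 m)
  · have h1 : 0 < h * ((m + 1 : ℕ) : ℝ) ^ s :=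
      mul_pos hh (Real.rpow_pos_of_pos (by positivity) s)
    have h2 : A ≤ c m * (h * ((m + 1 : ℕ) : ℝ) ^ s) :=
      (div_le_iff₀ h1).1 (le_max_right _ _)
    have h3 : h ^ (m + 1) * ((m + 1).factorial : ℝ) ^ s =
        (h * ((m + 1 : ℕ) : ℝ) ^ s) * (h ^ m * (m.factorial : ℝ) ^ s) := by
      rw [Nat.factorial_succ, Nat.cast_mul,
        Real.mul_rpow (Nat.cast_nonneg _) (Nat.cast_nonneg _)]
      ring
    have h4 : 0 ≤ k m * (h ^ m * (m.factorial : ℝ) ^ s) :=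
      mul_nonneg (by linarith [hk1 m]) (hpos m).le
    simp only []
    rw [h3, hks]
    calc A * (k m * (h ^ m * (m.factorial : ℝ) ^ s))
        ≤ (c m * (h * ((m + 1 : ℕ) : ℝ) ^ s)) * (k m * (h ^ m * (m.factorial : ℝ) ^ s)) :=
          mul_le_mul_of_nonneg_right h2 h4
      _ = _ := by ring
  · exact mul_le_mul_of_nonneg_right (hkN m) (hpos m).le

theorem prod_weight {d : ℕ} (s h : ℝ) (β : MIdx d) :
    ∏ i, (h ^ β i * ((β i).factorial : ℝ) ^ s) = h ^ deg β * mfact β ^ s := by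
  rw [Finset.prod_mul_distrib, Finset.prod_pow_eq_pow_sum, mfact, deg,
    Real.finsetProd_rpow _ _ (fun i _ => Nat.cast_nonneg _)]

theorem deg_add {d : ℕ} (α β : MIdx d) : deg (α + β) = deg α + deg β :=
  Finset.sum_add_distrib

theorem listQ_bound {d : ℕ} (ξ : E d) (x : E d) (a : ℝ) (ha : 0 ≤ a) (w : ℕ → ℝ)
    (hw0 : ∀ m, 0 ≤ w m) (hw : ∀ m, ‖ξ‖ * w m ≤ w (m + 1)) (B : ℝ) (f : E d → ℂ)
    (hf : ContDiff ℝ ∞ f) (hB : ∀ γ : MIdx d, a * ‖mderiv γ f x‖ ≤ B * ∏ i, w (γ i))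
    (hB0 : 0 ≤ B) (β : MIdx d) :
    a * ‖listQ ξ (List.finRange d) β f x‖ ≤ 2 ^ deg β * B * ∏ i, w (β i) := by
  let P : (E d → ℂ) → ℝ → MIdx d → Prop := fun g B δ =>
    ContDiff ℝ ∞ g ∧ 0 ≤ B ∧ ∀ γ : MIdx d, a * ‖mderiv γ g x‖ ≤ B * ∏ i, w ((γ + δ) i)
  have step : ∀ g B δ (j : Fin d), P g B δ → P (qderiv ξ j g) (2 * B) (δ + Pi.single j 1) := by
    rintro g B δ j ⟨hg, hB, hP⟩
    refine ⟨contDiff_qderiv ξ j hg, by positivity, fun γ => ?_⟩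
    have e1 : mderiv γ (qderiv ξ j g) x =
        mderiv (γ + Pi.single j 1) g x + (Complex.I * (ξ j : ℂ)) * mderiv γ g x := by
      rw [qderiv, mderiv_add γ (contDiff_pderiv j hg)
          (g := (Complex.I * (ξ j : ℂ)) • g) (contDiff_const.smul hg),
        mderiv_pderiv γ j hg, mderiv_smul γ _ hg]
      rfl
    have hξ : ‖Complex.I * (ξ j : ℂ)‖ ≤ ‖ξ‖ := by
      rw [norm_mul, Complex.norm_I, one_mul, Complex.norm_real]
      exact PiLp.norm_apply_le ξ j
    have aux : ∀ ε ζ : MIdx d, (∀ i, i ≠ j → ε i = ζ i) → ε j = ζ j + 1 →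
        ‖ξ‖ * ∏ i, w (ζ i) ≤ ∏ i, w (ε i) := by
      intro ε ζ h1 h2
      rw [← Finset.mul_prod_erase _ (fun i => w (ζ i)) (Finset.mem_univ j),
        ← Finset.mul_prod_erase _ (fun i => w (ε i)) (Finset.mem_univ j), ← mul_assoc]
      have e3 : ∏ i ∈ Finset.univ.erase j, w (ε i) = ∏ i ∈ Finset.univ.erase j, w (ζ i) :=
        Finset.prod_congr rfl fun i hi => by rw [h1 i (Finset.ne_of_mem_erase hi)]
      rw [e3, h2]
      exact mul_le_mul_of_nonneg_right (hw _) (Finset.prod_nonneg fun i _ => hw0 _)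
    have e2 : ‖ξ‖ * ∏ i, w ((γ + δ) i) ≤ ∏ i, w ((γ + (δ + Pi.single j 1) : MIdx d) i) :=
      aux _ _ (fun i hi => by simp [hi]) (by simp [add_assoc])
    have e5 := hP (γ + Pi.single j 1)
    have e6 : γ + Pi.single j 1 + δ = γ + (δ + Pi.single j 1) := by abel
    rw [e6] at e5
    have e7 : a * (‖ξ‖ * ‖mderiv γ g x‖) ≤ B * ∏ i, w ((γ + (δ + Pi.single j 1) : MIdx d) i) := by
      calc a * (‖ξ‖ * ‖mderiv γ g x‖) = ‖ξ‖ * (a * ‖mderiv γ g x‖) := by ring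
        _ ≤ ‖ξ‖ * (B * ∏ i, w ((γ + δ) i)) :=
          mul_le_mul_of_nonneg_left (hP γ) (norm_nonneg ξ)
        _ = B * (‖ξ‖ * ∏ i, w ((γ + δ) i)) := by ring
        _ ≤ _ := mul_le_mul_of_nonneg_left e2 hB
    rw [e1]
    calc a * ‖mderiv (γ + Pi.single j 1) g x + Complex.I * (ξ j : ℂ) * mderiv γ g x‖
        ≤ a * (‖mderiv (γ + Pi.single j 1) g x‖ + ‖ξ‖ * ‖mderiv γ g x‖) := by
          refine mul_le_mul_of_nonneg_left ((norm_add_le _ _).trans ?_) ha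
          rw [norm_mul]
          gcongr
      _ ≤ _ := by linarith
  have iter : ∀ (n : ℕ) g B δ (j : Fin d), P g B δ →
      P ((qderiv ξ j)^[n] g) (2 ^ n * B) (δ + Pi.single j n) := by
    intro n g B δ j hP
    induction n with
    | zero => simpa using hP
    | succ n ih =>
      have := step _ _ _ j ih
      rw [Function.iterate_succ_apply']
      convert this using 1
      · ring
      · rw [add_assoc, ← Pi.single_add]
  have main : ∀ L : List (Fin d), P (listQ ξ L β f) (2 ^ (L.map β).sum * B)
      ((L.map fun j => (Pi.single j (β j) : MIdx d)).sum) := by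
    intro L
    induction L with
    | nil => exact ⟨hf, by simpa using hB0, fun γ => by simpa [listQ] using hB γ⟩
    | cons j L ih =>
      have := iter (β j) _ _ _ j ih
      simp only [List.map_cons, List.sum_cons]
      have e1 : (2 : ℝ) ^ (β j + (L.map β).sum) * B = 2 ^ β j * (2 ^ (L.map β).sum * B) := by
        rw [pow_add]; ring
      rw [e1, add_comm (Pi.single j (β j) : MIdx d)]
      exact this
  have h1 := (main (List.finRange d)).2.2 0
  have e1 : ((List.finRange d).map β).sum = deg β := by
    rw [deg, ← List.sum_ofFn, List.ofFn_eq_map]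
  have e2 : ((List.finRange d).map fun j => (Pi.single j (β j) : MIdx d)).sum = β := by
    rw [← List.ofFn_eq_map, List.sum_ofFn]
    exact Finset.univ_sum_single β
  rw [e1, e2, zero_add] at h1
  have e3 : mderiv 0 (listQ ξ (List.finRange d) β f) = listQ ξ (List.finRange d) β f := by
    have : ∀ (L : List (Fin d)) (g : E d → ℂ), listDeriv L 0 g = g := by
      intro L g
      induction L with
      | nil => rfl
      | cons i L ih => exact ih
    exact this _ _
  rw [e3] at h1
  exact h1

theorem modulate_mem {d : ℕ} {t s : ℝ} (hs : 0 < s) (ξ : E d) {f : E d → ℂ}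
    (hf : f ∈ gsSubmodule d t s) : modulate ξ f ∈ gsSubmodule d t s := by
  refine ⟨contDiff_modulate ξ hf.1, fun h hh => ?_⟩
  have hh2 : 0 < h / 2 := by positivity
  obtain ⟨C, hC⟩ := hf.2 (h / 2) hh2
  obtain ⟨w, K, hK, hw1, hw2, hw3⟩ := exists_weight hs hh2 ‖ξ‖
  have hpos : ∀ m : ℕ, 0 < (h / 2) ^ m * (m.factorial : ℝ) ^ s := fun m =>
    mul_pos (pow_pos hh2 m) (Real.rpow_pos_of_pos (by exact_mod_cast m.factorial_pos) s)
  have hw0 : ∀ m, 0 ≤ w m := fun m => (hpos m).le.trans (hw1 m)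
  refine ⟨|C| * K ^ d, fun α β x => ?_⟩
  have e1 : mderiv β (modulate ξ f) = modulate ξ (listQ ξ (List.finRange d) β f) :=
    listDeriv_modulate ξ _ β hf.1
  rw [e1, norm_modulate]
  have hα : 0 ≤ (h / 2) ^ deg α * mfact α ^ t :=
    mul_nonneg (by positivity) (Real.rpow_nonneg (mfact_pos α).le t)
  have h1 := listQ_bound ξ x |mono x α| (abs_nonneg _) w hw0 hw2
    (|C| * ((h / 2) ^ deg α * mfact α ^ t)) f hf.1 (fun γ => by
      refine (hC α γ x).trans ?_
      have e2 : gsWeight t s (h / 2) α γ =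
          ((h / 2) ^ deg α * mfact α ^ t) * ∏ i, ((h / 2) ^ γ i * ((γ i).factorial : ℝ) ^ s) := by
        rw [prod_weight, gsWeight, deg_add, pow_add]
        ring
      rw [e2, mul_assoc |C|]
      have e4 : ∏ i, ((h / 2) ^ γ i * ((γ i).factorial : ℝ) ^ s) ≤ ∏ i, w (γ i) :=
        Finset.prod_le_prod (fun i _ => (hpos _).le) fun i _ => hw1 _
      have e5 : 0 ≤ ∏ i, ((h / 2) ^ γ i * ((γ i).factorial : ℝ) ^ s) :=
        Finset.prod_nonneg fun i _ => (hpos _).le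
      exact mul_le_mul (le_abs_self C) (mul_le_mul_of_nonneg_left e4 hα)
        (mul_nonneg hα e5) (abs_nonneg C))
    (mul_nonneg (abs_nonneg C) hα) β
  refine h1.trans ?_
  have e6 : ∏ i, w (β i) ≤ K ^ d * ((h / 2) ^ deg β * mfact β ^ s) := by
    rw [← prod_weight]
    calc ∏ i, w (β i) ≤ ∏ i, (K * ((h / 2) ^ β i * ((β i).factorial : ℝ) ^ s)) :=
          Finset.prod_le_prod (fun i _ => hw0 _) fun i _ => hw3 _
      _ = _ := by rw [Finset.prod_mul_distrib]; simp
  calc 2 ^ deg β * (|C| * ((h / 2) ^ deg α * mfact α ^ t)) * ∏ i, w (β i)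
      ≤ 2 ^ deg β * (|C| * ((h / 2) ^ deg α * mfact α ^ t)) *
          (K ^ d * ((h / 2) ^ deg β * mfact β ^ s)) := by
        refine mul_le_mul_of_nonneg_left e6 ?_
        exact mul_nonneg (by positivity) (mul_nonneg (abs_nonneg C) hα)
    _ = |C| * K ^ d * ((h / 2) ^ deg α * (2 * (h / 2)) ^ deg β * mfact α ^ t * mfact β ^ s) := by
        rw [mul_pow 2 (h / 2)]; ring
    _ ≤ |C| * K ^ d * gsWeight t s h α β := by
        have e7 : 2 * (h / 2) = h := by ring
        rw [e7, gsWeight, deg_add, pow_add]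
        have e8 : (h / 2) ^ deg α ≤ h ^ deg α := by
          gcongr
          linarith
        have := Real.rpow_nonneg (mfact_pos α).le t
        have := Real.rpow_nonneg (mfact_pos β).le s
        gcongr

theorem translate_mem {d : ℕ} {t s : ℝ} (ht : 0 < t) (a : E d) {f : E d → ℂ}
    (hf : f ∈ gsSubmodule d t s) : translate a f ∈ gsSubmodule d t s := by
  refine ⟨hf.1.comp (contDiff_id.sub contDiff_const), fun h hh => ?_⟩
  have hh2 : 0 < h / 2 := by positivity
  obtain ⟨C, hC⟩ := hf.2 (h / 2) hh2
  obtain ⟨w, K, hK, hw1, hw2, hw3⟩ := exists_weight ht hh2 ‖a‖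
  have hA : ∀ m : ℕ, ‖a‖ ^ m ≤ K * ((h / 2) ^ m * (m.factorial : ℝ) ^ t) := by
    intro m
    refine le_trans ?_ (hw3 m)
    induction m with
    | zero => simpa using hw1 0
    | succ m ih =>
      rw [pow_succ']
      exact (mul_le_mul_of_nonneg_left ih (norm_nonneg a)).trans (hw2 m)
  have hpos : ∀ m : ℕ, 0 < (h / 2) ^ m * (m.factorial : ℝ) ^ t := fun m =>
    mul_pos (pow_pos hh2 m) (Real.rpow_pos_of_pos (by exact_mod_cast m.factorial_pos) t)
  refine ⟨|C| * K ^ d, fun α β x => ?_⟩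
  have e1 : mderiv β (translate a f) x = mderiv β f (x - a) := by
    rw [mderiv, listDeriv_translate]
    rfl
  rw [e1]
  let y : E d := x - a
  let α' : MIdx d := fun i => if ‖a‖ ≤ |y i| then α i else 0
  have hb : |mono x α| ≤ 2 ^ deg α * (|mono y α'| * ∏ i, ‖a‖ ^ (α i - α' i)) := by
    simp only [mono, Finset.abs_prod, abs_pow, deg]
    rw [← Finset.prod_pow_eq_pow_sum, ← Finset.prod_mul_distrib, ← Finset.prod_mul_distrib]
    refine Finset.prod_le_prod (fun i _ => by positivity) fun i _ => ?_
    have hx : |x i| ≤ |y i| + ‖a‖ := by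
      have h1 : x i = y i + a i := by simp [y]
      have h2 : |a i| ≤ ‖a‖ := PiLp.norm_apply_le a i
      rw [h1]
      exact (abs_add_le _ _).trans (by linarith)
    by_cases hi : ‖a‖ ≤ |y i|
    · simp only [α', hi, if_true, Nat.sub_self, pow_zero, mul_one]
      rw [← mul_pow]
      exact pow_le_pow_left₀ (abs_nonneg _) (by linarith) _
    · simp only [α', hi, if_false, Nat.sub_zero, pow_zero, one_mul]
      rw [← mul_pow]
      push Not at hi
      exact pow_le_pow_left₀ (abs_nonneg _) (by linarith) _
  have hc : (∏ i, ‖a‖ ^ (α i - α' i)) * ((h / 2) ^ deg α' * mfact α' ^ t) ≤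
      K ^ d * ((h / 2) ^ deg α * mfact α ^ t) := by
    rw [← prod_weight, ← prod_weight, ← Finset.prod_mul_distrib]
    calc ∏ i, (‖a‖ ^ (α i - α' i) * ((h / 2) ^ α' i * ((α' i).factorial : ℝ) ^ t))
        ≤ ∏ i, (K * ((h / 2) ^ α i * ((α i).factorial : ℝ) ^ t)) := by
          refine Finset.prod_le_prod
            (fun i _ => mul_nonneg (by positivity) (hpos _).le) fun i _ => ?_
          by_cases hi : ‖a‖ ≤ |y i|
          · simp only [α', hi, if_true, Nat.sub_self, pow_zero, one_mul]
            exact le_mul_of_one_le_left (hpos _).le hK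
          · simpa [α', hi] using hA (α i)
      _ = _ := by rw [Finset.prod_mul_distrib]; simp
  have hβ : 0 ≤ (h / 2) ^ deg β * mfact β ^ s :=
    mul_nonneg (by positivity) (Real.rpow_nonneg (mfact_pos β).le s)
  have hp : 0 ≤ ∏ i, ‖a‖ ^ (α i - α' i) := Finset.prod_nonneg fun i _ => by positivity
  have hw' : |mono y α'| * ‖mderiv β f y‖ ≤ |C| * gsWeight t s (h / 2) α' β :=
    (hC α' β y).trans (mul_le_mul_of_nonneg_right (le_abs_self C) (gsWeight_pos t s hh2 _ _).le)
  calc |mono x α| * ‖mderiv β f (x - a)‖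
      ≤ (2 ^ deg α * (|mono y α'| * ∏ i, ‖a‖ ^ (α i - α' i))) * ‖mderiv β f y‖ :=
        mul_le_mul_of_nonneg_right hb (norm_nonneg _)
    _ = (2 ^ deg α * ∏ i, ‖a‖ ^ (α i - α' i)) * (|mono y α'| * ‖mderiv β f y‖) := by ring
    _ ≤ (2 ^ deg α * ∏ i, ‖a‖ ^ (α i - α' i)) * (|C| * gsWeight t s (h / 2) α' β) :=
        mul_le_mul_of_nonneg_left hw' (mul_nonneg (by positivity) hp)
    _ = 2 ^ deg α * |C| * ((h / 2) ^ deg β * mfact β ^ s) *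
          ((∏ i, ‖a‖ ^ (α i - α' i)) * ((h / 2) ^ deg α' * mfact α' ^ t)) := by
        rw [gsWeight, deg_add, pow_add]; ring
    _ ≤ 2 ^ deg α * |C| * ((h / 2) ^ deg β * mfact β ^ s) *
          (K ^ d * ((h / 2) ^ deg α * mfact α ^ t)) :=
        mul_le_mul_of_nonneg_left hc (mul_nonneg (by positivity) hβ)
    _ = |C| * K ^ d * ((2 * (h / 2)) ^ deg α * (h / 2) ^ deg β * mfact α ^ t * mfact β ^ s) := by
        rw [mul_pow 2 (h / 2)]; ring
    _ ≤ |C| * K ^ d * gsWeight t s h α β := by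
        have e7 : 2 * (h / 2) = h := by ring
        rw [e7, gsWeight, deg_add, pow_add]
        have e8 : (h / 2) ^ deg β ≤ h ^ deg β := by
          gcongr
          linarith
        have := Real.rpow_nonneg (mfact_pos α).le t
        have := Real.rpow_nonneg (mfact_pos β).le s
        gcongr

/-- The time-frequency shift `M_ξ T_x` on `Σ_t^s(ℝ^d)`. -/
def tfShift {d : ℕ} {t s : ℝ} (ht : 0 < t) (hs : 0 < s) (x ξ : E d) (ψ : GS d t s) : GS d t s :=
  ⟨modulate ξ (translate x ψ.fn), modulate_mem hs ξ (translate_mem ht x ψ.2)⟩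

/-- The short-time Fourier transform
`V_ψ u (x, ξ) = (2π) ^ (-d/2) (u, M_ξ T_x ψ)` of `u ∈ (Σ_t^s)'(ℝ^d)` with window `ψ`. -/
def stft {d : ℕ} {t s : ℝ} (ht : 0 < t) (hs : 0 < s) (ψ : GS d t s) (u : GSDual d t s)
    (x ξ : E d) : ℂ :=
  (((2 * Real.pi) ^ (-(d : ℝ) / 2) : ℝ) : ℂ) * u (tfShift ht hs x ξ ψ)

/-- The `t,s`-Gelfand-Shilov wave front set `WF^{t,s}(u)` of `u ∈ (Σ_t^s)'(ℝ^d)`, computed with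
the window `ψ`: a point `z ≠ 0` of phase space is outside it if `z` has an open neighbourhood
`U ⊆ T^*ℝ^d ∖ 0` such that
`sup_{λ > 0, (x, ξ) ∈ U} exp (r λ) |V_ψ u (λ ^ t x, λ ^ s ξ)| < ∞` for all `r > 0`. -/
def WF {d : ℕ} {t s : ℝ} (ht : 0 < t) (hs : 0 < s) (ψ : GS d t s) (u : GSDual d t s) :
    Set (E d × E d) :=
  {z | z ≠ 0 ∧ ¬ ∃ U : Set (E d × E d), IsOpen U ∧ U ⊆ {0}ᶜ ∧ z ∈ U ∧
    ∀ r : ℝ, 0 < r → ∃ C : ℝ, ∀ l : ℝ, 0 < l → ∀ p ∈ U,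
      Real.exp (r * l) * ‖stft ht hs ψ u (l ^ t • p.1) (l ^ s • p.2)‖ ≤ C}

/-- The Fourier transform `(2π) ^ (-d/2) ∫ φ(x) exp (-i ⟨x, ξ⟩) dx`. -/
def fourier {d : ℕ} (φ : E d → ℂ) (ξ : E d) : ℂ :=
  (((2 * Real.pi) ^ (-(d : ℝ) / 2) : ℝ) : ℂ) *
    ∫ x, φ x * Complex.exp (-Complex.I * ((inner ℝ x ξ : ℝ) : ℂ))

/-- The Fourier transform of the ultradistribution `u ∈ (Σ_t^s)'(ℝ^d)`, that is the
ultradistribution acting by `(û, φ̂) = (u, φ)`, is the continuous function `g`. -/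
def HasFourier {d : ℕ} {t s : ℝ} (u : GSDual d t s) (g : E d → ℂ) : Prop :=
  Continuous g ∧ ∀ φ : GS d t s,
    MeasureTheory.Integrable (fun ξ => g ξ * starRingEnd ℂ (fourier φ.fn ξ)) ∧
    u φ = ∫ ξ, g ξ * starRingEnd ℂ (fourier φ.fn ξ)

/-- The set `V_s(u) ⊆ ℝ^d ∖ 0`: a point `η ≠ 0` is outside it if `û` is a continuous function
such that `sup_{ξ ∈ Γ} exp (r |ξ| ^ (1/s)) |û(ξ)| < ∞` for all `r > 0`, for some open conic
set `Γ ⊆ ℝ^d ∖ 0` containing `η`. -/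
def V {d : ℕ} {t s : ℝ} (u : GSDual d t s) : Set (E d) :=
  {η | η ≠ 0 ∧ ¬ ∃ g : E d → ℂ, HasFourier u g ∧
    ∃ Γ : Set (E d), IsOpen Γ ∧ Γ ⊆ {0}ᶜ ∧ (∀ x ∈ Γ, ∀ l : ℝ, 0 < l → l • x ∈ Γ) ∧ η ∈ Γ ∧
      ∀ r : ℝ, 0 < r → ∃ C : ℝ, ∀ ξ ∈ Γ, Real.exp (r * ‖ξ‖ ^ (1 / s)) * ‖g ξ‖ ≤ C}

/-- `u = ∑ c_α D ^ α δ₀` in `(Σ_t^s)'(ℝ^d)`: the series converges to `u` (unconditionally) on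
every test function, where `(D ^ α δ₀, φ) = (δ₀, D ^ α φ) = conj (D ^ α φ (0))`. -/
def IsDiracSeries {d : ℕ} {t s : ℝ} (c : MIdx d → ℂ) (u : GSDual d t s) : Prop :=
  ∀ φ : GS d t s, HasSum (fun α => c α * starRingEnd ℂ (Dop α φ.fn 0)) (u φ)

/-- `F = ∑ c_α x ^ α` in `(Σ_t^s)'(ℝ^d)`: the series converges to `F` (unconditionally) on
every test function, where `(x ^ α, φ) = ∫ x ^ α conj (φ(x)) dx`. -/
def IsPowerSeries {d : ℕ} {t s : ℝ} (c : MIdx d → ℂ) (F : GSDual d t s) : Prop :=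
  ∀ φ : GS d t s, HasSum (fun α => c α * ∫ x, (mono x α : ℂ) * starRingEnd ℂ (φ.fn x)) (F φ)

/-- The ultradistribution `F` is the function `f`: `(F, φ) = ∫ f conj(φ)`. -/
def IsFunction {d : ℕ} {t s : ℝ} (F : GSDual d t s) (f : E d → ℂ) : Prop :=
  ∀ φ : GS d t s, MeasureTheory.Integrable (fun x => f x * starRingEnd ℂ (φ.fn x)) ∧
    F φ = ∫ x, f x * starRingEnd ℂ (φ.fn x)


/-- The sum `f (x) = ∑ c_α x ^ α` of the power series with coefficients `c`. -/
def powerSeriesSum {d : ℕ} (c : MIdx d → ℂ) (x : E d) : ℂ := ∑' α : MIdx d, c α * (mono x α : ℂ)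

/-- The set of directions in `ℝ^d ∖ 0` in which the function `f` fails to decay like
`exp (-r |x| ^ (1/s))` for all `r > 0`: a point `x₀ ≠ 0` is outside it if there is an open set
`U ⊆ ℝ^d ∖ 0` containing `x₀` such that
`sup_{x ∈ U, λ > 0} exp (r λ) |f (λ ^ s x)| < ∞` for all `r > 0`. -/
def nonDecay {d : ℕ} (s : ℝ) (f : E d → ℂ) : Set (E d) :=
  {x₀ | x₀ ≠ 0 ∧ ¬ ∃ U : Set (E d), IsOpen U ∧ U ⊆ {0}ᶜ ∧ x₀ ∈ U ∧
    ∀ r : ℝ, 0 < r → ∃ C : ℝ, ∀ x ∈ U, ∀ l : ℝ, 0 < l →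
      Real.exp (r * l) * ‖f (l ^ s • x)‖ ≤ C}

end GelfandShilov

end

/- Since `û` is a constant multiple of `f`, the set `V u` is read off the decay of `f`. Up to
unimodular factors and constants, the short-time Fourier transform of `u` is the windowed Fourier
transform `∫ f (x + z) ρ z exp (-i ⟨z, ξ⟩) dz` of `f`, with the roles of `x` and `ξ` exchanged and
`ρ` made from the Fourier transform of the window; that of `f` has the same form, with `ρ` made from
the window itself.

The smallness of the `c α` makes `f` and its derivatives grow sub-exponentially in `|x| ^ (1 / s)`,
so the windowed transform decays super-exponentially in `ξ` at sub-exponential cost in `x`: no point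
with `ξ₀ ≠ 0` is in the wave front set. At `(x₀, 0)` the windowed transform decays where `f` does,
because it is the integral of `f (x + z) ρ z` against a unimodular factor, and `f` decays where the
windowed transform does, by Fourier inversion in `ξ`. -/

noncomputable section

namespace GelfandShilov

open MeasureTheory

variable {d : ℕ}

theorem rpow_one_div_rpow {s y : ℝ} (hs : s ≠ 0) (hy : 0 ≤ y) : (y ^ (1 / s)) ^ s = y := by
  rw [← Real.rpow_mul hy, one_div_mul_cancel hs, Real.rpow_one]

theorem pow_eq_mul_pow_rpow {s h y : ℝ} (hs : s ≠ 0) (hh : 0 < h) (hy : 0 ≤ y) (n : ℕ) :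
    y ^ n = h ^ n * (((y / h) ^ (1 / s)) ^ n) ^ s := by
  have hyh : 0 ≤ y / h := div_nonneg hy hh.le
  rw [← Real.rpow_natCast (_ ^ _), ← Real.rpow_mul (Real.rpow_nonneg hyh _), mul_comm (n : ℝ),
    Real.rpow_mul (Real.rpow_nonneg hyh _), rpow_one_div_rpow hs hyh, Real.rpow_natCast, ← mul_pow,
    mul_div_cancel₀ _ hh.ne']

theorem pow_le_mul_factorial_rpow_mul_exp {s h y : ℝ} (hs : 0 < s) (hh : 0 < h) (hy : 0 ≤ y)
    (n : ℕ) :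
    y ^ n ≤ h ^ n * (n.factorial : ℝ) ^ s * Real.exp (s * (y / h) ^ (1 / s)) := by
  set q : ℝ := (y / h) ^ (1 / s)
  have hq0 : 0 ≤ q := Real.rpow_nonneg (div_nonneg hy hh.le) _
  have hfac : (0 : ℝ) < n.factorial := by exact_mod_cast n.factorial_pos
  have hpow : q ^ n ≤ n.factorial * Real.exp q :=
    (div_le_iff₀' hfac).1 (Real.pow_div_factorial_le_exp q hq0 n)
  calc y ^ n = h ^ n * (q ^ n) ^ s := pow_eq_mul_pow_rpow hs.ne' hh hy n
    _ ≤ h ^ n * (n.factorial * Real.exp q) ^ s := by gcongr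
    _ = h ^ n * (n.factorial : ℝ) ^ s * Real.exp (s * q) := by
      rw [Real.mul_rpow hfac.le (Real.exp_pos q).le, ← Real.exp_mul, mul_comm q, mul_assoc]

theorem exp_half_mul_le_of_pow_mul_le {q w C : ℝ}
    (hbound : ∀ n : ℕ, q ^ n * w ≤ C * n.factorial) : Real.exp (q / 2) * w ≤ C * 2 := by
  have hexp : HasSum (fun n : ℕ => (q / 2) ^ n / n.factorial * w) (Real.exp (q / 2) * w) := by
    rw [Real.exp_eq_exp_ℝ]
    exact (NormedSpace.expSeries_div_hasSum_exp (q / 2)).mul_right w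
  refine hasSum_le (fun n => ?_) hexp (hasSum_geometric_two.mul_left C)
  have hfac : (0 : ℝ) < n.factorial := by exact_mod_cast n.factorial_pos
  calc (q / 2) ^ n / n.factorial * w = q ^ n * w / n.factorial * (1 / 2) ^ n := by
        rw [div_pow, one_div, inv_pow]
        field_simp
    _ ≤ C * (1 / 2) ^ n := by
        gcongr
        exact (div_le_iff₀ hfac).2 (hbound n)

theorem le_exp_of_pow_mul_le {s h y v C : ℝ} (hs : 0 < s) (hh : 0 < h) (hy : 0 ≤ y) (hv : 0 ≤ v)
    (hC : 0 ≤ C) (hbound : ∀ n : ℕ, y ^ n * v ≤ C * (h ^ n * (n.factorial : ℝ) ^ s)) :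
    v ≤ 2 ^ s * C * Real.exp (-(s / 2) * (y / h) ^ (1 / s)) := by
  set q : ℝ := (y / h) ^ (1 / s) with hq
  have : 0 ≤ q := Real.rpow_nonneg (div_nonneg hy hh.le) _
  have hw0 : 0 ≤ v ^ (1 / s) := Real.rpow_nonneg hv _
  have hD0 : 0 ≤ C ^ (1 / s) := Real.rpow_nonneg hC _
  have hroot (n : ℕ) : q ^ n * v ^ (1 / s) ≤ C ^ (1 / s) * n.factorial := by
    rw [← Real.rpow_le_rpow_iff (by positivity) (by positivity) hs,
      Real.mul_rpow (by positivity) hw0, Real.mul_rpow hD0 (Nat.cast_nonneg _),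
      rpow_one_div_rpow hs.ne' hv, rpow_one_div_rpow hs.ne' hC]
    have hn := hbound n
    rw [pow_eq_mul_pow_rpow hs.ne' hh hy n, ← hq] at hn
    exact le_of_mul_le_mul_left (by linarith) (pow_pos hh n)
  have hexp := Real.rpow_le_rpow (by positivity) (exp_half_mul_le_of_pow_mul_le hroot) hs.le
  rw [Real.mul_rpow (Real.exp_pos _).le hw0, Real.mul_rpow hD0 zero_le_two,
    rpow_one_div_rpow hs.ne' hv, rpow_one_div_rpow hs.ne' hC, ← Real.exp_mul] at hexp
  rw [show -(s / 2) * q = -(q / 2 * s) by ring, Real.exp_neg, ← div_eq_mul_inv,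
    le_div_iff₀ (Real.exp_pos _)]
  linarith

theorem norm_add_rpow_le {X : Type*} [SeminormedAddCommGroup X] {p : ℝ} (hp : 0 ≤ p) (x y : X) :
    ‖x + y‖ ^ p ≤ 2 ^ p * (‖x‖ ^ p + ‖y‖ ^ p) := by
  wlog hxy : ‖y‖ ≤ ‖x‖ generalizing x y
  · rw [add_comm x, add_comm (‖x‖ ^ p)]
    exact this y x (le_of_not_ge hxy)
  calc ‖x + y‖ ^ p ≤ (2 * ‖x‖) ^ p := by
        gcongr
        linarith [norm_add_le x y]
    _ = 2 ^ p * ‖x‖ ^ p := Real.mul_rpow zero_le_two (norm_nonneg x)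
    _ ≤ 2 ^ p * (‖x‖ ^ p + ‖y‖ ^ p) := by
        gcongr
        exact le_add_of_nonneg_right (by positivity)

theorem integrable_exp_neg_mul_norm_rpow {X : Type*} [NormedAddCommGroup X] [NormedSpace ℝ X]
    [FiniteDimensional ℝ X] [MeasurableSpace X] [BorelSpace X] (μ : Measure X)
    [μ.IsAddHaarMeasure] {p r : ℝ} (hp : 0 < p) (hr : 0 < r) :
    Integrable (fun x => Real.exp (-r * ‖x‖ ^ p)) μ := by
  cases subsingleton_or_nontrivial X
  · exact (integrable_const (Real.exp (-r * ‖(0 : X)‖ ^ p))).congr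
      (.of_forall fun x => by rw [Subsingleton.elim x 0])
  · rw [integrable_fun_norm_addHaar μ (f := fun y => Real.exp (-r * y ^ p))]
    have hdim : (-1 : ℝ) < (Module.finrank ℝ X - 1 : ℕ) := by
      linarith [Nat.cast_nonneg (α := ℝ) (Module.finrank ℝ X - 1)]
    simpa using integrableOn_rpow_mul_exp_neg_mul_rpow hdim hp hr

theorem MIdx.induction {P : MIdx d → Prop} (zero : P 0)
    (add_single : ∀ γ j, P γ → P (γ + Pi.single j 1)) (γ : MIdx d) : P γ := by
  suffices h : ∀ δ, P δ → P (δ + γ) by simpa using h 0 zero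
  induction γ using Pi.single_induction with
  | zero => exact fun δ hδ => by simpa using hδ
  | add f g hf hg => exact fun δ hδ => add_assoc δ f g ▸ hg _ (hf δ hδ)
  | single i m =>
    intro δ hδ
    induction m with
    | zero => simpa using hδ
    | succ m ih => simpa only [Pi.single_add, add_assoc] using add_single _ i ih

theorem deg_zero : deg (0 : MIdx d) = 0 := by simp [deg]

theorem deg_single (i : Fin d) (n : ℕ) : deg (Pi.single i n : MIdx d) = n := by
  simp [deg]

theorem mfact_zero : mfact (0 : MIdx d) = 1 := by simp [mfact]

theorem mfact_single (i : Fin d) (n : ℕ) : mfact (Pi.single i n : MIdx d) = n.factorial := by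
  rw [mfact, Finset.prod_eq_single i (fun j _ hj => by simp [hj]) (by simp), Pi.single_eq_same]

theorem one_le_mfact (α : MIdx d) : 1 ≤ mfact α :=
  Finset.one_le_prod fun i _ => by exact_mod_cast (α i).factorial_pos

theorem mfact_le_mfact_add (α γ : MIdx d) : mfact α ≤ mfact (α + γ) :=
  Finset.prod_le_prod (fun _ _ => Nat.cast_nonneg _) fun i _ => by
    exact_mod_cast Nat.factorial_le (Nat.le_add_right (α i) (γ i))

theorem mfact_add_le (α γ : MIdx d) :
    mfact (α + γ) ≤ 2 ^ deg (α + γ) * mfact α * mfact γ := by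
  simp only [mfact, deg, ← Finset.prod_pow_eq_pow_sum, ← Finset.prod_mul_distrib]
  refine Finset.prod_le_prod (fun _ _ => Nat.cast_nonneg _) fun i _ => ?_
  rw [Pi.add_apply, ← Nat.add_choose_mul_factorial_mul_factorial]
  push_cast
  gcongr
  exact_mod_cast Nat.choose_le_two_pow _ _

theorem mono_zero (x : E d) : mono x 0 = 1 := by simp [mono]

theorem mono_single (x : E d) (i : Fin d) (n : ℕ) : mono x (Pi.single i n) = x i ^ n := by
  rw [mono, Finset.prod_eq_single i (fun j _ hj => by simp [hj]) (by simp), Pi.single_eq_same]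

theorem mono_add (x : E d) (α β : MIdx d) : mono x (α + β) = mono x α * mono x β := by
  simp [mono, pow_add, Finset.prod_mul_distrib]

theorem abs_mono_le_pow (x : E d) (α : MIdx d) : |mono x α| ≤ ‖x‖ ^ deg α := by
  rw [mono, Finset.abs_prod, deg, ← Finset.prod_pow_eq_pow_sum]
  refine Finset.prod_le_prod (fun i _ => abs_nonneg _) fun i _ => ?_
  rw [abs_pow]
  exact pow_le_pow_left₀ (abs_nonneg _) (PiLp.norm_apply_le x i) _

theorem abs_mono_le_exp {s h : ℝ} (hs : 0 < s) (hh : 0 < h) (x : E d) (α : MIdx d) :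
    |mono x α| ≤ h ^ deg α * mfact α ^ s * Real.exp (d * (s * (‖x‖ / h) ^ (1 / s))) := by
  calc |mono x α| ≤ ∏ i, ‖x‖ ^ α i := by
        rw [Finset.prod_pow_eq_pow_sum]
        exact abs_mono_le_pow x α
    _ ≤ ∏ i, (h ^ α i * ((α i).factorial : ℝ) ^ s * Real.exp (s * (‖x‖ / h) ^ (1 / s))) :=
        Finset.prod_le_prod (fun _ _ => by positivity) fun i _ =>
          pow_le_mul_factorial_rpow_mul_exp hs hh (norm_nonneg x) _
    _ = h ^ deg α * mfact α ^ s * Real.exp (d * (s * (‖x‖ / h) ^ (1 / s))) := by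
        rw [Finset.prod_mul_distrib, prod_weight]
        simp [← Real.exp_nat_mul]

theorem exists_norm_le_mul_abs_apply [NeZero d] (x : E d) : ∃ i, ‖x‖ ≤ d * |x i| := by
  obtain ⟨i, hi⟩ := Finite.exists_max fun i => |x i|
  refine ⟨i, ?_⟩
  calc ‖x‖ = ‖∑ j, x j • EuclideanSpace.basisFun (Fin d) ℝ j‖ := by
        conv_lhs => rw [← (EuclideanSpace.basisFun (Fin d) ℝ).sum_repr x]
        simp only [EuclideanSpace.basisFun_repr]
    _ ≤ ∑ j, ‖x j • EuclideanSpace.basisFun (Fin d) ℝ j‖ := norm_sum_le _ _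
    _ = ∑ j, |x j| := by simp [norm_smul]
    _ ≤ ∑ _j : Fin d, |x i| := Finset.sum_le_sum fun j _ => hi j
    _ = d * |x i| := by simp

theorem exists_le_exp_of_abs_mono_mul_le (d : ℕ) {s r : ℝ} (hs : 0 < s) (hr : 0 < r) :
    ∃ h > 0, ∃ K > 0, ∀ (x : E d) (v C : ℝ), 0 ≤ v → 0 ≤ C →
      (∀ α, |mono x α| * v ≤ C * (h ^ deg α * mfact α ^ s)) →
      v ≤ K * C * Real.exp (-r * ‖x‖ ^ (1 / s)) := by
  rcases Nat.eq_zero_or_pos d with rfl | hd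
  · refine ⟨1, one_pos, 1, one_pos, fun x v C _ _ hbound => ?_⟩
    have hv := hbound 0
    simpa [Subsingleton.elim x 0, mono, mfact, deg, Real.zero_rpow (inv_ne_zero hs.ne')] using hv
  have : NeZero d := ⟨hd.ne'⟩
  have : (0 : ℝ) < d := by exact_mod_cast hd
  -- the value of `b` for which `(s / 2) * (d |x i| b) ^ (1/s) = r * (d |x i|) ^ (1/s)`
  set b : ℝ := (2 * r / s) ^ s
  have hb : 0 < b := by positivity
  have hbs : b ^ (1 / s) = 2 * r / s := by
    rw [← Real.rpow_mul (by positivity), mul_one_div_cancel hs.ne', Real.rpow_one]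
  refine ⟨1 / (d * b), by positivity, 2 ^ s, by positivity, fun x v C hv hC hbound => ?_⟩
  obtain ⟨i, hi⟩ := exists_norm_le_mul_abs_apply x
  have hcoord := le_exp_of_pow_mul_le hs (h := 1 / (d * b)) (by positivity) (abs_nonneg (x i)) hv hC
    fun n => (by
      simpa only [mono_single, mfact_single, deg_single, abs_pow] using hbound (Pi.single i n))
  refine hcoord.trans (mul_le_mul_of_nonneg_left (Real.exp_le_exp.2 ?_) (by positivity))
  calc -(s / 2) * (|x i| / (1 / (d * b))) ^ (1 / s) = -(s / 2) * ((d * |x i|) * b) ^ (1 / s) := by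
        congr 2
        field_simp
    _ = -r * (d * |x i|) ^ (1 / s) := by
        rw [Real.mul_rpow (by positivity) hb.le, hbs]
        field_simp
    _ ≤ -r * ‖x‖ ^ (1 / s) :=
        mul_le_mul_of_nonpos_left (Real.rpow_le_rpow (norm_nonneg _) hi (by positivity))
          (neg_nonpos.2 hr.le)

theorem exists_abs_mono_le_exp (d : ℕ) {s ε : ℝ} (hs : 0 < s) (hε : 0 < ε) :
    ∃ R > 0, ∀ r ≥ R, ∀ (x : E d) (α : MIdx d),
      |mono x α| ≤ r ^ deg α * mfact α ^ s * Real.exp (ε * ‖x‖ ^ (1 / s)) := by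
  refine ⟨(d * s / ε) ^ s + 1, by positivity, fun r hr x α => ?_⟩
  have hr0 : 0 < r := lt_of_lt_of_le (by positivity) hr
  have hroot : d * s / ε ≤ r ^ (1 / s) :=
    calc d * s / ε = ((d * s / ε) ^ s) ^ (1 / s) := by
          rw [← Real.rpow_mul (by positivity), mul_one_div_cancel hs.ne', Real.rpow_one]
      _ ≤ r ^ (1 / s) := by
          gcongr
          linarith
  refine (abs_mono_le_exp hs hr0 x α).trans (mul_le_mul_of_nonneg_left (Real.exp_le_exp.2 ?_) ?_)
  · calc d * (s * (‖x‖ / r) ^ (1 / s)) = d * s * ‖x‖ ^ (1 / s) / r ^ (1 / s) := by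
          rw [Real.div_rpow (norm_nonneg x) hr0.le]
          ring
      _ ≤ ε * r ^ (1 / s) * ‖x‖ ^ (1 / s) / r ^ (1 / s) := by
          refine div_le_div_of_nonneg_right (mul_le_mul_of_nonneg_right ?_ (by positivity))
            (by positivity)
          exact (div_le_iff₀' hε).1 hroot
      _ = ε * ‖x‖ ^ (1 / s) := by
          field_simp
  · exact mul_nonneg (by positivity) (Real.rpow_nonneg (mfact_pos α).le s)

theorem mfact_add_single (α : MIdx d) (j : Fin d) :
    mfact (α + Pi.single j 1) = (α j + 1) * mfact α := by
  have hrest : ∏ i ∈ Finset.univ.erase j, (((α + Pi.single j 1 : MIdx d) i).factorial : ℝ) =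
      ∏ i ∈ Finset.univ.erase j, ((α i).factorial : ℝ) :=
    Finset.prod_congr rfl fun i hi => by simp [Finset.ne_of_mem_erase hi]
  rw [mfact, mfact, ← Finset.mul_prod_erase _ _ (Finset.mem_univ j), hrest,
    ← Finset.mul_prod_erase _ _ (Finset.mem_univ j), ← mul_assoc]
  simp [Nat.factorial_succ]

/-- The condition `∑ |c_α| r ^ |α| α! ^ s < ∞` for all `r > 0`. For `s = 0` it says that `c` is
the coefficient family of an entire power series. -/
def SmallCoeff (s : ℝ) (c : MIdx d → ℂ) : Prop :=
  ∀ r : ℝ, 0 < r → Summable fun α => ‖c α‖ * r ^ deg α * mfact α ^ s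

/-- The weighted `ℓ¹` norm `∑ |c_α| r ^ |α| α! ^ s`. -/
def coeffNorm (s r : ℝ) (c : MIdx d → ℂ) : ℝ := ∑' α, ‖c α‖ * r ^ deg α * mfact α ^ s

/-- The coefficients `((α + γ)! / α!) c_{α + γ}` of the derivative `∂ ^ γ` of a power series. -/
def derivCoeff (γ : MIdx d) (c : MIdx d → ℂ) : MIdx d → ℂ :=
  fun α => ((mfact (α + γ) / mfact α : ℝ) : ℂ) * c (α + γ)

section Coefficients

variable {s t r : ℝ} {c : MIdx d → ℂ}

theorem coeff_term_nonneg (s : ℝ) (hr : 0 ≤ r) (c : MIdx d → ℂ) (α : MIdx d) :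
    0 ≤ ‖c α‖ * r ^ deg α * mfact α ^ s :=
  mul_nonneg (by positivity) (Real.rpow_nonneg (mfact_pos α).le s)

theorem coeffNorm_nonneg (s : ℝ) (hr : 0 ≤ r) (c : MIdx d → ℂ) : 0 ≤ coeffNorm s r c :=
  tsum_nonneg (coeff_term_nonneg s hr c)

theorem SmallCoeff.of_le (hc : SmallCoeff s c) (hts : t ≤ s) : SmallCoeff t c := fun r hr =>
  .of_nonneg_of_le (coeff_term_nonneg t hr.le c)
    (fun α => mul_le_mul_of_nonneg_left
      (Real.rpow_le_rpow_of_exponent_le (one_le_mfact α) hts) (by positivity)) (hc r hr)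

theorem SmallCoeff.summable_norm_mul_pow (hc : SmallCoeff 0 c) (hr : 0 < r) :
    Summable fun α => ‖c α‖ * r ^ deg α := by
  simpa using hc r hr

theorem derivCoeff_zero (c : MIdx d → ℂ) : derivCoeff 0 c = c := by
  funext α
  simp [derivCoeff, div_self (mfact_pos α).ne']

theorem derivCoeff_single (j : Fin d) (c : MIdx d → ℂ) (α : MIdx d) :
    derivCoeff (Pi.single j 1) c α = (α j + 1 : ℝ) * c (α + Pi.single j 1) := by
  rw [derivCoeff, mfact_add_single, mul_div_cancel_right₀ _ (mfact_pos α).ne']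

theorem derivCoeff_derivCoeff (γ δ : MIdx d) (c : MIdx d → ℂ) :
    derivCoeff γ (derivCoeff δ c) = derivCoeff (γ + δ) c := by
  funext α
  have hα : (mfact α : ℂ) ≠ 0 := Complex.ofReal_ne_zero.2 (mfact_pos α).ne'
  have hαγ : (mfact (α + γ) : ℂ) ≠ 0 := Complex.ofReal_ne_zero.2 (mfact_pos _).ne'
  simp only [derivCoeff, ← add_assoc, Complex.ofReal_div]
  field_simp

theorem mfact_add_div_mul_rpow_le (ht : 0 ≤ t) (hst : 1 ≤ s + t) (α γ : MIdx d) :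
    mfact (α + γ) / mfact α * mfact α ^ s ≤
      (2 ^ t) ^ deg (α + γ) * mfact γ ^ t * mfact (α + γ) ^ s := by
  have hα := mfact_pos α
  have hγ := mfact_pos γ
  set q : ℝ := mfact (α + γ) / mfact α
  have hq : 1 ≤ q := (one_le_div hα).2 (mfact_le_mfact_add α γ)
  have hq0 : 0 < q := one_pos.trans_le hq
  have hsplit : mfact (α + γ) ^ s = q ^ s * mfact α ^ s := by
    rw [← Real.mul_rpow hq0.le hα.le, div_mul_cancel₀ _ hα.ne']
  calc q * mfact α ^ s = q ^ (1 - s) * mfact (α + γ) ^ s := by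
        rw [hsplit, ← mul_assoc, ← Real.rpow_add hq0, sub_add_cancel, Real.rpow_one]
    _ ≤ q ^ t * mfact (α + γ) ^ s := by
        refine mul_le_mul_of_nonneg_right ?_ (Real.rpow_nonneg (mfact_pos _).le s)
        exact Real.rpow_le_rpow_of_exponent_le hq (by linarith)
    _ ≤ (2 ^ deg (α + γ) * mfact γ) ^ t * mfact (α + γ) ^ s := by
        refine mul_le_mul_of_nonneg_right (Real.rpow_le_rpow hq0.le ?_ ht)
          (Real.rpow_nonneg (mfact_pos _).le s)
        rw [div_le_iff₀ hα, mul_right_comm]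
        exact mfact_add_le α γ
    _ = (2 ^ t) ^ deg (α + γ) * mfact γ ^ t * mfact (α + γ) ^ s := by
        rw [Real.mul_rpow (by positivity) hγ.le, Real.rpow_pow_comm zero_le_two]

theorem norm_derivCoeff_term_le (ht : 0 ≤ t) (hst : 1 ≤ s + t) (hr : 0 < r) (γ : MIdx d)
    (c : MIdx d → ℂ) (α : MIdx d) :
    ‖derivCoeff γ c α‖ * r ^ deg α * mfact α ^ s ≤ r⁻¹ ^ deg γ * mfact γ ^ t *
      (‖c (α + γ)‖ * (2 ^ t * r) ^ deg (α + γ) * mfact (α + γ) ^ s) := by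
  have hq : 0 ≤ mfact (α + γ) / mfact α := (div_pos (mfact_pos _) (mfact_pos _)).le
  calc ‖derivCoeff γ c α‖ * r ^ deg α * mfact α ^ s
      = ‖c (α + γ)‖ * r ^ deg α * (mfact (α + γ) / mfact α * mfact α ^ s) := by
        rw [derivCoeff, norm_mul, Complex.norm_real, Real.norm_of_nonneg hq]
        ring
    _ ≤ ‖c (α + γ)‖ * r ^ deg α *
          ((2 ^ t) ^ deg (α + γ) * mfact γ ^ t * mfact (α + γ) ^ s) := by
        exact mul_le_mul_of_nonneg_left (mfact_add_div_mul_rpow_le ht hst α γ) (by positivity)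
    _ = r⁻¹ ^ deg γ * mfact γ ^ t *
          (‖c (α + γ)‖ * (2 ^ t * r) ^ deg (α + γ) * mfact (α + γ) ^ s) := by
        rw [mul_pow _ r, deg_add, pow_add r, inv_pow]
        field_simp

theorem SmallCoeff.deriv (ht : 0 ≤ t) (hst : 1 ≤ s + t) (hc : SmallCoeff s c)
    (γ : MIdx d) : SmallCoeff s (derivCoeff γ c) := fun r hr =>
  .of_nonneg_of_le (coeff_term_nonneg s hr.le _) (norm_derivCoeff_term_le ht hst hr γ c)
    (((hc (2 ^ t * r) (by positivity)).comp_injective (add_left_injective γ)).mul_left _)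

theorem SmallCoeff.deriv_of_zero (hc : SmallCoeff 0 c) (γ : MIdx d) :
    SmallCoeff 0 (derivCoeff γ c) :=
  hc.deriv (t := 1) zero_le_one (by norm_num) γ

theorem coeffNorm_derivCoeff_le (ht : 0 ≤ t) (hst : 1 ≤ s + t) (hr : 0 < r)
    (hc : SmallCoeff s c) (γ : MIdx d) :
    coeffNorm s r (derivCoeff γ c) ≤ r⁻¹ ^ deg γ * mfact γ ^ t * coeffNorm s (2 ^ t * r) c := by
  have hsum := hc (2 ^ t * r) (by positivity)
  have hshift := hsum.comp_injective (add_left_injective γ)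
  calc coeffNorm s r (derivCoeff γ c)
      ≤ r⁻¹ ^ deg γ * mfact γ ^ t *
          ∑' α, ‖c (α + γ)‖ * (2 ^ t * r) ^ deg (α + γ) * mfact (α + γ) ^ s := by
        rw [← tsum_mul_left]
        exact (hc.deriv ht hst γ r hr).tsum_le_tsum
          (norm_derivCoeff_term_le ht hst hr γ c) (hshift.mul_left _)
    _ ≤ r⁻¹ ^ deg γ * mfact γ ^ t * coeffNorm s (2 ^ t * r) c := by
        refine mul_le_mul_of_nonneg_left ?_
          (mul_nonneg (by positivity) (Real.rpow_nonneg (mfact_pos γ).le t))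
        exact tsum_comp_le_tsum_of_inj hsum (coeff_term_nonneg s (by positivity) c)
          (add_left_injective γ)

end Coefficients

/-- The `j`-th coordinate as a complex valued real linear form. -/
def coordCLM (j : Fin d) : E d →L[ℝ] ℂ :=
  Complex.ofRealCLM.comp (EuclideanSpace.proj j)

theorem norm_coordCLM_le (j : Fin d) : ‖(coordCLM j : E d →L[ℝ] ℂ)‖ ≤ 1 := by
  refine ContinuousLinearMap.opNorm_le_bound _ zero_le_one fun v => ?_
  simpa [coordCLM] using PiLp.norm_apply_le v j

theorem hasFDerivAt_mono (α : MIdx d) (x : E d) :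
    HasFDerivAt (fun y : E d => (mono y α : ℂ))
      (∑ j, ((α j * mono x (α - Pi.single j 1) : ℝ) : ℂ) • coordCLM j) x := by
  have hpow (i : Fin d) : HasFDerivAt (fun y : E d => y i ^ α i)
      ((α i * x i ^ (α i - 1)) • (EuclideanSpace.proj i : E d →L[ℝ] ℝ)) x := by
    simpa using ((EuclideanSpace.proj i : E d →L[ℝ] ℝ).hasFDerivAt (x := x)).pow (α i)
  have hreal : HasFDerivAt (fun y : E d => mono y α)
      (∑ j, (α j * mono x (α - Pi.single j 1)) •
        (EuclideanSpace.proj j : E d →L[ℝ] ℝ)) x := by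
    refine (HasFDerivAt.finsetProd fun i _ => hpow i).congr_fderiv ?_
    refine Finset.sum_congr rfl fun j _ => ?_
    have herase : ∏ i ∈ Finset.univ.erase j, x i ^ (α - Pi.single j 1 : MIdx d) i =
        ∏ i ∈ Finset.univ.erase j, x i ^ α i :=
      Finset.prod_congr rfl fun i hi => by simp [Finset.ne_of_mem_erase hi]
    rw [smul_smul, mono, ← Finset.mul_prod_erase _ _ (Finset.mem_univ j), herase,
      Pi.sub_apply, Pi.single_eq_same]
    congr 1
    ring
  refine (Complex.ofRealCLM.hasFDerivAt.comp x hreal).congr_fderiv ?_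
  ext v
  simp [coordCLM]

theorem norm_sum_deriv_mono_smul_le {R : ℝ} (hR : 1 ≤ R) {x : E d} (hx : ‖x‖ ≤ R) (α : MIdx d) :
    ‖∑ j, ((α j * mono x (α - Pi.single j 1) : ℝ) : ℂ) • (coordCLM j : E d →L[ℝ] ℂ)‖ ≤
      (2 * R) ^ deg α := by
  have hmono (j : Fin d) : |mono x (α - Pi.single j 1)| ≤ R ^ deg α :=
    calc |mono x (α - Pi.single j 1)| ≤ ‖x‖ ^ deg (α - Pi.single j 1) := abs_mono_le_pow x _
      _ ≤ R ^ deg (α - Pi.single j 1) := by gcongr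
      _ ≤ R ^ deg α := pow_le_pow_right₀ hR (Finset.sum_le_sum fun i _ => Nat.sub_le _ _)
  calc ‖∑ j, ((α j * mono x (α - Pi.single j 1) : ℝ) : ℂ) • (coordCLM j : E d →L[ℝ] ℂ)‖
      ≤ ∑ j, α j * R ^ deg α := by
        refine norm_sum_le_of_le _ fun j _ => ?_
        rw [norm_smul, Complex.norm_real, norm_mul, Real.norm_natCast, Real.norm_eq_abs]
        refine (mul_le_of_le_one_right (by positivity) (norm_coordCLM_le j)).trans ?_
        gcongr
        exact hmono j
    _ = deg α * R ^ deg α := by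
        rw [← Finset.sum_mul, deg, Nat.cast_sum]
    _ ≤ (2 * R) ^ deg α := by
        rw [mul_pow]
        gcongr
        exact_mod_cast Nat.lt_two_pow_self.le

theorem SmallCoeff.summable {c : MIdx d → ℂ} (hc : SmallCoeff 0 c) (x : E d) :
    Summable fun α => c α * (mono x α : ℂ) := by
  refine .of_norm_bounded (hc.summable_norm_mul_pow (r := ‖x‖ + 1) (by positivity)) fun α => ?_
  rw [norm_mul, Complex.norm_real, Real.norm_eq_abs]
  gcongr
  exact (abs_mono_le_pow x α).trans (by gcongr; linarith)

theorem hasSum_mul_deriv_mono {c : MIdx d → ℂ} (hc : SmallCoeff 0 c) (j : Fin d) (x : E d) :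
    HasSum (fun α => c α * ((α j * mono x (α - Pi.single j 1) : ℝ) : ℂ))
      (powerSeriesSum (derivCoeff (Pi.single j 1) c) x) := by
  have hinj := add_left_injective (Pi.single j 1 : MIdx d)
  rw [← hinj.hasSum_iff]
  · have hsum : HasSum _ (powerSeriesSum (derivCoeff (Pi.single j 1) c) x) :=
      ((hc.deriv_of_zero _).summable x).hasSum
    convert hsum using 2 with α
    simp only [Function.comp_apply, derivCoeff_single, add_tsub_cancel_right, Pi.add_apply,
      Pi.single_eq_same]
    push_cast
    ring
  · intro α hα
    have hαj : α j = 0 := by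
      by_contra hne
      refine hα ⟨α - Pi.single j 1, tsub_add_cancel_of_le fun i => ?_⟩
      rcases eq_or_ne i j with rfl | hij
      · simpa using Nat.one_le_iff_ne_zero.2 hne
      · simp [hij]
    simp [hαj]

theorem SmallCoeff.hasFDerivAt {c : MIdx d → ℂ} (hc : SmallCoeff 0 c) (x : E d) :
    HasFDerivAt (powerSeriesSum c)
      (∑ j, powerSeriesSum (derivCoeff (Pi.single j 1) c) x • coordCLM j) x := by
  set R : ℝ := ‖x‖ + 1
  have hR : 1 ≤ R := le_add_of_nonneg_left (norm_nonneg x)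
  have hx : x ∈ Metric.ball (0 : E d) R := by simp [R]
  have hsum : HasSum (fun α => c α • ∑ j, ((α j * mono x (α - Pi.single j 1) : ℝ) : ℂ) •
      (coordCLM j : E d →L[ℝ] ℂ))
      (∑ j, powerSeriesSum (derivCoeff (Pi.single j 1) c) x • coordCLM j) := by
    simp only [Finset.smul_sum, smul_smul]
    exact hasSum_sum fun j _ => (hasSum_mul_deriv_mono hc j x).smul_const _
  rw [← hsum.tsum_eq]
  refine hasFDerivAt_tsum_of_isPreconnected (hc.summable_norm_mul_pow (r := 2 * R) (by positivity))
    Metric.isOpen_ball (convex_ball (0 : E d) R).isPreconnected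
    (fun α y _ => (hasFDerivAt_mono α y).const_mul (c α)) (fun α y hy => ?_) hx (hc.summable x) hx
  rw [norm_smul]
  gcongr
  exact norm_sum_deriv_mono_smul_le hR (mem_ball_zero_iff.1 hy).le α

theorem SmallCoeff.contDiff {c : MIdx d → ℂ} (hc : SmallCoeff 0 c) :
    ContDiff ℝ ∞ (powerSeriesSum c) := by
  refine contDiff_infty.2 fun n => ?_
  induction n generalizing c with
  | zero =>
    exact contDiff_zero.2 (continuous_iff_continuousAt.2 fun x => (hc.hasFDerivAt x).continuousAt)
  | succ n ih =>
    rw [Nat.cast_add, Nat.cast_one, contDiff_succ_iff_hasFDerivAt]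
    exact ⟨_, ContDiff.sum fun j _ => (ih (hc.deriv_of_zero _)).smul contDiff_const,
      hc.hasFDerivAt⟩

theorem mderiv_zero (f : E d → ℂ) : mderiv 0 f = f := by
  suffices h : ∀ L : List (Fin d), listDeriv L 0 f = f from h _
  intro L
  induction L with
  | nil => rfl
  | cons _ _ ih => exact ih

theorem SmallCoeff.mderiv_powerSeriesSum (γ : MIdx d) {c : MIdx d → ℂ} (hc : SmallCoeff 0 c) :
    mderiv γ (powerSeriesSum c) = powerSeriesSum (derivCoeff γ c) := by
  induction γ using MIdx.induction generalizing c with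
  | zero => rw [mderiv_zero, derivCoeff_zero]
  | add_single γ j ih =>
    have hpderiv :
        pderiv j (powerSeriesSum c) = powerSeriesSum (derivCoeff (Pi.single j 1) c) := by
      funext x
      simp [pderiv, (hc.hasFDerivAt x).fderiv, coordCLM, apply_ite]
    rw [← mderiv_pderiv γ j hc.contDiff, hpderiv, ih (hc.deriv_of_zero _),
      derivCoeff_derivCoeff]

theorem norm_powerSeriesSum_le {s r B : ℝ} (hr : 0 < r) {c : MIdx d → ℂ} (hc : SmallCoeff s c)
    {x : E d} (hx : ∀ α, |mono x α| ≤ r ^ deg α * mfact α ^ s * B) :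
    ‖powerSeriesSum c x‖ ≤ coeffNorm s r c * B := by
  rw [coeffNorm, ← tsum_mul_right]
  refine tsum_of_norm_bounded ((hc r hr).mul_right B).hasSum fun α => ?_
  rw [norm_mul, Complex.norm_real, Real.norm_eq_abs, mul_assoc, mul_assoc, ← mul_assoc (r ^ _)]
  exact mul_le_mul_of_nonneg_left (hx α) (norm_nonneg _)

theorem SmallCoeff.exists_norm_mderiv_le {s t ε h : ℝ} (hs : 0 < s) (ht : 0 ≤ t)
    (hst : 1 ≤ s + t) (hε : 0 < ε) (hh : 0 < h) {c : MIdx d → ℂ} (hc : SmallCoeff s c) :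
    ∃ C ≥ 0, ∀ (γ : MIdx d) (x : E d), ‖mderiv γ (powerSeriesSum c) x‖ ≤
      C * (h ^ deg γ * mfact γ ^ t) * Real.exp (ε * ‖x‖ ^ (1 / s)) := by
  obtain ⟨R, hR, hmono⟩ := exists_abs_mono_le_exp d hs hε
  set r : ℝ := max R h⁻¹
  have hr : 0 < r := lt_max_of_lt_left hR
  have hrh : r⁻¹ ≤ h := inv_le_of_inv_le₀ hh (le_max_right _ _)
  refine ⟨coeffNorm s (2 ^ t * r) c, coeffNorm_nonneg s (by positivity) c, fun γ x => ?_⟩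
  rw [(hc.of_le hs.le).mderiv_powerSeriesSum]
  have hC := coeffNorm_nonneg s (r := 2 ^ t * r) (by positivity) c
  have hγ := Real.rpow_nonneg (mfact_pos γ).le t
  calc ‖powerSeriesSum (derivCoeff γ c) x‖
      ≤ coeffNorm s r (derivCoeff γ c) * Real.exp (ε * ‖x‖ ^ (1 / s)) :=
        norm_powerSeriesSum_le hr (hc.deriv ht hst γ) (hmono r (le_max_left _ _) x)
    _ ≤ r⁻¹ ^ deg γ * mfact γ ^ t * coeffNorm s (2 ^ t * r) c *
          Real.exp (ε * ‖x‖ ^ (1 / s)) := by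
        gcongr
        exact coeffNorm_derivCoeff_le ht hst hr hc γ
    _ ≤ coeffNorm s (2 ^ t * r) c * (h ^ deg γ * mfact γ ^ t) *
          Real.exp (ε * ‖x‖ ^ (1 / s)) := by
        rw [mul_comm (coeffNorm _ _ _)]
        gcongr

section Decay

variable {X : Type*} [NormedAddCommGroup X] {s : ℝ} {f ρ : X → ℂ}

/-- Continuous functions that are `O(exp (-r ‖x‖ ^ (1/s)))` for every `r > 0`, the decay of the
elements of `Σ_s^t` and of the Fourier transforms of the elements of `Σ_t^s`. -/
structure SuperExpDecay (s : ℝ) (ρ : X → ℂ) : Prop where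
  continuous : Continuous ρ
  bound : ∀ r > 0, ∃ C ≥ 0, ∀ x, ‖ρ x‖ ≤ C * Real.exp (-r * ‖x‖ ^ (1 / s))

/-- Continuous functions that are `O(exp (ε ‖x‖ ^ (1/s)))` for every `ε > 0`; they act on `Σ_s^t`
by integration. -/
structure SubExpGrowth (s : ℝ) (f : X → ℂ) : Prop where
  continuous : Continuous f
  bound : ∀ ε > 0, ∃ C ≥ 0, ∀ x, ‖f x‖ ≤ C * Real.exp (ε * ‖x‖ ^ (1 / s))

theorem SuperExpDecay.integrable [NormedSpace ℝ X] [FiniteDimensional ℝ X] [MeasurableSpace X]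
    [BorelSpace X] (μ : Measure X) [μ.IsAddHaarMeasure] (hs : 0 < s) (hρ : SuperExpDecay s ρ) :
    Integrable ρ μ := by
  obtain ⟨C, -, hC⟩ := hρ.bound 1 one_pos
  exact ((integrable_exp_neg_mul_norm_rpow μ (one_div_pos.2 hs) one_pos).const_mul C).mono'
    hρ.continuous.aestronglyMeasurable (.of_forall hC)

theorem SuperExpDecay.conj (hρ : SuperExpDecay s ρ) :
    SuperExpDecay s (fun x => starRingEnd ℂ (ρ x)) where
  continuous := Complex.continuous_conj.comp hρ.continuous
  bound r hr := by simpa using hρ.bound r hr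

theorem SubExpGrowth.mul_decay (hf : SubExpGrowth s f) (hρ : SuperExpDecay s ρ) :
    SuperExpDecay s (fun x => f x * ρ x) where
  continuous := hf.continuous.mul hρ.continuous
  bound r hr := by
    obtain ⟨A, hA, hfA⟩ := hf.bound 1 one_pos
    obtain ⟨B, hB, hρB⟩ := hρ.bound (r + 1) (by positivity)
    refine ⟨A * B, by positivity, fun x => ?_⟩
    calc ‖f x * ρ x‖
        ≤ A * Real.exp (1 * ‖x‖ ^ (1 / s)) * (B * Real.exp (-(r + 1) * ‖x‖ ^ (1 / s))) := by
          rw [norm_mul]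
          exact mul_le_mul (hfA x) (hρB x) (norm_nonneg _) (by positivity)
      _ = A * B * Real.exp (-r * ‖x‖ ^ (1 / s)) := by
          rw [mul_mul_mul_comm, ← Real.exp_add]
          ring_nf

end Decay

theorem continuous_mono (α : MIdx d) : Continuous fun x : E d => mono x α := by
  unfold mono
  fun_prop

theorem subExpGrowth_mono {s : ℝ} (hs : 0 < s) (α : MIdx d) :
    SubExpGrowth s fun x : E d => (mono x α : ℂ) where
  continuous := Complex.continuous_ofReal.comp (continuous_mono α)
  bound ε hε := by
    obtain ⟨R, hR, hmono⟩ := exists_abs_mono_le_exp d hs hε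
    have := Real.rpow_nonneg (mfact_pos α).le s
    refine ⟨R ^ deg α * mfact α ^ s, by positivity, fun x => ?_⟩
    rw [Complex.norm_real, Real.norm_eq_abs]
    exact hmono R le_rfl x α

theorem SmallCoeff.subExpGrowth {s : ℝ} (hs : 0 < s) {c : MIdx d → ℂ} (hc : SmallCoeff s c) :
    SubExpGrowth s (powerSeriesSum c) where
  continuous := (hc.of_le hs.le).contDiff.continuous
  bound ε hε := by
    obtain ⟨R, hR, hmono⟩ := exists_abs_mono_le_exp d hs hε
    exact ⟨coeffNorm s R c, coeffNorm_nonneg s hR.le c, fun x =>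
      norm_powerSeriesSum_le hR hc (hmono R le_rfl x)⟩

theorem hasSum_integral_powerSeriesSum {s : ℝ} (hs : 0 < s) {c : MIdx d → ℂ}
    (hc : SmallCoeff s c) {ρ : E d → ℂ} (hρ : SuperExpDecay s ρ) :
    HasSum (fun α => c α * ∫ x, (mono x α : ℂ) * ρ x) (∫ x, powerSeriesSum c x * ρ x) := by
  obtain ⟨R, hR, hmono⟩ := exists_abs_mono_le_exp d hs one_pos
  obtain ⟨C, _, hρC⟩ := hρ.bound 2 two_pos
  set w : E d → ℝ := fun x => C * Real.exp (-1 * ‖x‖ ^ (1 / s))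
  have hw : Integrable w :=
    (integrable_exp_neg_mul_norm_rpow _ (one_div_pos.2 hs) one_pos).const_mul C
  have hbound (α : MIdx d) (x : E d) :
      ‖c α * ((mono x α : ℂ) * ρ x)‖ ≤ ‖c α‖ * R ^ deg α * mfact α ^ s * w x := by
    have hα := Real.rpow_nonneg (mfact_pos α).le s
    calc ‖c α * ((mono x α : ℂ) * ρ x)‖ = ‖c α‖ * (|mono x α| * ‖ρ x‖) := by
          rw [norm_mul, norm_mul, Complex.norm_real, Real.norm_eq_abs]
      _ ≤ ‖c α‖ * (R ^ deg α * mfact α ^ s * Real.exp (1 * ‖x‖ ^ (1 / s)) *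
            (C * Real.exp (-2 * ‖x‖ ^ (1 / s)))) := by
          gcongr
          exacts [hmono R le_rfl x α, hρC x]
      _ = ‖c α‖ * R ^ deg α * mfact α ^ s *
            (C * (Real.exp (1 * ‖x‖ ^ (1 / s)) * Real.exp (-2 * ‖x‖ ^ (1 / s)))) := by ring
      _ = ‖c α‖ * R ^ deg α * mfact α ^ s * w x := by
          rw [← Real.exp_add, ← add_mul]
          norm_num [w]
  have hint (α : MIdx d) : Integrable fun x => c α * ((mono x α : ℂ) * ρ x) :=
    ((((subExpGrowth_mono hs α).mul_decay hρ).integrable _ hs).const_mul _)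
  have hsum : Summable fun α => ∫ x, ‖c α * ((mono x α : ℂ) * ρ x)‖ := by
    refine Summable.of_nonneg_of_le (fun α => integral_nonneg fun x => norm_nonneg _)
      (fun α => ?_) ((hc R hR).mul_right (∫ x, w x))
    rw [← integral_const_mul]
    exact integral_mono (hint α).norm (hw.const_mul _) (hbound α)
  have hswap := hasSum_integral_of_summable_integral_norm hint hsum
  have htsum (x : E d) : ∑' α, c α * ((mono x α : ℂ) * ρ x) = powerSeriesSum c x * ρ x := by
    simp_rw [← mul_assoc, tsum_mul_right, powerSeriesSum]
  simpa only [htsum, integral_const_mul] using hswap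

section Fourier

open scoped FourierTransform

/-- The normalizing constant `(2π) ^ (-d/2)` of the unitary Fourier transform. -/
def fourierConst (d : ℕ) : ℝ := (2 * Real.pi) ^ (-(d : ℝ) / 2)

theorem fourierConst_pos (d : ℕ) : 0 < fourierConst d :=
  Real.rpow_pos_of_pos Real.two_pi_pos _

theorem fourierConst_le_one (d : ℕ) : fourierConst d ≤ 1 :=
  Real.rpow_le_one_of_one_le_of_nonpos (by linarith [Real.pi_gt_three])
    (div_nonpos_of_nonpos_of_nonneg (neg_nonpos.2 d.cast_nonneg) two_pos.le)

theorem fourierConst_mul_self_mul_pow (d : ℕ) :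
    fourierConst d * fourierConst d * (2 * Real.pi) ^ d = 1 := by
  rw [fourierConst, ← Real.rpow_add Real.two_pi_pos, ← Real.rpow_natCast,
    ← Real.rpow_add Real.two_pi_pos]
  ring_nf
  exact Real.rpow_zero _

theorem norm_fourierConst_mul_le (d : ℕ) (z : ℂ) : ‖(fourierConst d : ℂ) * z‖ ≤ ‖z‖ := by
  rw [norm_mul, Complex.norm_real, Real.norm_of_nonneg (fourierConst_pos d).le]
  exact mul_le_of_le_one_left (norm_nonneg z) (fourierConst_le_one d)

theorem integrable_modulate (ξ : E d) {φ : E d → ℂ} (hφ : Integrable φ) :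
    Integrable (modulate ξ φ) :=
  hφ.norm.mono' ((contDiff_phase ξ).continuous.aestronglyMeasurable.mul hφ.aestronglyMeasurable)
    (.of_forall fun y => (norm_modulate ξ φ y).le)

theorem fourier_eq_integral_modulate (φ : E d → ℂ) (ξ : E d) :
    fourier φ ξ = (fourierConst d : ℂ) * ∫ x, modulate (-ξ) φ x := by
  simp only [fourier, fourierConst, modulate, inner_neg_right, Complex.ofReal_neg, neg_mul,
    mul_neg, mul_comm (φ _)]

theorem fourier_eq_scaled (φ : E d → ℂ) (ξ : E d) :
    fourier φ ξ = (fourierConst d : ℂ) * 𝓕 φ ((2 * Real.pi)⁻¹ • ξ) := by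
  rw [fourier_eq_integral_modulate, Real.fourier_eq']
  congr 2 with x
  rw [modulate, smul_eq_mul, inner_neg_right, inner_smul_right]
  congr 2
  push_cast
  field_simp

theorem continuous_fourier {φ : E d → ℂ} (hφ : Integrable φ) : Continuous (fourier φ) := by
  have hcont : Continuous (𝓕 φ) :=
    VectorFourier.fourierIntegral_continuous Real.continuous_fourierChar
      (L := innerₗ (E d)) continuous_inner hφ
  rw [funext (fourier_eq_scaled φ)]
  exact continuous_const.mul (hcont.comp (continuous_const_smul _))

theorem norm_fourier_le_integral (φ : E d → ℂ) (ξ : E d) : ‖fourier φ ξ‖ ≤ ∫ x, ‖φ x‖ := by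
  rw [fourier_eq_integral_modulate]
  refine (norm_fourierConst_mul_le d _).trans ((norm_integral_le_integral_norm _).trans_eq ?_)
  simp only [norm_modulate]

theorem fourier_sub {φ ψ : E d → ℂ} (hφ : Integrable φ) (hψ : Integrable ψ) (ξ : E d) :
    fourier (φ - ψ) ξ = fourier φ ξ - fourier ψ ξ := by
  have hsub : modulate (-ξ) (φ - ψ) = modulate (-ξ) φ - modulate (-ξ) ψ := by
    funext y
    exact mul_sub _ _ _
  simp only [fourier_eq_integral_modulate, ← mul_sub, hsub]
  rw [← integral_sub (integrable_modulate _ hφ) (integrable_modulate _ hψ)]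
  rfl

theorem fourier_fourier_neg {φ : E d → ℂ} (hc : Continuous φ) (hφ : Integrable φ)
    (hF : Integrable (fourier φ)) (y : E d) : fourier (fourier φ) (-y) = φ y := by
  have hconst : (fourierConst d : ℂ) ≠ 0 := by exact_mod_cast (fourierConst_pos d).ne'
  have hF' : Integrable (𝓕 φ) := by
    rw [funext (fourier_eq_scaled φ)] at hF
    exact (integrable_comp_smul_iff volume (𝓕 φ) (inv_ne_zero Real.two_pi_pos.ne')).1
      ((integrable_const_mul_iff (isUnit_iff_ne_zero.2 hconst) _).1 hF)
  set G : E d → ℂ := fun w => Complex.exp ((2 * Real.pi * inner ℝ w y : ℝ) * Complex.I) • 𝓕 φ w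
  have hG : ∫ w, G w = φ y := by
    rw [← Real.fourierInv_eq']
    exact congrFun (hc.fourierInv_fourier_eq hφ hF') y
  have hscale (ξ : E d) : modulate y (fourier φ) ξ =
      (fourierConst d : ℂ) * G ((2 * Real.pi)⁻¹ • ξ) := by
    simp only [modulate, fourier_eq_scaled, G, inner_smul_left, smul_eq_mul]
    rw [mul_left_comm]
    congr 3
    simp [field]
  rw [fourier_eq_integral_modulate, neg_neg]
  simp_rw [hscale]
  rw [integral_const_mul, Measure.integral_comp_inv_smul_of_nonneg _ _ Real.two_pi_pos.le, hG,
    finrank_euclideanSpace_fin, Complex.real_smul, ← mul_assoc, ← mul_assoc]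
  rw [← Complex.ofReal_mul, ← Complex.ofReal_mul, fourierConst_mul_self_mul_pow,
    Complex.ofReal_one, one_mul]

theorem norm_le_integral_of_norm_fourier_le {φ : E d → ℂ} (hc : Continuous φ) (hφ : Integrable φ)
    {w : E d → ℝ} (hw : Integrable w) (hle : ∀ ξ, ‖fourier φ ξ‖ ≤ w ξ) (y : E d) :
    ‖φ y‖ ≤ ∫ ξ, w ξ := by
  have hF : Integrable (fourier φ) :=
    hw.mono' (continuous_fourier hφ).aestronglyMeasurable (.of_forall hle)
  rw [← fourier_fourier_neg hc hφ hF y]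
  exact (norm_fourier_le_integral _ _).trans (integral_mono hF.norm hw hle)

theorem eq_zero_of_fourier_eq_zero {φ : E d → ℂ} (hc : Continuous φ) (hφ : Integrable φ)
    (hzero : ∀ ξ, fourier φ ξ = 0) : φ = 0 := by
  funext y
  have hle := norm_le_integral_of_norm_fourier_le hc hφ (integrable_zero _ _ _)
    (fun ξ => by simp [hzero ξ]) y
  simpa using hle

theorem integral_pderiv_eq_zero (j : Fin d) {f : E d → ℂ} (hf : Differentiable ℝ f)
    (hi : Integrable f) (hi' : Integrable (pderiv j f)) : ∫ x, pderiv j f x = 0 := by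
  unfold pderiv at hi' ⊢
  have hparts := integral_mul_fderiv_eq_neg_fderiv_mul_of_integrable (μ := (volume : Measure (E d)))
    (f := f) (g := fun _ => (1 : ℂ)) (v := EuclideanSpace.single j 1)
    (by simpa only [mul_one] using hi') (by simp) (by simpa only [mul_one] using hi)
    (fun x _ => hf x) (fun x _ => differentiableAt_const _)
  simpa [eq_comm] using hparts

theorem fourier_pderiv (j : Fin d) {f : E d → ℂ} (hf : ContDiff ℝ ∞ f) (hi : Integrable f)
    (hi' : Integrable (pderiv j f)) (ξ : E d) :
    fourier (pderiv j f) ξ = Complex.I * (ξ j : ℂ) * fourier f ξ := by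
  have hdiff : pderiv j (modulate (-ξ) f) =
      fun x => modulate (-ξ) (pderiv j f) x - Complex.I * ξ j * modulate (-ξ) f x := by
    rw [pderiv_modulate (-ξ) j hf]
    funext x
    simp only [modulate, qderiv, Pi.add_apply, Pi.smul_apply, smul_eq_mul, PiLp.neg_apply,
      Complex.ofReal_neg]
    ring
  have hint := integrable_modulate (-ξ) hi
  have hint' := integrable_modulate (-ξ) hi'
  have hzero := integral_pderiv_eq_zero j ((contDiff_modulate (-ξ) hf).differentiable (by simp))
    hint (by rw [hdiff]; exact hint'.sub (hint.const_mul _))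
  rw [hdiff, integral_sub hint' (hint.const_mul _), integral_const_mul, sub_eq_zero] at hzero
  rw [fourier_eq_integral_modulate, fourier_eq_integral_modulate, hzero]
  ring

theorem fourier_mderiv (β : MIdx d) {f : E d → ℂ} (hf : ContDiff ℝ ∞ f)
    (hi : ∀ γ, Integrable (mderiv γ f)) (ξ : E d) :
    fourier (mderiv β f) ξ = Complex.I ^ deg β * (mono ξ β : ℂ) * fourier f ξ := by
  induction β using MIdx.induction generalizing f with
  | zero => simp [mderiv_zero, deg_zero, mono_zero]
  | add_single γ j ih =>
    have hi₀ : Integrable f := by simpa only [mderiv_zero] using hi 0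
    have hi₁ : Integrable (pderiv j f) := by
      rw [← mderiv_zero (pderiv j f), mderiv_pderiv 0 j hf]
      exact hi _
    rw [← mderiv_pderiv γ j hf, ih (contDiff_pderiv j hf) fun δ => by
      rw [mderiv_pderiv δ j hf]
      exact hi _]
    rw [fourier_pderiv j hf hi₀ hi₁, deg_add, deg_single, mono_add, mono_single]
    push_cast
    ring

theorem exists_norm_fourier_le (d : ℕ) {s r : ℝ} (hs : 0 < s) (hr : 0 < r) :
    ∃ h > 0, ∃ K > 0, ∀ (g : E d → ℂ) (w : E d → ℝ), ContDiff ℝ ∞ g → Integrable w →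
      (∀ β x, ‖mderiv β g x‖ ≤ h ^ deg β * mfact β ^ s * w x) →
      ∀ ξ, ‖fourier g ξ‖ ≤ K * (∫ x, w x) * Real.exp (-r * ‖ξ‖ ^ (1 / s)) := by
  obtain ⟨h, hh, K, hK, hdecay⟩ := exists_le_exp_of_abs_mono_mul_le d hs hr
  refine ⟨h, hh, K, hK, fun g w hg hw hbound ξ => ?_⟩
  have hi (γ : MIdx d) : Integrable (mderiv γ g) :=
    (hw.const_mul (h ^ deg γ * mfact γ ^ s)).mono'
      (contDiff_mderiv γ hg).continuous.aestronglyMeasurable (.of_forall (hbound γ))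
  have hw0 : 0 ≤ ∫ x, w x := integral_nonneg fun x => by
    simpa [deg_zero, mfact_zero] using (norm_nonneg _).trans (hbound 0 x)
  refine hdecay ξ _ _ (norm_nonneg _) hw0 fun α => ?_
  calc |mono ξ α| * ‖fourier g ξ‖ = ‖fourier (mderiv α g) ξ‖ := by
        rw [fourier_mderiv α hg hi, norm_mul, norm_mul, norm_pow, Complex.norm_I, one_pow, one_mul,
          Complex.norm_real, Real.norm_eq_abs]
    _ ≤ ∫ x, ‖mderiv α g x‖ := norm_fourier_le_integral _ ξ
    _ ≤ ∫ x, h ^ deg α * mfact α ^ s * w x := integral_mono (hi α).norm (hw.const_mul _) (hbound α)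
    _ = (∫ x, w x) * (h ^ deg α * mfact α ^ s) := by
        rw [integral_const_mul, mul_comm]

end Fourier

section TimeFrequencyShifts

theorem modulate_zero (φ : E d → ℂ) : modulate 0 φ = φ := by
  funext y
  simp [modulate]

theorem modulate_modulate (ξ η : E d) (φ : E d → ℂ) :
    modulate ξ (modulate η φ) = modulate (ξ + η) φ := by
  funext y
  rw [modulate, modulate, modulate, ← mul_assoc, ← Complex.exp_add, inner_add_right]
  push_cast
  ring_nf

theorem translate_modulate (x ξ : E d) (φ : E d → ℂ) :
    translate x (modulate ξ φ) =
      Complex.exp (-Complex.I * (inner ℝ x ξ : ℝ)) • modulate ξ (translate x φ) := by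
  funext y
  rw [Pi.smul_apply, smul_eq_mul, translate, modulate, modulate, translate, ← mul_assoc,
    ← Complex.exp_add, inner_sub_left]
  push_cast
  ring_nf

theorem fourier_modulate (ξ : E d) (φ : E d → ℂ) :
    fourier (modulate ξ φ) = translate ξ (fourier φ) := by
  funext η
  rw [translate, fourier_eq_integral_modulate, fourier_eq_integral_modulate, modulate_modulate,
    neg_sub, neg_add_eq_sub]

theorem fourier_translate (x : E d) (φ : E d → ℂ) :
    fourier (translate x φ) = modulate (-x) (fourier φ) := by
  funext η
  rw [modulate, fourier_eq_integral_modulate, fourier_eq_integral_modulate, mul_left_comm,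
    ← integral_const_mul (Complex.exp _), ← integral_add_right_eq_self _ x]
  refine congrArg _ (integral_congr_ae (.of_forall fun y => ?_))
  simp only [modulate, translate, add_sub_cancel_right, ← mul_assoc, ← Complex.exp_add]
  simp only [inner_add_left, inner_neg_right, real_inner_comm η x]
  push_cast
  ring_nf

theorem fourier_modulate_translate (x ξ : E d) (φ : E d → ℂ) :
    fourier (modulate ξ (translate x φ)) =
      Complex.exp (Complex.I * (inner ℝ x ξ : ℝ)) • modulate (-x) (translate ξ (fourier φ)) := by
  rw [fourier_modulate, fourier_translate, translate_modulate, inner_neg_right, real_inner_comm]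
  push_cast
  rw [neg_mul_neg]

/-- The short-time Fourier transform of a function `f` with respect to a window function `ρ`:
the Fourier transform at `ξ` of `f · conj (ρ (· - x))`. -/
def windowedFourier (f ρ : E d → ℂ) (x ξ : E d) : ℂ :=
  fourier (fun y => f y * starRingEnd ℂ (translate x ρ y)) ξ

theorem windowedFourier_eq_integral (f ρ : E d → ℂ) (x ξ : E d) :
    windowedFourier f ρ x ξ =
      (fourierConst d : ℂ) * ∫ y, f y * starRingEnd ℂ (modulate ξ (translate x ρ) y) := by
  rw [windowedFourier, fourier_eq_integral_modulate]
  congr 2 with y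
  simp only [modulate, map_mul, ← Complex.exp_conj, Complex.conj_I, Complex.conj_ofReal,
    inner_neg_right, Complex.ofReal_neg, mul_neg, neg_mul]
  ring

end TimeFrequencyShifts

section TestFunctions

variable {t s : ℝ}

theorem GS.contDiff (φ : GS d t s) : ContDiff ℝ ∞ φ.fn := φ.2.1

theorem GS.ext_fn {φ ψ : GS d t s} (h : φ.fn = ψ.fn) : φ = ψ := Subtype.ext h

theorem GS.abs_mono_mul_norm_mderiv_le (φ : GS d t s) (h : Set.Ioi (0 : ℝ)) (α β : MIdx d)
    (x : E d) :
    |mono x α| * ‖mderiv β φ.fn x‖ ≤ gsSeminorm d t s h φ * gsWeight t s h α β :=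
  (div_le_iff₀ (gsWeight_pos t s h.2 _ _)).1
    (le_ciSup (φ.bddAbove h.2) (α, β, x) : gsQuot t s h φ.fn (α, β, x) ≤ gsSeminorm d t s h φ)

theorem exists_norm_mderiv_le_gsSeminorm (d : ℕ) (s : ℝ) {t h r : ℝ} (ht : 0 < t) (hh : 0 < h)
    (hr : 0 < r) :
    ∃ k : Set.Ioi (0 : ℝ), ∃ K ≥ 0, ∀ (φ : GS d t s) β x, ‖mderiv β φ.fn x‖ ≤
      K * gsSeminorm d t s k φ * (h ^ deg β * mfact β ^ s) * Real.exp (-r * ‖x‖ ^ (1 / t)) := by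
  obtain ⟨h₀, hh₀, K, hK, hdecay⟩ := exists_le_exp_of_abs_mono_mul_le d ht hr
  have hk : 0 < min h h₀ := lt_min hh hh₀
  refine ⟨⟨min h h₀, hk⟩, K, hK.le, fun φ β x => ?_⟩
  set N : ℝ := gsSeminorm d t s ⟨min h h₀, hk⟩ φ
  have : 0 ≤ N := apply_nonneg _ _
  have hfact (γ : MIdx d) (p : ℝ) : 0 ≤ mfact γ ^ p := Real.rpow_nonneg (mfact_pos γ).le p
  have hβ := hfact β s
  rw [mul_assoc K]
  refine hdecay x _ (N * (h ^ deg β * mfact β ^ s)) (norm_nonneg _) (by positivity) fun α => ?_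
  have hα := hfact α t
  calc |mono x α| * ‖mderiv β φ.fn x‖
      ≤ N * ((min h h₀) ^ (deg α + deg β) * mfact α ^ t * mfact β ^ s) := by
        rw [← deg_add]
        exact φ.abs_mono_mul_norm_mderiv_le _ α β x
    _ ≤ N * (h₀ ^ deg α * h ^ deg β * mfact α ^ t * mfact β ^ s) := by
        rw [pow_add]
        gcongr
        · exact min_le_right _ _
        · exact min_le_left _ _
    _ = N * (h ^ deg β * mfact β ^ s) * (h₀ ^ deg α * mfact α ^ t) := by ring

theorem GS.exists_norm_mderiv_le (ht : 0 < t) (φ : GS d t s) {h r : ℝ} (hh : 0 < h) (hr : 0 < r) :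
    ∃ C ≥ 0, ∀ β x, ‖mderiv β φ.fn x‖ ≤
      C * (h ^ deg β * mfact β ^ s) * Real.exp (-r * ‖x‖ ^ (1 / t)) := by
  obtain ⟨k, K, hK, hbound⟩ := exists_norm_mderiv_le_gsSeminorm d s ht hh hr
  exact ⟨K * gsSeminorm d t s k φ, mul_nonneg hK (apply_nonneg _ _), hbound φ⟩

theorem GS.superExpDecay (ht : 0 < t) (φ : GS d t s) : SuperExpDecay t φ.fn where
  continuous := φ.contDiff.continuous
  bound r hr := by
    obtain ⟨C, hC, hbound⟩ := φ.exists_norm_mderiv_le ht one_pos hr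
    exact ⟨C, hC, fun x => by simpa [mderiv_zero, deg_zero, mfact_zero] using hbound 0 x⟩

theorem GS.integrable_mderiv (ht : 0 < t) (φ : GS d t s) (β : MIdx d) :
    Integrable (mderiv β φ.fn) := by
  obtain ⟨C, -, hbound⟩ := φ.exists_norm_mderiv_le ht one_pos one_pos
  exact ((integrable_exp_neg_mul_norm_rpow _ (one_div_pos.2 ht) one_pos).const_mul _).mono'
    (contDiff_mderiv β φ.contDiff).continuous.aestronglyMeasurable (.of_forall (hbound β))

theorem GS.integrable (ht : 0 < t) (φ : GS d t s) : Integrable φ.fn :=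
  (φ.superExpDecay ht).integrable _ ht

theorem GS.superExpDecay_fourier (ht : 0 < t) (hs : 0 < s) (φ : GS d t s) :
    SuperExpDecay s (fourier φ.fn) where
  continuous := continuous_fourier (φ.integrable ht)
  bound r hr := by
    obtain ⟨h, hh, K, hK, hfourier⟩ := exists_norm_fourier_le d hs hr
    obtain ⟨C, hC, hbound⟩ := φ.exists_norm_mderiv_le ht hh one_pos
    set w : E d → ℝ := fun x => C * Real.exp (-1 * ‖x‖ ^ (1 / t))
    have hw : Integrable w :=
      (integrable_exp_neg_mul_norm_rpow _ (one_div_pos.2 ht) one_pos).const_mul C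
    have : 0 ≤ ∫ x, w x := integral_nonneg fun x => by positivity
    refine ⟨K * ∫ x, w x, by positivity,
      hfourier φ.fn w φ.contDiff hw fun β x => (hbound β x).trans_eq ?_⟩
    ring

theorem GS.exists_fourier_ne_zero (ht : 0 < t) {ψ : GS d t s} (hψ : ψ ≠ 0) :
    ∃ η, fourier ψ.fn η ≠ 0 := by
  contrapose! hψ
  exact GS.ext_fn (eq_zero_of_fourier_eq_zero ψ.contDiff.continuous (ψ.integrable ht) hψ)

theorem GS.Dop_zero_eq_integral (ht : 0 < t) (hs : 0 < s) (φ : GS d t s) (α : MIdx d) :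
    Dop α φ.fn 0 = (fourierConst d : ℂ) * ∫ ξ, (mono ξ α : ℂ) * fourier φ.fn ξ := by
  have hF : fourier (mderiv α φ.fn) =
      fun ξ => Complex.I ^ deg α * ((mono ξ α : ℂ) * fourier φ.fn ξ) := by
    funext ξ
    rw [fourier_mderiv α φ.contDiff (φ.integrable_mderiv ht), mul_assoc]
  have hI : Integrable (fourier (mderiv α φ.fn)) := by
    rw [hF]
    exact (((subExpGrowth_mono hs α).mul_decay (φ.superExpDecay_fourier ht hs)).integrable
      _ hs).const_mul _
  rw [Dop, ← fourier_fourier_neg (contDiff_mderiv α φ.contDiff).continuous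
    (φ.integrable_mderiv ht α) hI, neg_zero, hF, fourier_eq_integral_modulate, neg_zero,
    modulate_zero, integral_const_mul, mul_left_comm, ← mul_assoc ((-Complex.I) ^ deg α),
    ← mul_pow]
  simp

end TestFunctions

section Ultradistributions

variable {t s : ℝ}

/-- A conjugate linear functional bounded by one of the Gelfand-Shilov norms is an
ultradistribution. -/
def dualOfBound (L : GS d t s →ₛₗ[starRingEnd ℂ] ℂ)
    (hL : ∃ h : Set.Ioi (0 : ℝ), ∃ C ≥ 0, ∀ φ, ‖L φ‖ ≤ C * gsSeminorm d t s h φ) :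
    GSDual d t s where
  toLinearMap := L
  cont := by
    obtain ⟨h, C, hC, hL⟩ := hL
    refine WithSeminorms.continuous_normedSpace_rng ℂ (gs_withSeminorms d t s) L
      ⟨{h}, ⟨C, hC⟩, fun φ => ?_⟩
    rw [Finset.sup_singleton]
    exact hL φ

theorem norm_diracSeries_term_le (c : MIdx d → ℂ) (φ : GS d t s) (α : MIdx d) :
    ‖c α * starRingEnd ℂ (Dop α φ.fn 0)‖ ≤
      ‖c α‖ * 1 ^ deg α * mfact α ^ s * gsSeminorm d t s ⟨1, Set.mem_Ioi.2 one_pos⟩ φ := by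
  have hα : ‖mderiv α φ.fn 0‖ ≤ mfact α ^ s * gsSeminorm d t s ⟨1, Set.mem_Ioi.2 one_pos⟩ φ := by
    simpa [mono_zero, gsWeight, mfact_zero, mul_comm] using
      φ.abs_mono_mul_norm_mderiv_le ⟨1, Set.mem_Ioi.2 one_pos⟩ 0 α 0
  have hD : ‖Dop α φ.fn 0‖ = ‖mderiv α φ.fn 0‖ := by simp [Dop]
  rw [norm_mul, RCLike.norm_conj, hD, one_pow, mul_one, mul_assoc]
  gcongr

theorem summable_diracSeries {c : MIdx d → ℂ} (hc : SmallCoeff s c) (φ : GS d t s) :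
    Summable fun α => c α * starRingEnd ℂ (Dop α φ.fn 0) :=
  .of_norm_bounded ((hc 1 one_pos).mul_right _) (norm_diracSeries_term_le c φ)

/-- The ultradistribution `∑ c_α D ^ α δ₀`. -/
def diracSeries (t : ℝ) {c : MIdx d → ℂ} (hc : SmallCoeff s c) : GSDual d t s :=
  dualOfBound
    { toFun φ := ∑' α, c α * starRingEnd ℂ (Dop α φ.fn 0)
      map_add' φ ψ := by
        rw [← (summable_diracSeries hc φ).tsum_add (summable_diracSeries hc ψ)]
        congr 1 with α
        have hadd : mderiv α (φ + ψ).fn = mderiv α φ.fn + mderiv α ψ.fn :=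
          mderiv_add α φ.contDiff ψ.contDiff
        simp only [Dop, hadd, Pi.add_apply, mul_add, map_add]
      map_smul' a φ := by
        rw [smul_eq_mul, ← tsum_mul_left]
        congr 1 with α
        have hsmul : mderiv α (a • φ).fn = a • mderiv α φ.fn := mderiv_smul α a φ.contDiff
        simp only [Dop, hsmul, Pi.smul_apply, smul_eq_mul, map_mul]
        ring }
    ⟨⟨1, Set.mem_Ioi.2 one_pos⟩, coeffNorm s 1 c, coeffNorm_nonneg s zero_le_one c, fun φ => by
      rw [coeffNorm, ← tsum_mul_right]
      exact tsum_of_norm_bounded ((hc 1 one_pos).mul_right _).hasSum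
        (norm_diracSeries_term_le c φ)⟩

theorem isDiracSeries_diracSeries (t : ℝ) {c : MIdx d → ℂ} (hc : SmallCoeff s c) :
    IsDiracSeries c (diracSeries t hc) := fun φ => (summable_diracSeries hc φ).hasSum

theorem SubExpGrowth.integrable_mul_conj (ht : 0 < t) {f : E d → ℂ} (hf : SubExpGrowth t f)
    (φ : GS d t s) : Integrable fun x => f x * starRingEnd ℂ (φ.fn x) :=
  (hf.mul_decay (φ.superExpDecay ht).conj).integrable _ ht

theorem SubExpGrowth.exists_norm_integral_mul_conj_le (s : ℝ) (ht : 0 < t) {f : E d → ℂ}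
    (hf : SubExpGrowth t f) : ∃ h : Set.Ioi (0 : ℝ), ∃ C ≥ 0, ∀ φ : GS d t s,
      ‖∫ x, f x * starRingEnd ℂ (φ.fn x)‖ ≤ C * gsSeminorm d t s h φ := by
  obtain ⟨k, K, hK, hbound⟩ := exists_norm_mderiv_le_gsSeminorm d s ht one_pos two_pos
  obtain ⟨A, hA, hfA⟩ := hf.bound 1 one_pos
  set w : E d → ℝ := fun x => Real.exp (-1 * ‖x‖ ^ (1 / t))
  have hw : Integrable w := integrable_exp_neg_mul_norm_rpow _ (one_div_pos.2 ht) one_pos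
  have : 0 ≤ ∫ x, w x := integral_nonneg fun x => (Real.exp_pos _).le
  refine ⟨k, A * K * ∫ x, w x, by positivity, fun φ => ?_⟩
  have hpoint (x : E d) : ‖f x * starRingEnd ℂ (φ.fn x)‖ ≤
      A * K * gsSeminorm d t s k φ * w x := by
    have hφ : ‖φ.fn x‖ ≤ K * gsSeminorm d t s k φ * Real.exp (-2 * ‖x‖ ^ (1 / t)) := by
      simpa [mderiv_zero, deg_zero, mfact_zero] using hbound φ 0 x
    calc ‖f x * starRingEnd ℂ (φ.fn x)‖
        ≤ A * Real.exp (1 * ‖x‖ ^ (1 / t)) *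
          (K * gsSeminorm d t s k φ * Real.exp (-2 * ‖x‖ ^ (1 / t))) := by
          rw [norm_mul, RCLike.norm_conj]
          exact mul_le_mul (hfA x) hφ (norm_nonneg _) (by positivity)
      _ = A * K * gsSeminorm d t s k φ *
          (Real.exp (1 * ‖x‖ ^ (1 / t)) * Real.exp (-2 * ‖x‖ ^ (1 / t))) := by ring
      _ = A * K * gsSeminorm d t s k φ * w x := by
          rw [← Real.exp_add, ← add_mul]
          norm_num only [w]
  refine (norm_integral_le_of_norm_le (hw.const_mul _) (.of_forall hpoint)).trans_eq ?_
  rw [integral_const_mul]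
  ring

/-- The ultradistribution given by a function of subexponential growth. -/
def functionDual (s : ℝ) (ht : 0 < t) {f : E d → ℂ} (hf : SubExpGrowth t f) : GSDual d t s :=
  dualOfBound
    { toFun φ := ∫ x, f x * starRingEnd ℂ (φ.fn x)
      map_add' φ ψ := by
        rw [← integral_add (hf.integrable_mul_conj ht φ) (hf.integrable_mul_conj ht ψ)]
        congr 1 with x
        change f x * starRingEnd ℂ (φ.fn x + ψ.fn x) = _
        rw [map_add, mul_add]
      map_smul' a φ := by
        rw [smul_eq_mul, ← integral_const_mul]
        congr 1 with x
        change f x * starRingEnd ℂ (a * φ.fn x) = _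
        rw [map_mul, mul_left_comm] }
    (hf.exists_norm_integral_mul_conj_le s ht)

theorem isFunction_functionDual (s : ℝ) (ht : 0 < t) {f : E d → ℂ} (hf : SubExpGrowth t f) :
    IsFunction (functionDual s ht hf) f :=
  fun φ => ⟨hf.integrable_mul_conj ht φ, rfl⟩

theorem IsFunction.isPowerSeries (hs : 0 < s) {c : MIdx d → ℂ} (hc : SmallCoeff s c)
    {F : GSDual d s t} (hF : IsFunction F (powerSeriesSum c)) : IsPowerSeries c F := fun φ => by
  rw [(hF φ).2]
  exact hasSum_integral_powerSeriesSum hs hc (φ.superExpDecay hs).conj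

theorem IsFunction.stft_eq (ht : 0 < t) (hs : 0 < s) {F : GSDual d t s} {f : E d → ℂ}
    (hF : IsFunction F f) (ψ : GS d t s) (x ξ : E d) :
    stft ht hs ψ F x ξ = windowedFourier f ψ.fn x ξ := by
  rw [windowedFourier_eq_integral, stft, (hF _).2]
  rfl

theorem IsDiracSeries.hasFourier (ht : 0 < t) (hs : 0 < s) {c : MIdx d → ℂ}
    (hc : SmallCoeff s c) {u : GSDual d t s} (hu : IsDiracSeries c u) :
    HasFourier u (fun ξ => (fourierConst d : ℂ) * powerSeriesSum c ξ) := by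
  have hf := hc.subExpGrowth hs
  refine ⟨continuous_const.mul hf.continuous, fun φ => ?_⟩
  have hφ := (φ.superExpDecay_fourier ht hs).conj
  have hterm (α : MIdx d) : c α * starRingEnd ℂ (Dop α φ.fn 0) = (fourierConst d : ℂ) *
      (c α * ∫ ξ, (mono ξ α : ℂ) * starRingEnd ℂ (fourier φ.fn ξ)) := by
    rw [φ.Dop_zero_eq_integral ht hs, map_mul, Complex.conj_ofReal, ← integral_conj]
    simp only [map_mul, Complex.conj_ofReal]
    ring
  simp_rw [mul_assoc]
  refine ⟨((hf.mul_decay hφ).integrable _ hs).const_mul _, (hu φ).unique ?_⟩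
  simp_rw [hterm]
  rw [integral_const_mul]
  exact (hasSum_integral_powerSeriesSum hs hc hφ).mul_left _

theorem HasFourier.stft_eq (ht : 0 < t) (hs : 0 < s) {u : GSDual d t s} {g : E d → ℂ}
    (hg : HasFourier u g) (ψ : GS d t s) (x ξ : E d) :
    stft ht hs ψ u x ξ = Complex.exp (-Complex.I * (inner ℝ x ξ : ℝ)) *
      windowedFourier g (fourier ψ.fn) ξ (-x) := by
  have hshift : fourier (tfShift ht hs x ξ ψ).fn = Complex.exp (Complex.I * (inner ℝ x ξ : ℝ)) •
      modulate (-x) (translate ξ (fourier ψ.fn)) := fourier_modulate_translate x ξ ψ.fn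
  rw [windowedFourier_eq_integral, mul_left_comm, ← integral_const_mul, stft, (hg.2 _).2, hshift]
  congr 2 with η
  simp only [Pi.smul_apply, smul_eq_mul, map_mul, ← Complex.exp_conj, Complex.conj_I,
    Complex.conj_ofReal]
  ring

theorem HasFourier.unique_of_ne_zero (ht : 0 < t) (hs : 0 < s) {ψ : GS d t s} (hψ : ψ ≠ 0)
    {u : GSDual d t s} {g₁ g₂ : E d → ℂ} (h₁ : HasFourier u g₁) (h₂ : HasFourier u g₂) :
    g₁ = g₂ := by
  obtain ⟨η₀, hη₀⟩ := ψ.exists_fourier_ne_zero ht hψ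
  funext η
  set ξ := η - η₀ with hξ
  set k : (E d → ℂ) → E d → ℂ := fun g ζ => g ζ * starRingEnd ℂ (translate ξ (fourier ψ.fn) ζ)
  have hcont {g : E d → ℂ} (hg : HasFourier u g) : Continuous (k g) :=
    hg.1.mul (Complex.continuous_conj.comp
      ((continuous_fourier (ψ.integrable ht)).comp (continuous_id.sub continuous_const)))
  have hint {g : E d → ℂ} (hg : HasFourier u g) : Integrable (k g) := by
    have hpair := (hg.2 (tfShift ht hs 0 ξ ψ)).1
    have hshift : fourier (tfShift ht hs 0 ξ ψ).fn = translate ξ (fourier ψ.fn) := by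
      refine (fourier_modulate_translate 0 ξ ψ.fn).trans ?_
      simp [modulate_zero]
    rwa [hshift] at hpair
  have hfourier (x : E d) : fourier (k g₁) (-x) = fourier (k g₂) (-x) :=
    mul_left_cancel₀ (Complex.exp_ne_zero _)
      ((h₁.stft_eq ht hs ψ x ξ).symm.trans (h₂.stft_eq ht hs ψ x ξ))
  have hk : k g₁ = k g₂ := sub_eq_zero.1 <|
    eq_zero_of_fourier_eq_zero ((hcont h₁).sub (hcont h₂)) ((hint h₁).sub (hint h₂)) fun x => by
      rw [fourier_sub (hint h₁) (hint h₂), ← neg_neg x, hfourier, sub_self]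
  have hη : fourier ψ.fn (η - ξ) ≠ 0 := by simpa [hξ] using hη₀
  exact mul_right_cancel₀ ((map_ne_zero _).2 hη) (congrFun hk η)

end Ultradistributions

section TensorProducts

theorem contDiff_prod_apply {g : Fin d → ℝ → ℂ} (hg : ∀ i, ContDiff ℝ ∞ (g i)) :
    ContDiff ℝ ∞ fun x : E d => ∏ i, g i (x i) :=
  contDiff_prod fun i _ => (hg i).comp (EuclideanSpace.proj i : E d →L[ℝ] ℝ).contDiff

theorem pderiv_prod (j : Fin d) {g : Fin d → ℝ → ℂ} (hg : ∀ i, Differentiable ℝ (g i)) :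
    pderiv j (fun x : E d => ∏ i, g i (x i)) =
      fun x => ∏ i, Function.update g j (deriv (g j)) i (x i) := by
  funext x
  have hfactor (i : Fin d) (_ : i ∈ Finset.univ) : HasFDerivAt (fun y : E d => g i (y i))
      ((EuclideanSpace.proj i : E d →L[ℝ] ℝ).smulRight (deriv (g i) (x i))) x := by
    refine ((hg i (x i)).hasDerivAt.hasFDerivAt.comp x
      (EuclideanSpace.proj i : E d →L[ℝ] ℝ).hasFDerivAt).congr_fderiv ?_
    ext v
    simp
  rw [pderiv, (HasFDerivAt.finsetProd hfactor).fderiv, sum_apply,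
    Finset.sum_eq_single j (fun i _ hij => by simp [hij]) (by simp),
    ← Finset.prod_erase_mul _ _ (Finset.mem_univ j), Function.update_self]
  have herase : ∏ i ∈ Finset.univ.erase j, Function.update g j (deriv (g j)) i (x i) =
      ∏ i ∈ Finset.univ.erase j, g i (x i) :=
    Finset.prod_congr rfl fun i hi => by rw [Function.update_of_ne (Finset.ne_of_mem_erase hi)]
  rw [herase]
  simp

theorem mderiv_prod (β : MIdx d) {g : Fin d → ℝ → ℂ} (hg : ∀ i, ContDiff ℝ ∞ (g i)) :
    mderiv β (fun x : E d => ∏ i, g i (x i)) = fun x => ∏ i, iteratedDeriv (β i) (g i) (x i) := by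
  induction β using MIdx.induction generalizing g with
  | zero => simp [mderiv_zero]
  | add_single γ j ih =>
    have hupdate (i : Fin d) : ContDiff ℝ ∞ (Function.update g j (deriv (g j)) i) := by
      obtain rfl | hij := eq_or_ne i j
      · simpa using (contDiff_infty_iff_deriv.1 (hg i)).2
      · simpa [hij] using hg i
    rw [← mderiv_pderiv γ j (contDiff_prod_apply hg),
      pderiv_prod j fun i => (hg i).differentiable (by simp), ih hupdate]
    funext x
    refine Finset.prod_congr rfl fun i _ => ?_
    obtain rfl | hij := eq_or_ne i j
    · simp [iteratedDeriv_succ']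
    · simp [hij]

theorem prod_mem_gsSubmodule {t s : ℝ} {g : Fin d → ℝ → ℂ} (hg : ∀ i, ContDiff ℝ ∞ (g i))
    (hbound : ∀ i, ∀ h > 0, ∃ C : ℝ, ∀ (m n : ℕ) (x : ℝ), |x| ^ m * ‖iteratedDeriv n (g i) x‖ ≤
      C * ((h ^ m * (m.factorial : ℝ) ^ t) * (h ^ n * (n.factorial : ℝ) ^ s))) :
    (fun x : E d => ∏ i, g i (x i)) ∈ gsSubmodule d t s := by
  refine ⟨contDiff_prod_apply hg, fun h hh => ?_⟩
  choose C hC using fun i => hbound i h hh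
  refine ⟨∏ i, C i, fun α β x => ?_⟩
  calc |mono x α| * ‖mderiv β (fun x : E d => ∏ i, g i (x i)) x‖
      = ∏ i, |x i| ^ α i * ‖iteratedDeriv (β i) (g i) (x i)‖ := by
        rw [mderiv_prod β hg, mono, Finset.abs_prod, norm_prod, ← Finset.prod_mul_distrib]
        simp only [abs_pow]
    _ ≤ ∏ i, C i * ((h ^ α i * ((α i).factorial : ℝ) ^ t) *
          (h ^ β i * ((β i).factorial : ℝ) ^ s)) :=
        Finset.prod_le_prod (fun i _ => by positivity) fun i _ => hC i _ _ _
    _ = (∏ i, C i) * gsWeight t s h α β := by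
        rw [Finset.prod_mul_distrib, Finset.prod_mul_distrib, prod_weight, prod_weight, gsWeight,
          deg_add, pow_add]
        ring

end TensorProducts

section Nontriviality

theorem exists_mul_rpow_le_mul_rpow_add {p q ε : ℝ} (hp : 0 ≤ p) (hpq : p < q) (hε : 0 < ε)
    {a : ℝ} (ha : 0 ≤ a) : ∃ K ≥ 0, ∀ y ≥ 0, a * y ^ p ≤ ε * y ^ q + K := by
  set Y : ℝ := (a / ε) ^ (1 / (q - p))
  have hY : 0 ≤ Y := by positivity
  refine ⟨a * Y ^ p, by positivity, fun y hy => ?_⟩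
  rcases le_total y Y with hyY | hYy
  · have : a * y ^ p ≤ a * Y ^ p := by gcongr
    have : 0 ≤ ε * y ^ q := by positivity
    linarith
  · have hratio : a ≤ ε * y ^ (q - p) := by
      have hYpow : Y ^ (q - p) = a / ε := by
        rw [← Real.rpow_mul (by positivity), one_div_mul_cancel (sub_pos.2 hpq).ne', Real.rpow_one]
      rw [← div_le_iff₀' hε, ← hYpow]
      exact Real.rpow_le_rpow hY hYy (sub_pos.2 hpq).le
    calc a * y ^ p ≤ ε * y ^ (q - p) * y ^ p := by gcongr
      _ = ε * y ^ q := by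
          rw [mul_assoc, ← Real.rpow_add' hy (by linarith), sub_add_cancel]
      _ ≤ ε * y ^ q + a * Y ^ p := le_add_of_nonneg_right (by positivity)

theorem norm_pow_sub_pow_le {𝕜 : Type*} [NormedField 𝕜] {a b : 𝕜} {M : ℝ} (ha : ‖a‖ ≤ M)
    (hb : ‖b‖ ≤ M) (n : ℕ) : ‖a ^ n - b ^ n‖ ≤ ‖a - b‖ * (n * M ^ (n - 1)) := by
  have hM : 0 ≤ M := (norm_nonneg a).trans ha
  have hterm (i : ℕ) (hi : i ∈ Finset.range n) : ‖a ^ i * b ^ (n - 1 - i)‖ ≤ M ^ (n - 1) := by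
    rw [norm_mul, norm_pow, norm_pow]
    calc ‖a‖ ^ i * ‖b‖ ^ (n - 1 - i) ≤ M ^ i * M ^ (n - 1 - i) := by gcongr
      _ = M ^ (n - 1) := by
          rw [← pow_add, Nat.add_sub_cancel' (Nat.le_sub_one_of_lt (Finset.mem_range.1 hi))]
  rw [← (Commute.all a b).mul_geom_sum₂, norm_mul]
  gcongr
  simpa using (norm_sum_le _ _).trans (Finset.sum_le_sum hterm)

theorem exists_abs_pow_le_re_pow_add {N : ℕ} (hN : N ≠ 0) (hev : Even N) {R : ℝ} (hR : 0 ≤ R) :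
    ∃ K, ∀ (x : ℝ) (z : ℂ), ‖z - x‖ ≤ R → |x| ^ N / 2 ≤ (z ^ N).re + K := by
  have hN1 : (1 : ℝ) ≤ N := by exact_mod_cast Nat.one_le_iff_ne_zero.2 hN
  obtain ⟨K, -, hK⟩ := exists_mul_rpow_le_mul_rpow_add (p := (N - 1 : ℝ)) (q := N)
    (ε := 1 / 2 ^ N) (a := R * N) (by linarith) (by linarith) (by positivity) (by positivity)
  refine ⟨R ^ N / 2 + K, fun x z hz => ?_⟩
  have hx : ‖(x : ℂ)‖ = |x| := Complex.norm_real x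
  have hzR : ‖z‖ ≤ |x| + R := by
    calc ‖z‖ = ‖(x : ℂ) + (z - x)‖ := by rw [add_sub_cancel]
      _ ≤ |x| + R := (norm_add_le _ _).trans (add_le_add hx.le hz)
  have hdiff : ‖z ^ N - (x : ℂ) ^ N‖ ≤ |x| ^ N / 2 + R ^ N / 2 + K := by
    calc ‖z ^ N - (x : ℂ) ^ N‖ ≤ R * (N * (|x| + R) ^ (N - 1)) :=
          (norm_pow_sub_pow_le hzR (hx.le.trans (le_add_of_nonneg_right hR)) N).trans (by gcongr)
      _ = R * N * (|x| + R) ^ (N - 1 : ℝ) := by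
          rw [← Real.rpow_natCast, Nat.cast_pred (Nat.pos_of_ne_zero hN), mul_assoc]
      _ ≤ 1 / 2 ^ N * (|x| + R) ^ N + K := by
          simpa only [Real.rpow_natCast] using hK (|x| + R) (by positivity)
      _ ≤ 1 / 2 ^ N * (2 ^ (N - 1) * (|x| ^ N + R ^ N)) + K := by
          gcongr
          exact add_pow_le (abs_nonneg x) hR N
      _ = |x| ^ N / 2 + R ^ N / 2 + K := by
          rw [← mul_pow_sub_one hN (2 : ℝ)]
          field_simp
  have hre : |x| ^ N - ‖z ^ N - (x : ℂ) ^ N‖ ≤ (z ^ N).re := by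
    have hpow : ((x : ℂ) ^ N).re = |x| ^ N := by
      rw [← Complex.ofReal_pow, Complex.ofReal_re, hev.pow_abs]
    have habs := (abs_le.1 (Complex.abs_re_le_norm (z ^ N - (x : ℂ) ^ N))).1
    rw [Complex.sub_re, hpow] at habs
    linarith
  linarith

/-- The entire function `exp (-z ^ N)`, whose restriction to the real axis lies in `Σ_t^s(ℝ)` for
`1 ≤ s` and even `N > 1 / t`. -/
def expNegPow (N : ℕ) (z : ℂ) : ℂ := Complex.exp (-z ^ N)

theorem contDiff_expNegPow (N : ℕ) : ContDiff ℂ ∞ (expNegPow N) := by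
  unfold expNegPow
  fun_prop

theorem iteratedDeriv_comp_ofReal {f : ℂ → ℂ} (hf : ContDiff ℂ ∞ f) (n : ℕ) :
    iteratedDeriv n (fun x : ℝ => f x) = fun x : ℝ => iteratedDeriv n f x := by
  induction n with
  | zero => simp
  | succ n ih =>
    funext x
    have hdiff : DifferentiableAt ℂ (iteratedDeriv n f) x :=
      hf.differentiable_iteratedDeriv n (by exact_mod_cast ENat.natCast_lt_top n) x
    rw [iteratedDeriv_succ, iteratedDeriv_succ, ih]
    exact hdiff.hasDerivAt.comp_ofReal.deriv

theorem exists_norm_iteratedDeriv_expNegPow_le {N : ℕ} (hN : N ≠ 0) (hev : Even N) {h : ℝ}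
    (hh : 0 < h) : ∃ C > 0, ∀ (n : ℕ) (x : ℝ), ‖iteratedDeriv n (expNegPow N) x‖ ≤
      C * (h ^ n * n.factorial) * Real.exp (-(|x| ^ N / 2)) := by
  have hR : 0 < 1 / h := one_div_pos.2 hh
  obtain ⟨K, hK⟩ := exists_abs_pow_le_re_pow_add hN hev hR.le
  refine ⟨Real.exp K, Real.exp_pos _, fun n x => ?_⟩
  have hsphere (z : ℂ) (hz : z ∈ Metric.sphere (x : ℂ) (1 / h)) :
      ‖expNegPow N z‖ ≤ Real.exp K * Real.exp (-(|x| ^ N / 2)) := by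
    have hre := hK x z (mem_sphere_iff_norm.1 hz).le
    rw [expNegPow, Complex.norm_exp, ← Real.exp_add, Complex.neg_re, Real.exp_le_exp]
    linarith
  refine (Complex.norm_iteratedDeriv_le_of_forall_mem_sphere_norm_le n hR
    ((contDiff_expNegPow N).differentiable (by simp)).diffContOnCl hsphere).trans_eq ?_
  rw [one_div, inv_pow, div_inv_eq_mul]
  ring

theorem exists_abs_pow_mul_norm_iteratedDeriv_expNegPow_le {t s : ℝ} (ht : 0 < t) (hs : 1 ≤ s)
    {N : ℕ} (hev : Even N) (hNt : 1 / t < N) {h : ℝ} (hh : 0 < h) :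
    ∃ C : ℝ, ∀ (m n : ℕ) (x : ℝ), |x| ^ m * ‖iteratedDeriv n (expNegPow N) x‖ ≤
      C * ((h ^ m * (m.factorial : ℝ) ^ t) * (h ^ n * (n.factorial : ℝ) ^ s)) := by
  have hN : N ≠ 0 := by
    rintro rfl
    exact absurd hNt (not_lt.2 (by simpa using ht.le))
  obtain ⟨C, hC, hderiv⟩ := exists_norm_iteratedDeriv_expNegPow_le hN hev hh
  obtain ⟨K, -, hK⟩ := exists_mul_rpow_le_mul_rpow_add (one_div_pos.2 ht).le hNt one_half_pos
    (a := t / h ^ (1 / t)) (by positivity)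
  have hexp (y : ℝ) (hy : 0 ≤ y) : t * (y / h) ^ (1 / t) - y ^ N / 2 ≤ K := by
    have hyK := hK y hy
    rw [Real.rpow_natCast] at hyK
    rw [Real.div_rpow hy hh.le, mul_div_left_comm, mul_comm]
    linarith
  refine ⟨C * Real.exp K, fun m n x => ?_⟩
  have hfact : (n.factorial : ℝ) ≤ (n.factorial : ℝ) ^ s :=
    Real.self_le_rpow_of_one_le (by exact_mod_cast n.factorial_pos) hs
  calc |x| ^ m * ‖iteratedDeriv n (expNegPow N) x‖
      ≤ (h ^ m * (m.factorial : ℝ) ^ t * Real.exp (t * (|x| / h) ^ (1 / t))) *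
        (C * (h ^ n * n.factorial) * Real.exp (-(|x| ^ N / 2))) :=
        mul_le_mul (pow_le_mul_factorial_rpow_mul_exp ht hh (abs_nonneg x) m) (hderiv n x)
          (norm_nonneg _) (by positivity)
    _ = C * Real.exp (t * (|x| / h) ^ (1 / t) - |x| ^ N / 2) *
        ((h ^ m * (m.factorial : ℝ) ^ t) * (h ^ n * n.factorial)) := by
        rw [sub_eq_add_neg, Real.exp_add]
        ring
    _ ≤ C * Real.exp K * ((h ^ m * (m.factorial : ℝ) ^ t) * (h ^ n * (n.factorial : ℝ) ^ s)) := by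
        gcongr
        exact hexp |x| (abs_nonneg x)

theorem GS.nontrivial (d : ℕ) {t s : ℝ} (ht : 0 < t) (hs : 1 ≤ s) : Nontrivial (GS d t s) := by
  obtain ⟨m, hm⟩ := exists_nat_gt (1 / t)
  have hNt : 1 / t < (2 * m : ℕ) := by
    push_cast
    linarith [Nat.cast_nonneg (α := ℝ) m]
  have hf := contDiff_expNegPow (2 * m)
  have hmem := prod_mem_gsSubmodule (d := d) (t := t) (s := s)
    (g := fun _ (x : ℝ) => expNegPow (2 * m) x)
    (fun _ => (hf.restrict_scalars ℝ).comp Complex.ofRealCLM.contDiff) fun _ h hh => by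
      simpa only [iteratedDeriv_comp_ofReal hf] using
        exists_abs_pow_mul_norm_iteratedDeriv_expNegPow_le ht hs (even_two_mul m) hNt hh
  refine ⟨⟨_, hmem⟩, 0, fun hzero => ?_⟩
  have hval : ∏ i : Fin d, expNegPow (2 * m) ((0 : E d) i) = 0 := congrFun (congrArg GS.fn hzero) 0
  exact Finset.prod_ne_zero_iff.2 (fun i _ => Complex.exp_ne_zero _) hval

theorem HasFourier.unique {t s : ℝ} [Nontrivial (GS d t s)] (ht : 0 < t) (hs : 0 < s)
    {u : GSDual d t s} {g₁ g₂ : E d → ℂ} (h₁ : HasFourier u g₁) (h₂ : HasFourier u g₂) :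
    g₁ = g₂ := by
  obtain ⟨ψ, hψ⟩ := exists_ne (0 : GS d t s)
  exact h₁.unique_of_ne_zero ht hs hψ h₂

end Nontriviality

section RayDecay

variable {X : Type*} [NormedAddCommGroup X] [NormedSpace ℝ X] {s : ℝ} {f : X → ℂ}

/-- Decay of `f` like `exp (-r ‖x‖ ^ (1/s))` on the set `A`, for every `r > 0`; this is the
condition imposed on cones in the definition of `V`. -/
def DecayOn (s : ℝ) (f : X → ℂ) (A : Set X) : Prop :=
  ∀ r : ℝ, 0 < r → ∃ C : ℝ, ∀ x ∈ A, Real.exp (r * ‖x‖ ^ (1 / s)) * ‖f x‖ ≤ C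

/-- Decay of `f (l ^ s • x)` like `exp (-r l)` uniformly in `x ∈ A`, for every `r > 0`; this is the
condition imposed on neighbourhoods in the definition of `nonDecay`. -/
def RayDecayOn (s : ℝ) (f : X → ℂ) (A : Set X) : Prop :=
  ∀ r : ℝ, 0 < r → ∃ C : ℝ, ∀ x ∈ A, ∀ l : ℝ, 0 < l → Real.exp (r * l) * ‖f (l ^ s • x)‖ ≤ C

theorem RayDecayOn.mono {A B : Set X} (hf : RayDecayOn s f B) (hAB : A ⊆ B) :
    RayDecayOn s f A := fun r hr =>
  let ⟨C, hC⟩ := hf r hr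
  ⟨C, fun x hx => hC x (hAB hx)⟩

theorem mul_rpow_one_div (hs : s ≠ 0) {l a : ℝ} (hl : 0 ≤ l) (ha : 0 ≤ a) :
    (l ^ s * a) ^ (1 / s) = l * a ^ (1 / s) := by
  rw [Real.mul_rpow (Real.rpow_nonneg hl s) ha, ← Real.rpow_mul hl, mul_one_div_cancel hs,
    Real.rpow_one]

theorem norm_rpow_smul_rpow (hs : s ≠ 0) {l : ℝ} (hl : 0 ≤ l) (x : X) :
    ‖l ^ s • x‖ ^ (1 / s) = l * ‖x‖ ^ (1 / s) := by
  rw [norm_smul, Real.norm_of_nonneg (Real.rpow_nonneg hl s),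
    mul_rpow_one_div hs hl (norm_nonneg x)]

theorem DecayOn.rayDecayOn (hs : 0 < s) {A : Set X}
    (hA : ∀ x ∈ A, ∀ l : ℝ, 0 < l → l • x ∈ A) (hf : DecayOn s f A) {a : ℝ} (ha : 0 < a) :
    RayDecayOn s f (A ∩ {x | a < ‖x‖}) := by
  intro r hr
  obtain ⟨C, hC⟩ := hf (r / a ^ (1 / s)) (by positivity)
  refine ⟨C, fun x hx l hl => ?_⟩
  have hexp : r * l ≤ r / a ^ (1 / s) * ‖l ^ s • x‖ ^ (1 / s) :=
    calc r * l = r / a ^ (1 / s) * (l * a ^ (1 / s)) := by field_simp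
      _ ≤ r / a ^ (1 / s) * (l * ‖x‖ ^ (1 / s)) := by
          gcongr
          exact hx.2.le
      _ = r / a ^ (1 / s) * ‖l ^ s • x‖ ^ (1 / s) := by rw [norm_rpow_smul_rpow hs.ne' hl.le]
  calc Real.exp (r * l) * ‖f (l ^ s • x)‖
      ≤ Real.exp (r / a ^ (1 / s) * ‖l ^ s • x‖ ^ (1 / s)) * ‖f (l ^ s • x)‖ := by gcongr
    _ ≤ C := hC _ (hA x hx.1 _ (Real.rpow_pos_of_pos hl s))

/-- The cone of all positive multiples of the elements of `A`. -/
def coneSpan (A : Set X) : Set X := {x | ∃ l : ℝ, 0 < l ∧ l • x ∈ A}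

theorem isOpen_coneSpan {A : Set X} (hA : IsOpen A) : IsOpen (coneSpan A) := by
  have hunion : coneSpan A = ⋃ (l : ℝ) (_ : 0 < l), (fun x : X => l • x) ⁻¹' A := by
    ext x
    simp [coneSpan]
  rw [hunion]
  exact isOpen_iUnion fun l => isOpen_iUnion fun _ => hA.preimage (continuous_const_smul l)

theorem subset_coneSpan (A : Set X) : A ⊆ coneSpan A := fun x hx =>
  ⟨1, one_pos, by rwa [one_smul]⟩

theorem smul_mem_coneSpan {A : Set X} {x : X} (hx : x ∈ coneSpan A) {l : ℝ} (hl : 0 < l) :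
    l • x ∈ coneSpan A := by
  obtain ⟨m, hm, hmx⟩ := hx
  exact ⟨m / l, div_pos hm hl, by rwa [smul_smul, div_mul_cancel₀ _ hl.ne']⟩

theorem coneSpan_subset_compl_zero {A : Set X} (hA : A ⊆ {0}ᶜ) : coneSpan A ⊆ {0}ᶜ := by
  rintro x ⟨l, -, hx⟩ rfl
  exact hA hx (smul_zero l)

theorem RayDecayOn.decayOn_coneSpan (hs : 0 < s) {A : Set X} {M : ℝ} (hA : ∀ x ∈ A, ‖x‖ ≤ M)
    (hf : RayDecayOn s f A) : DecayOn s f (coneSpan A) := by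
  intro r hr
  obtain ⟨C, hC⟩ := hf (r * |M| ^ (1 / s) + 1) (by positivity)
  refine ⟨C, ?_⟩
  rintro x ⟨k, hk, hx⟩
  set l : ℝ := k⁻¹ ^ (1 / s)
  have hl : 0 < l := by positivity
  have hxl : x = l ^ s • k • x := by
    rw [rpow_one_div_rpow hs.ne' (by positivity), inv_smul_smul₀ hk.ne']
  have hexp : r * ‖x‖ ^ (1 / s) ≤ (r * |M| ^ (1 / s) + 1) * l :=
    calc r * ‖x‖ ^ (1 / s) = r * (l * ‖k • x‖ ^ (1 / s)) := by
          rw [← norm_rpow_smul_rpow hs.ne' hl.le, ← hxl]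
      _ ≤ r * (l * |M| ^ (1 / s)) := by
          gcongr
          exact (hA _ hx).trans (le_abs_self M)
      _ ≤ (r * |M| ^ (1 / s) + 1) * l := by linarith
  calc Real.exp (r * ‖x‖ ^ (1 / s)) * ‖f x‖
      ≤ Real.exp ((r * |M| ^ (1 / s) + 1) * l) * ‖f (l ^ s • k • x)‖ := by
        rw [← hxl]
        gcongr
    _ ≤ C := hC _ hx l hl

theorem exists_cone_decayOn_iff (hs : 0 < s) {η : X} (hη : η ≠ 0) :
    (∃ Γ : Set X, IsOpen Γ ∧ Γ ⊆ {0}ᶜ ∧ (∀ x ∈ Γ, ∀ l : ℝ, 0 < l → l • x ∈ Γ) ∧ η ∈ Γ ∧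
      DecayOn s f Γ) ↔
    ∃ U : Set X, IsOpen U ∧ U ⊆ {0}ᶜ ∧ η ∈ U ∧ RayDecayOn s f U := by
  constructor
  · rintro ⟨Γ, hΓ, hΓ0, hcone, hηΓ, hf⟩
    have hη2 : 0 < ‖η‖ / 2 := half_pos (norm_pos_iff.2 hη)
    exact ⟨Γ ∩ {x | ‖η‖ / 2 < ‖x‖}, hΓ.inter (isOpen_lt continuous_const continuous_norm),
      fun x hx => hΓ0 hx.1, ⟨hηΓ, half_lt_self (norm_pos_iff.2 hη)⟩, hf.rayDecayOn hs hcone hη2⟩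
  · rintro ⟨U, hU, hU0, hηU, hf⟩
    set A := U ∩ {x | ‖x‖ < ‖η‖ + 1}
    exact ⟨coneSpan A, isOpen_coneSpan (hU.inter (isOpen_lt continuous_norm continuous_const)),
      coneSpan_subset_compl_zero (Set.inter_subset_left.trans hU0),
      fun x hx l hl => smul_mem_coneSpan hx hl, subset_coneSpan A ⟨hηU, lt_add_one ‖η‖⟩,
      (hf.mono Set.inter_subset_left).decayOn_coneSpan hs fun x hx => hx.2.le⟩

end RayDecay

theorem V_eq_nonDecay {t s : ℝ} [Nontrivial (GS d t s)] (ht : 0 < t) (hs : 0 < s)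
    {u : GSDual d t s} {g : E d → ℂ} (hg : HasFourier u g) : V u = nonDecay s g := by
  ext η
  refine and_congr_right fun hη => not_congr ?_
  refine Iff.trans ⟨?_, fun hcone => ⟨g, hg, hcone⟩⟩ (exists_cone_decayOn_iff hs hη)
  rintro ⟨g', hg', hcone⟩
  rwa [hg'.unique ht hs hg] at hcone

theorem nonDecay_const_mul_subset (s : ℝ) (a : ℂ) (f : E d → ℂ) :
    nonDecay s (fun x => a * f x) ⊆ nonDecay s f := by
  rintro x ⟨hx, hdecay⟩
  refine ⟨hx, fun ⟨U, hU, hU0, hxU, hf⟩ => hdecay ⟨U, hU, hU0, hxU, fun r hr => ?_⟩⟩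
  obtain ⟨C, hC⟩ := hf r hr
  refine ⟨‖a‖ * C, fun y hy l hl => ?_⟩
  rw [norm_mul, mul_left_comm]
  exact mul_le_mul_of_nonneg_left (hC y hy l hl) (norm_nonneg a)

theorem nonDecay_const_mul (s : ℝ) {a : ℂ} (ha : a ≠ 0) (f : E d → ℂ) :
    nonDecay s (fun x => a * f x) = nonDecay s f := by
  refine (nonDecay_const_mul_subset s a f).antisymm ?_
  simpa only [inv_mul_cancel_left₀ ha] using
    nonDecay_const_mul_subset s a⁻¹ fun x => a * f x

theorem pderiv_mul (j : Fin d) {f g : E d → ℂ} (hf : Differentiable ℝ f)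
    (hg : Differentiable ℝ g) : pderiv j (f * g) = pderiv j f * g + f * pderiv j g := by
  funext y
  simp only [pderiv, Pi.add_apply, Pi.mul_apply, fderiv_mul (hf y) (hg y), add_apply,
    _root_.smul_apply, smul_eq_mul]
  ring

/-- The binomial coefficients of the Leibniz rule sum up to the factor `2 ^ |β|`. -/
theorem norm_mderiv_mul_le (β : MIdx d) {f g : E d → ℂ} (hf : ContDiff ℝ ∞ f)
    (hg : ContDiff ℝ ∞ g) (x : E d) {W : MIdx d → ℝ}
    (hW : ∀ γ δ, ‖mderiv γ f x‖ * ‖mderiv δ g x‖ ≤ W (γ + δ)) :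
    ‖mderiv β (f * g) x‖ ≤ 2 ^ deg β * W β := by
  induction β using MIdx.induction generalizing f g W with
  | zero => simpa [mderiv_zero, deg_zero] using hW 0 0
  | add_single γ j ih =>
    have hf' := contDiff_pderiv j hf
    have hg' := contDiff_pderiv j hg
    have hleft := ih hf' hg (W := fun β => W (β + Pi.single j 1)) fun γ δ => by
      rw [mderiv_pderiv γ j hf, add_right_comm]
      exact hW _ _
    have hright := ih hf hg' (W := fun β => W (β + Pi.single j 1)) fun γ δ => by
      rw [mderiv_pderiv δ j hg, add_assoc]
      exact hW _ _
    calc ‖mderiv (γ + Pi.single j 1) (f * g) x‖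
        = ‖mderiv γ (pderiv j f * g) x + mderiv γ (f * pderiv j g) x‖ := by
          rw [← mderiv_pderiv γ j (f := f * g) (hf.mul hg),
            pderiv_mul j (hf.differentiable (by simp)) (hg.differentiable (by simp)),
            mderiv_add γ (f := pderiv j f * g) (g := f * pderiv j g) (hf'.mul hg) (hf.mul hg'),
            Pi.add_apply]
      _ ≤ 2 ^ deg γ * W (γ + Pi.single j 1) + 2 ^ deg γ * W (γ + Pi.single j 1) :=
          (norm_add_le _ _).trans (add_le_add hleft hright)
      _ = 2 ^ deg (γ + Pi.single j 1) * W (γ + Pi.single j 1) := by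
          rw [deg_add, deg_single]
          ring

theorem mfact_mul_mfact_le (α γ : MIdx d) : mfact α * mfact γ ≤ mfact (α + γ) := by
  simp only [mfact, ← Finset.prod_mul_distrib]
  refine Finset.prod_le_prod (fun _ _ => by positivity) fun i _ => ?_
  exact_mod_cast Nat.le_of_dvd (Nat.factorial_pos _)
    (Nat.factorial_mul_factorial_dvd_factorial_add (α i) (γ i))

theorem norm_mderiv_mul_le_of_le {h s A B : ℝ} (hh : 0 < h) (hs : 0 ≤ s) (hA : 0 ≤ A) (hB : 0 ≤ B)
    {f g : E d → ℂ} (hf : ContDiff ℝ ∞ f) (hg : ContDiff ℝ ∞ g) {x : E d}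
    (hfA : ∀ γ, ‖mderiv γ f x‖ ≤ A * (h ^ deg γ * mfact γ ^ s))
    (hgB : ∀ δ, ‖mderiv δ g x‖ ≤ B * (h ^ deg δ * mfact δ ^ s)) (β : MIdx d) :
    ‖mderiv β (f * g) x‖ ≤ A * B * ((2 * h) ^ deg β * mfact β ^ s) := by
  have hfact (γ : MIdx d) := (mfact_pos γ).le
  have hfact_s (γ : MIdx d) := Real.rpow_nonneg (hfact γ) s
  have hprod (γ δ : MIdx d) : ‖mderiv γ f x‖ * ‖mderiv δ g x‖ ≤
      A * B * (h ^ deg (γ + δ) * mfact (γ + δ) ^ s) :=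
    calc ‖mderiv γ f x‖ * ‖mderiv δ g x‖
        ≤ A * (h ^ deg γ * mfact γ ^ s) * (B * (h ^ deg δ * mfact δ ^ s)) :=
          mul_le_mul (hfA γ) (hgB δ) (norm_nonneg _)
            (mul_nonneg hA (mul_nonneg (by positivity) (hfact_s γ)))
      _ = A * B * (h ^ deg (γ + δ) * (mfact γ * mfact δ) ^ s) := by
          rw [Real.mul_rpow (hfact γ) (hfact δ), deg_add, pow_add]
          ring
      _ ≤ A * B * (h ^ deg (γ + δ) * mfact (γ + δ) ^ s) := by
          have := mul_nonneg (hfact γ) (hfact δ)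
          gcongr
          exact mfact_mul_mfact_le γ δ
  refine (norm_mderiv_mul_le β hf hg x
    (W := fun β => A * B * (h ^ deg β * mfact β ^ s)) hprod).trans_eq ?_
  rw [mul_pow]
  ring

theorem mderiv_conj (β : MIdx d) {f : E d → ℂ} (hf : ContDiff ℝ ∞ f) :
    mderiv β (fun x => starRingEnd ℂ (f x)) = fun x => starRingEnd ℂ (mderiv β f x) := by
  induction β using MIdx.induction generalizing f with
  | zero => simp [mderiv_zero]
  | add_single γ j ih =>
    have hconj : ContDiff ℝ ∞ fun x => starRingEnd ℂ (f x) := Complex.conjCLE.contDiff.comp hf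
    have hpderiv : pderiv j (fun x => starRingEnd ℂ (f x)) =
        fun x => starRingEnd ℂ (pderiv j f x) := by
      funext x
      have hcomp : fderiv ℝ (fun x => starRingEnd ℂ (f x)) x = _ :=
        ((Complex.conjCLE : ℂ →L[ℝ] ℂ).hasFDerivAt.comp x
          (hf.differentiable (by simp) x).hasFDerivAt).fderiv
      simp [pderiv, hcomp]
    rw [← mderiv_pderiv γ j hconj, hpderiv, ih (contDiff_pderiv j hf), mderiv_pderiv γ j hf]

theorem mderiv_translate (β : MIdx d) (a : E d) (f : E d → ℂ) :
    mderiv β (translate a f) = translate a (mderiv β f) := listDeriv_translate _ a β f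

theorem contDiff_translate (a : E d) {f : E d → ℂ} (hf : ContDiff ℝ ∞ f) :
    ContDiff ℝ ∞ (translate a f) := hf.comp (contDiff_id.sub contDiff_const)

theorem mderiv_modulate_const (α : MIdx d) (ξ : E d) (a : ℂ) :
    mderiv α (modulate ξ fun _ => a) =
      modulate ξ fun _ => Complex.I ^ deg α * (mono ξ α : ℂ) * a := by
  induction α using MIdx.induction generalizing a with
  | zero => simp [mderiv_zero, deg_zero, mono_zero]
  | add_single γ j ih =>
    have hqderiv : qderiv ξ j (fun _ => a) = fun _ => Complex.I * (ξ j : ℂ) * a := by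
      funext y
      simp [qderiv, pderiv]
    rw [← mderiv_pderiv γ j (contDiff_modulate ξ contDiff_const),
      pderiv_modulate ξ j contDiff_const, hqderiv, ih]
    congr 1
    funext y
    rw [deg_add, deg_single, mono_add, mono_single]
    push_cast
    ring

theorem norm_mderiv_modulate_one (α : MIdx d) (ξ y : E d) :
    ‖mderiv α (modulate ξ fun _ => 1) y‖ = |mono ξ α| := by
  simp [mderiv_modulate_const, norm_modulate]

/-- Bounds `‖N x ξ‖ = O(exp (-r ‖ξ‖ ^ (1/t) + ε ‖x‖ ^ (1/s)))` for all `r, ε > 0`: super-exponential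
decay in `ξ` at the cost of sub-exponential growth in `x`. -/
def SndDecay {X : Type*} [NormedAddCommGroup X] (s t : ℝ) (N : X → X → ℂ) : Prop :=
  ∀ r ε : ℝ, 0 < r → 0 < ε → ∃ C ≥ 0, ∀ x ξ, ‖N x ξ‖ ≤
    C * Real.exp (-r * ‖ξ‖ ^ (1 / t) + ε * ‖x‖ ^ (1 / s))

theorem exp_mul_rpow_mul_exp_neg_le {X : Type*} [SeminormedAddCommGroup X] {p ε : ℝ} (hp : 0 ≤ p)
    (hε : 0 ≤ ε) (r : ℝ) (x y : X) :
    Real.exp (ε / 2 ^ p * ‖y‖ ^ p) * Real.exp (-(ε + r) * ‖y - x‖ ^ p) ≤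
      Real.exp (ε * ‖x‖ ^ p) * Real.exp (-r * ‖y - x‖ ^ p) := by
  have hy : ε / 2 ^ p * ‖y‖ ^ p ≤ ε * (‖x‖ ^ p + ‖y - x‖ ^ p) :=
    calc ε / 2 ^ p * ‖y‖ ^ p ≤ ε / 2 ^ p * (2 ^ p * (‖x‖ ^ p + ‖y - x‖ ^ p)) := by
          gcongr
          simpa using norm_add_rpow_le hp x (y - x)
      _ = ε * (‖x‖ ^ p + ‖y - x‖ ^ p) := by field_simp
  rw [← Real.exp_add, ← Real.exp_add]
  exact Real.exp_le_exp.2 (by linarith)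

section STFT

variable {s t : ℝ} {c : MIdx d → ℂ}

theorem SmallCoeff.sndDecay_windowedFourier (hs : 0 < s) (ht : 0 < t) (hst : 1 ≤ s + t)
    (hc : SmallCoeff s c) (ψ : GS d s t) :
    SndDecay s t (windowedFourier (powerSeriesSum c) ψ.fn) := by
  intro r ε hr hε
  obtain ⟨h, hh, K, hK, hfourier⟩ := exists_norm_fourier_le d ht hr
  obtain ⟨A, hA, hf⟩ := hc.exists_norm_mderiv_le hs ht.le hst
    (div_pos hε (Real.rpow_pos_of_pos two_pos (1 / s))) (half_pos hh)
  obtain ⟨B, hB, hψ⟩ := ψ.exists_norm_mderiv_le hs (half_pos hh) (add_pos hε one_pos)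
  have hint := integrable_exp_neg_mul_norm_rpow (volume : Measure (E d)) (one_div_pos.2 hs) one_pos
  set I : ℝ := ∫ y : E d, Real.exp (-1 * ‖y‖ ^ (1 / s))
  have : 0 ≤ I := integral_nonneg fun _ => (Real.exp_pos _).le
  refine ⟨K * (A * B * I), by positivity, fun x ξ => ?_⟩
  have hsmooth := contDiff_translate x ψ.contDiff
  set g : E d → ℂ := fun y => starRingEnd ℂ (translate x ψ.fn y)
  have hg : ContDiff ℝ ∞ g := Complex.conjCLE.contDiff.comp hsmooth
  have hgB (δ : MIdx d) (y : E d) : ‖mderiv δ g y‖ ≤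
      B * Real.exp (-(ε + 1) * ‖y - x‖ ^ (1 / s)) * ((h / 2) ^ deg δ * mfact δ ^ t) := by
    rw [mderiv_conj δ hsmooth, RCLike.norm_conj, mderiv_translate, mul_right_comm]
    exact hψ δ (y - x)
  have hprod (β : MIdx d) (y : E d) : ‖mderiv β (powerSeriesSum c * g) y‖ ≤
      h ^ deg β * mfact β ^ t *
        (A * B * Real.exp (ε * ‖x‖ ^ (1 / s)) * Real.exp (-1 * ‖y - x‖ ^ (1 / s))) := by
    have hle := norm_mderiv_mul_le_of_le (half_pos hh) ht.le
      (mul_nonneg hA (Real.exp_pos _).le) (mul_nonneg hB (Real.exp_pos _).le)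
      (hc.of_le hs.le).contDiff hg (fun γ => (hf γ y).trans_eq (mul_right_comm _ _ _))
      (fun δ => hgB δ y) β
    have hexp := exp_mul_rpow_mul_exp_neg_le (one_div_pos.2 hs).le hε.le 1 x y
    have hfact := mul_nonneg (pow_nonneg hh.le (deg β)) (Real.rpow_nonneg (mfact_pos β).le t)
    rw [mul_div_cancel₀ h two_ne_zero, mul_mul_mul_comm A _ B] at hle
    rw [mul_assoc (A * B), mul_comm (h ^ _ * _)]
    exact hle.trans (mul_le_mul_of_nonneg_right
      (mul_le_mul_of_nonneg_left hexp (mul_nonneg hA hB)) hfact)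
  refine (hfourier _ _ ((hc.of_le hs.le).contDiff.mul hg)
    ((hint.comp_sub_right x).const_mul _) hprod ξ).trans_eq ?_
  rw [integral_const_mul,
    integral_sub_right_eq_self (fun y : E d => Real.exp (-1 * ‖y‖ ^ (1 / s))) x, Real.exp_add]
  ring

theorem GS.exists_norm_mderiv_tfShift_le (ht : 0 < t) (hs : 0 < s) (ψ : GS d t s) {r ε : ℝ}
    (hr : 0 < r) (hε : 0 < ε) : ∃ h > 0, ∃ C ≥ 0, ∀ (x ξ : E d) (α : MIdx d),
      ‖mderiv α (tfShift ht hs x ξ ψ).fn 0‖ ≤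
        C * Real.exp (-r * ‖x‖ ^ (1 / t) + ε * ‖ξ‖ ^ (1 / s)) * (h ^ deg α * mfact α ^ s) := by
  obtain ⟨h, hh, hmono⟩ := exists_abs_mono_le_exp d hs hε
  obtain ⟨C, hC, hψ⟩ := ψ.exists_norm_mderiv_le ht hh hr
  refine ⟨2 * h, by positivity, C, hC, fun x ξ α => ?_⟩
  have hphase (γ : MIdx d) : ‖mderiv γ (modulate ξ fun _ => 1) 0‖ ≤
      Real.exp (ε * ‖ξ‖ ^ (1 / s)) * (h ^ deg γ * mfact γ ^ s) := by
    rw [norm_mderiv_modulate_one, mul_comm]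
    exact hmono h le_rfl ξ γ
  have htranslate (δ : MIdx d) : ‖mderiv δ (translate x ψ.fn) 0‖ ≤
      C * Real.exp (-r * ‖x‖ ^ (1 / t)) * (h ^ deg δ * mfact δ ^ s) := by
    rw [mderiv_translate, mul_right_comm]
    simpa [translate] using hψ δ (0 - x)
  have hshift : (tfShift ht hs x ξ ψ).fn = (modulate ξ fun _ => 1) * translate x ψ.fn := by
    funext y
    exact congrArg (· * translate x ψ.fn y) (mul_one _).symm
  rw [hshift]
  refine (norm_mderiv_mul_le_of_le hh hs.le (Real.exp_pos _).le
    (mul_nonneg hC (Real.exp_pos _).le) (contDiff_modulate ξ contDiff_const)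
    (contDiff_translate x ψ.contDiff) hphase htranslate α).trans_eq ?_
  rw [Real.exp_add]
  ring

theorem IsDiracSeries.sndDecay_stft (ht : 0 < t) (hs : 0 < s) (hc : SmallCoeff s c)
    {u : GSDual d t s} (hu : IsDiracSeries c u) (ψ : GS d t s) :
    SndDecay s t fun ξ x => stft ht hs ψ u x ξ := by
  intro r ε hr hε
  obtain ⟨h, hh, C, hC, hψ⟩ := ψ.exists_norm_mderiv_tfShift_le ht hs hr hε
  refine ⟨coeffNorm s h c * C, mul_nonneg (coeffNorm_nonneg s hh.le c) hC, fun ξ x => ?_⟩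
  refine (norm_fourierConst_mul_le d _).trans ?_
  rw [← (hu _).tsum_eq, coeffNorm, mul_assoc, ← tsum_mul_right]
  refine tsum_of_norm_bounded ((hc h hh).mul_right _).hasSum fun α => ?_
  have hD : ‖Dop α (tfShift ht hs x ξ ψ).fn 0‖ = ‖mderiv α (tfShift ht hs x ξ ψ).fn 0‖ := by
    simp [Dop]
  rw [norm_mul, RCLike.norm_conj, hD]
  refine (mul_le_mul_of_nonneg_left (hψ x ξ α) (norm_nonneg _)).trans_eq ?_
  ring

end STFT

section LocDecay

variable {X : Type*} [NormedAddCommGroup X] {s t : ℝ}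

theorem SndDecay.exists_norm_le {N : X → X → ℂ} (hN : SndDecay s t N) {M a r : ℝ} (hM : 0 ≤ M)
    (ha : 0 < a) (hr : 0 < r) : ∃ C ≥ 0, ∀ (x ξ : X) (l : ℝ), ‖x‖ ^ (1 / s) ≤ l * M →
      l * a ≤ ‖ξ‖ ^ (1 / t) →
      ‖N x ξ‖ ≤ C * (Real.exp (-(r * l)) * Real.exp (-1 * ‖ξ‖ ^ (1 / t))) := by
  obtain ⟨C, hC, hNC⟩ := hN ((r + M) / a + 1) 1 (by positivity) one_pos
  refine ⟨C, hC, fun x ξ l hx hξ => (hNC x ξ).trans ?_⟩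
  have hξ' : (r + M) * l ≤ (r + M) / a * ‖ξ‖ ^ (1 / t) :=
    calc (r + M) * l = (r + M) / a * (l * a) := by field_simp
      _ ≤ (r + M) / a * ‖ξ‖ ^ (1 / t) := by gcongr
  rw [← Real.exp_add]
  exact mul_le_mul_of_nonneg_left (Real.exp_le_exp.2 (by linarith)) hC

theorem SubExpGrowth.const_mul {f : X → ℂ} (hf : SubExpGrowth s f) (a : ℂ) :
    SubExpGrowth s fun x => a * f x where
  continuous := continuous_const.mul hf.continuous
  bound ε hε := by
    obtain ⟨C, hC, hfC⟩ := hf.bound ε hε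
    refine ⟨‖a‖ * C, by positivity, fun x => ?_⟩
    rw [norm_mul, mul_assoc]
    exact mul_le_mul_of_nonneg_left (hfC x) (norm_nonneg a)

theorem SubExpGrowth.sndDecay_mul (hs : 0 < s) {f ρ : X → ℂ} (hf : SubExpGrowth s f)
    (hρ : SuperExpDecay s ρ) : SndDecay s s fun x z => f (x + z) * ρ z := by
  intro r ε hr hε
  obtain ⟨A, hA, hfA⟩ := hf.bound (ε / 2 ^ (1 / s)) (by positivity)
  obtain ⟨B, hB, hρB⟩ := hρ.bound (ε + r) (by positivity)
  refine ⟨A * B, by positivity, fun x z => ?_⟩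
  have hexp := exp_mul_rpow_mul_exp_neg_le (one_div_nonneg.2 hs.le) hε.le r x (x + z)
  rw [add_sub_cancel_left] at hexp
  calc ‖f (x + z) * ρ z‖
      ≤ A * Real.exp (ε / 2 ^ (1 / s) * ‖x + z‖ ^ (1 / s)) *
        (B * Real.exp (-(ε + r) * ‖z‖ ^ (1 / s))) := by
        rw [norm_mul]
        exact mul_le_mul (hfA _) (hρB z) (norm_nonneg _) (by positivity)
    _ ≤ A * B * (Real.exp (ε * ‖x‖ ^ (1 / s)) * Real.exp (-r * ‖z‖ ^ (1 / s))) := by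
        rw [mul_mul_mul_comm]
        gcongr
    _ = A * B * Real.exp (-r * ‖z‖ ^ (1 / s) + ε * ‖x‖ ^ (1 / s)) := by
        rw [← Real.exp_add, add_comm]

variable [NormedSpace ℝ X]

/-- Decay of `N (l ^ s • x) (l ^ t • ξ)` like `exp (-r l)`, for every `r > 0`, uniformly in `(x, ξ)`
near `(x₀, ξ₀)`. With `N` a short-time Fourier transform, this says that `(x₀, ξ₀)` is not in the
wave front set. -/
def LocDecay (s t : ℝ) (N : X → X → ℂ) (x₀ ξ₀ : X) : Prop :=
  ∃ δ > 0, ∀ r : ℝ, 0 < r → ∃ C : ℝ, ∀ l : ℝ, 0 < l → ∀ x ∈ Metric.ball x₀ δ,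
    ∀ ξ ∈ Metric.ball ξ₀ δ, Real.exp (r * l) * ‖N (l ^ s • x) (l ^ t • ξ)‖ ≤ C

theorem locDecay_swap_neg_iff {N N' : X → X → ℂ} (hNN' : ∀ x ξ, ‖N x ξ‖ = ‖N' ξ (-x)‖)
    (x₀ ξ₀ : X) : LocDecay t s N x₀ ξ₀ ↔ LocDecay s t N' ξ₀ (-x₀) := by
  have hball {y : X} {δ : ℝ} : -y ∈ Metric.ball (-x₀) δ ↔ y ∈ Metric.ball x₀ δ := by
    simp only [Metric.mem_ball, dist_neg_neg]
  refine exists_congr fun δ => and_congr_right fun _ => forall₂_congr fun r _ =>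
    exists_congr fun C => forall₂_congr fun l _ => ⟨fun H ξ hξ y hy => ?_, fun H y hy ξ hξ => ?_⟩
  · rw [← neg_neg y] at hy ⊢
    rw [smul_neg, ← hNN']
    exact H (-y) (hball.1 hy) ξ hξ
  · rw [hNN', ← smul_neg]
    exact H ξ hξ (-y) (hball.2 hy)

theorem SndDecay.locDecay (hs : 0 < s) (ht : 0 < t) {N : X → X → ℂ} (hN : SndDecay s t N) (x₀ : X)
    {ξ₀ : X} (hξ₀ : ξ₀ ≠ 0) : LocDecay s t N x₀ ξ₀ := by
  have hδ : 0 < ‖ξ₀‖ / 2 := half_pos (norm_pos_iff.2 hξ₀)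
  refine ⟨‖ξ₀‖ / 2, hδ, fun r hr => ?_⟩
  obtain ⟨C, hC, hNC⟩ := hN.exists_norm_le
    (Real.rpow_nonneg (by positivity : 0 ≤ ‖x₀‖ + ‖ξ₀‖ / 2) (1 / s))
    (Real.rpow_pos_of_pos hδ (1 / t)) hr
  refine ⟨C, fun l hl x hx ξ hξ => ?_⟩
  have hx' : ‖l ^ s • x‖ ^ (1 / s) ≤ l * (‖x₀‖ + ‖ξ₀‖ / 2) ^ (1 / s) := by
    rw [norm_rpow_smul_rpow hs.ne' hl.le]
    gcongr
    exact (norm_lt_of_mem_ball hx).le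
  have hξ' : l * (‖ξ₀‖ / 2) ^ (1 / t) ≤ ‖l ^ t • ξ‖ ^ (1 / t) := by
    rw [norm_rpow_smul_rpow ht.ne' hl.le]
    gcongr
    linarith [norm_lt_of_mem_ball (Metric.mem_ball_comm.1 hξ)]
  have hexp : Real.exp (-1 * ‖l ^ t • ξ‖ ^ (1 / t)) ≤ 1 :=
    Real.exp_le_one_iff.2 (by linarith [Real.rpow_nonneg (norm_nonneg (l ^ t • ξ)) (1 / t)])
  calc Real.exp (r * l) * ‖N (l ^ s • x) (l ^ t • ξ)‖
      ≤ Real.exp (r * l) * (C * (Real.exp (-(r * l)) * 1)) := by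
        gcongr
        refine (hNC _ _ l hx' hξ').trans ?_
        gcongr
    _ = C := by rw [mul_one, mul_left_comm, ← Real.exp_add, add_neg_cancel, Real.exp_zero, mul_one]

theorem inv_smul_mem_ball_zero {a δ : ℝ} (ha : 0 < a) {x : X} (hx : ‖x‖ < a * δ) :
    a⁻¹ • x ∈ Metric.ball 0 δ := by
  rwa [mem_ball_zero_iff, norm_smul, norm_inv, Real.norm_of_nonneg ha.le, inv_mul_lt_iff₀ ha]

theorem LocDecay.exists_norm_le (hs : 0 < s) (ht : 0 < t) {N : X → X → ℂ} (hN : SndDecay s t N)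
    {x₀ : X} (hloc : LocDecay s t N x₀ 0) : ∃ δ > 0, ∀ r : ℝ, 0 < r → ∃ C ≥ 0,
      ∀ x ∈ Metric.ball x₀ δ, ∀ l : ℝ, 0 < l → ∀ ξ,
        ‖N (l ^ s • x) ξ‖ ≤ C * (Real.exp (-(r * l)) * Real.exp (-1 * ‖ξ‖ ^ (1 / t))) := by
  obtain ⟨δ, hδ, hloc⟩ := hloc
  refine ⟨δ, hδ, fun r hr => ?_⟩
  set a : ℝ := δ ^ (1 / t)
  have ha : 0 < a := Real.rpow_pos_of_pos hδ _
  obtain ⟨A, hA⟩ := hloc (r + a) (by positivity)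
  obtain ⟨B, hB, hNB⟩ := hN.exists_norm_le
    (Real.rpow_nonneg (by positivity : 0 ≤ ‖x₀‖ + δ) (1 / s)) ha hr
  refine ⟨max A B, hB.trans (le_max_right A B), fun x hx l hl ξ => ?_⟩
  have hlt : 0 < l ^ t := Real.rpow_pos_of_pos hl t
  have hscale : (l ^ t * δ) ^ (1 / t) = l * a := mul_rpow_one_div ht.ne' hl.le hδ.le
  rcases lt_or_ge ‖ξ‖ (l ^ t * δ) with hnear | hfar
  · have hbound := hA l hl x hx _ (inv_smul_mem_ball_zero hlt hnear)
    rw [smul_inv_smul₀ hlt.ne'] at hbound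
    have hξ : ‖ξ‖ ^ (1 / t) ≤ l * a := by
      rw [← hscale]
      gcongr
    have hexp : 1 ≤ Real.exp ((r + a) * l) *
        (Real.exp (-(r * l)) * Real.exp (-1 * ‖ξ‖ ^ (1 / t))) := by
      rw [← Real.exp_add, ← Real.exp_add, Real.one_le_exp_iff]
      linarith
    set e := Real.exp (-(r * l)) * Real.exp (-1 * ‖ξ‖ ^ (1 / t))
    calc ‖N (l ^ s • x) ξ‖ ≤ ‖N (l ^ s • x) ξ‖ * (Real.exp ((r + a) * l) * e) :=
          le_mul_of_one_le_right (norm_nonneg _) hexp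
      _ = Real.exp ((r + a) * l) * ‖N (l ^ s • x) ξ‖ * e := by ring
      _ ≤ max A B * e := by
          gcongr
          exact hbound.trans (le_max_left A B)
  · refine (hNB _ ξ l ?_ ?_).trans (by gcongr; exact le_max_right A B)
    · rw [norm_rpow_smul_rpow hs.ne' hl.le]
      gcongr
      exact (norm_lt_of_mem_ball hx).le
    · rw [← hscale]
      gcongr

theorem RayDecayOn.locDecay_mul {f ρ : X → ℂ} (hρ : SuperExpDecay s ρ) {x₀ : X} {δ : ℝ}
    (hδ : 0 < δ) (hf : RayDecayOn s f (Metric.ball x₀ δ)) :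
    LocDecay s s (fun x z => f (x + z) * ρ z) x₀ 0 := by
  refine ⟨δ / 2, half_pos hδ, fun r hr => ?_⟩
  obtain ⟨A, hA⟩ := hf r hr
  obtain ⟨B, hB, hρB⟩ := hρ.bound 1 one_pos
  refine ⟨A * B, fun l hl x hx z hz => ?_⟩
  have hxz : x + z ∈ Metric.ball x₀ δ := by
    rw [mem_ball_iff_norm] at hx ⊢
    rw [mem_ball_zero_iff] at hz
    rw [add_sub_right_comm]
    linarith [norm_add_le (x - x₀) z]
  have hfA := hA (x + z) hxz l hl
  have hρ1 : ‖ρ (l ^ s • z)‖ ≤ B := (hρB _).trans <| mul_le_of_le_one_right hB <|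
    Real.exp_le_one_iff.2 (by linarith [Real.rpow_nonneg (norm_nonneg (l ^ s • z)) (1 / s)])
  simp only [← smul_add, norm_mul, ← mul_assoc]
  exact mul_le_mul hfA hρ1 (norm_nonneg _) ((by positivity : (0 : ℝ) ≤ _).trans hfA)

theorem SubExpGrowth.exists_norm_smul_le (hs : 0 < s) {f : X → ℂ} (hf : SubExpGrowth s f)
    (M L : ℝ) : ∃ C ≥ 0, ∀ (x : X) (l : ℝ), 0 < l → ‖x‖ ≤ M → l ≤ L →
      ‖f (l ^ s • x)‖ ≤ C := by
  obtain ⟨C, hC, hfC⟩ := hf.bound 1 one_pos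
  refine ⟨C * Real.exp (L * M ^ (1 / s)), by positivity, fun x l hl hx hlL => (hfC _).trans ?_⟩
  rw [norm_rpow_smul_rpow hs.ne' hl.le, one_mul]
  have : 0 ≤ L := hl.le.trans hlL
  gcongr

theorem RayDecayOn.of_comp_add_right (hs : 0 < s) {f : X → ℂ} (hf : SubExpGrowth s f) {x₀ z₀ : X}
    {δ : ℝ} (hδ : 0 < δ) (hshift : RayDecayOn s (fun y => f (y + z₀)) (Metric.ball x₀ δ)) :
    RayDecayOn s f (Metric.ball x₀ (δ / 2)) := by
  intro r hr
  obtain ⟨A, hA⟩ := hshift r hr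
  set L : ℝ := (‖z₀‖ / (δ / 2)) ^ (1 / s) with hL
  obtain ⟨B, _, hfB⟩ := hf.exists_norm_smul_le hs (‖x₀‖ + δ / 2) L
  refine ⟨max A (Real.exp (r * L) * B), fun y hy l hl => ?_⟩
  have hls : 0 < l ^ s := Real.rpow_pos_of_pos hl s
  rcases lt_or_ge ‖z₀‖ (l ^ s * (δ / 2)) with hlarge | hsmall
  · have hmem : y - (l ^ s)⁻¹ • z₀ ∈ Metric.ball x₀ δ := by
      have hz₀ := mem_ball_zero_iff.1 (inv_smul_mem_ball_zero hls hlarge)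
      rw [mem_ball_iff_norm] at hy ⊢
      rw [sub_right_comm]
      linarith [norm_sub_le (y - x₀) ((l ^ s)⁻¹ • z₀)]
    have hbound := hA _ hmem l hl
    simp only [smul_sub, smul_inv_smul₀ hls.ne', sub_add_cancel] at hbound
    exact hbound.trans (le_max_left _ _)
  · have hlL : l ≤ L :=
      calc l = (l ^ s) ^ (1 / s) := by
            rw [← Real.rpow_mul hl.le, mul_one_div_cancel hs.ne', Real.rpow_one]
        _ ≤ L := by
            rw [hL]
            gcongr
            exact (le_div_iff₀ (half_pos hδ)).2 hsmall
    refine le_max_of_le_right ?_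
    gcongr
    exact hfB y l hl (norm_lt_of_mem_ball hy).le hlL

end LocDecay

section WaveFront

variable {s t : ℝ} {f ρ : E d → ℂ} {x₀ : E d}

theorem mem_WF_iff {t s : ℝ} (ht : 0 < t) (hs : 0 < s) (ψ : GS d t s) (u : GSDual d t s)
    (x₀ ξ₀ : E d) :
    (x₀, ξ₀) ∈ WF ht hs ψ u ↔ (x₀, ξ₀) ≠ 0 ∧ ¬LocDecay t s (stft ht hs ψ u) x₀ ξ₀ := by
  refine and_congr_right fun hz => not_congr ⟨?_, ?_⟩
  · rintro ⟨U, hU, -, hzU, hdecay⟩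
    obtain ⟨δ, hδ, hball⟩ := Metric.isOpen_iff.1 hU _ hzU
    refine ⟨δ, hδ, fun r hr => ?_⟩
    obtain ⟨C, hC⟩ := hdecay r hr
    refine ⟨C, fun l hl x hx ξ hξ => hC l hl (x, ξ) (hball ?_)⟩
    rw [← ball_prod_same]
    exact ⟨hx, hξ⟩
  · rintro ⟨δ, hδ, hdecay⟩
    refine ⟨Metric.ball x₀ δ ×ˢ Metric.ball ξ₀ δ ∩ {0}ᶜ,
      (Metric.isOpen_ball.prod Metric.isOpen_ball).inter isOpen_compl_singleton,
      Set.inter_subset_right, ⟨⟨Metric.mem_ball_self hδ, Metric.mem_ball_self hδ⟩, hz⟩,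
      fun r hr => ?_⟩
    obtain ⟨C, hC⟩ := hdecay r hr
    exact ⟨C, fun l hl p hp => hC l hl p.1 hp.1.1 p.2 hp.1.2⟩

theorem mem_nonDecay_iff :
    x₀ ∈ nonDecay s f ↔ x₀ ≠ 0 ∧ ¬∃ δ > 0, RayDecayOn s f (Metric.ball x₀ δ) := by
  refine and_congr_right fun hx₀ => not_congr ⟨?_, ?_⟩
  · rintro ⟨U, hU, -, hxU, hdecay⟩
    obtain ⟨δ, hδ, hball⟩ := Metric.isOpen_iff.1 hU x₀ hxU
    exact ⟨δ, hδ, RayDecayOn.mono hdecay hball⟩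
  · rintro ⟨δ, hδ, hdecay⟩
    exact ⟨Metric.ball x₀ δ ∩ {0}ᶜ, Metric.isOpen_ball.inter isOpen_compl_singleton,
      Set.inter_subset_right, ⟨Metric.mem_ball_self hδ, hx₀⟩, hdecay.mono Set.inter_subset_left⟩

theorem norm_windowedFourier_le_integral (f ρ : E d → ℂ) (x ξ : E d) :
    ‖windowedFourier f ρ x ξ‖ ≤ ∫ z, ‖f (x + z) * ρ z‖ := by
  refine (norm_fourier_le_integral _ ξ).trans_eq ?_
  rw [← integral_add_left_eq_self _ x]
  simp [translate]

theorem SuperExpDecay.translate (hs : 0 < s) (hρ : SuperExpDecay s ρ) (a : E d) :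
    SuperExpDecay s (translate a ρ) where
  continuous := hρ.continuous.comp (continuous_id.sub continuous_const)
  bound r hr := by
    obtain ⟨C, hC, hρC⟩ := hρ.bound (r * 2 ^ (1 / s)) (by positivity)
    refine ⟨C * Real.exp (r * 2 ^ (1 / s) * ‖a‖ ^ (1 / s)), by positivity,
      fun x => (hρC (x - a)).trans ?_⟩
    have hx : ‖x‖ ^ (1 / s) ≤ 2 ^ (1 / s) * (‖x - a‖ ^ (1 / s) + ‖a‖ ^ (1 / s)) := by
      simpa using norm_add_rpow_le (one_div_nonneg.2 hs.le) (x - a) a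
    rw [mul_assoc, ← Real.exp_add]
    gcongr
    linarith [mul_le_mul_of_nonneg_left hx hr.le]

theorem RayDecayOn.locDecay_windowedFourier (hs : 0 < s) (hf : SubExpGrowth s f)
    (hρ : SuperExpDecay s ρ) {δ : ℝ} (hδ : 0 < δ) (hdecay : RayDecayOn s f (Metric.ball x₀ δ))
    (ξ₀ : E d) : LocDecay s t (windowedFourier f ρ) x₀ ξ₀ := by
  obtain ⟨η, hη, hbound⟩ :=
    (hdecay.locDecay_mul hρ hδ).exists_norm_le hs hs (hf.sndDecay_mul hs hρ)
  refine ⟨η, hη, fun r hr => ?_⟩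
  obtain ⟨C, -, hC⟩ := hbound r hr
  have hint := integrable_exp_neg_mul_norm_rpow (volume : Measure (E d)) (one_div_pos.2 hs) one_pos
  refine ⟨C * ∫ z : E d, Real.exp (-1 * ‖z‖ ^ (1 / s)), fun l hl x hx ξ _ => ?_⟩
  calc Real.exp (r * l) * ‖windowedFourier f ρ (l ^ s • x) (l ^ t • ξ)‖
      ≤ Real.exp (r * l) *
        ∫ z, C * (Real.exp (-(r * l)) * Real.exp (-1 * ‖z‖ ^ (1 / s))) := by
        gcongr
        refine (norm_windowedFourier_le_integral f ρ _ _).trans ?_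
        exact integral_mono_of_nonneg (.of_forall fun z => norm_nonneg _)
          ((hint.const_mul _).const_mul C) (.of_forall (hC x hx l hl))
    _ = C * ∫ z : E d, Real.exp (-1 * ‖z‖ ^ (1 / s)) := by
        rw [integral_const_mul, integral_const_mul, mul_left_comm, ← mul_assoc (Real.exp _),
          ← Real.exp_add, add_neg_cancel, Real.exp_zero, one_mul]

theorem LocDecay.exists_rayDecayOn (hs : 0 < s) (ht : 0 < t) (hf : SubExpGrowth s f)
    (hρ : SuperExpDecay s ρ) {z₀ : E d} (hz₀ : ρ z₀ ≠ 0)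
    (hN : SndDecay s t (windowedFourier f ρ))
    (hloc : LocDecay s t (windowedFourier f ρ) x₀ 0) :
    ∃ δ > 0, RayDecayOn s f (Metric.ball x₀ δ) := by
  obtain ⟨δ, hδ, hbound⟩ := hloc.exists_norm_le hs ht hN
  refine ⟨δ / 2, half_pos hδ, .of_comp_add_right hs hf hδ (z₀ := z₀) fun r hr => ?_⟩
  obtain ⟨C, -, hC⟩ := hbound r hr
  have hint := integrable_exp_neg_mul_norm_rpow (volume : Measure (E d)) (one_div_pos.2 ht) one_pos
  set I : ℝ := ∫ ξ : E d, Real.exp (-1 * ‖ξ‖ ^ (1 / t))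
  refine ⟨C * I / ‖ρ z₀‖, fun x hx l hl => ?_⟩
  have hwindow := hf.mul_decay (hρ.translate hs (l ^ s • x)).conj
  have hinversion : ‖f (l ^ s • x + z₀)‖ * ‖ρ z₀‖ ≤ C * (Real.exp (-(r * l)) * I) := by
    have hle := norm_le_integral_of_norm_fourier_le hwindow.continuous (hwindow.integrable _ hs)
      ((hint.const_mul _).const_mul C) (hC x hx l hl) (l ^ s • x + z₀)
    simpa only [norm_mul, RCLike.norm_conj, GelfandShilov.translate, add_sub_cancel_left,
      integral_const_mul] using hle
  rw [le_div_iff₀ (norm_pos_iff.2 hz₀), mul_assoc]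
  refine (mul_le_mul_of_nonneg_left hinversion (Real.exp_pos _).le).trans_eq ?_
  rw [mul_left_comm, ← mul_assoc (Real.exp _), ← Real.exp_add, add_neg_cancel, Real.exp_zero,
    one_mul]

theorem not_locDecay_windowedFourier_iff (hs : 0 < s) (ht : 0 < t) (hf : SubExpGrowth s f)
    (hρ : SuperExpDecay s ρ) {z₀ : E d} (hz₀ : ρ z₀ ≠ 0)
    (hN : SndDecay s t (windowedFourier f ρ)) {ξ₀ : E d} :
    (x₀, ξ₀) ≠ 0 ∧ ¬LocDecay s t (windowedFourier f ρ) x₀ ξ₀ ↔ x₀ ∈ nonDecay s f ∧ ξ₀ = 0 := by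
  by_cases hξ₀ : ξ₀ = 0
  · subst hξ₀
    simp only [ne_eq, Prod.mk_eq_zero, and_true, mem_nonDecay_iff]
    exact and_congr_right fun _ => not_congr
      ⟨fun hloc => hloc.exists_rayDecayOn hs ht hf hρ hz₀ hN,
        fun ⟨δ, hδ, hdecay⟩ => hdecay.locDecay_windowedFourier hs hf hρ hδ 0⟩
  · exact iff_of_false (fun h => h.2 (hN.locDecay hs ht x₀ hξ₀)) fun h => hξ₀ h.2

theorem WF_powerSeries (hs : 0 < s) (ht : 0 < t) (hst : 1 ≤ s + t) {c : MIdx d → ℂ}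
    (hc : SmallCoeff s c) {F : GSDual d s t} (hF : IsFunction F (powerSeriesSum c))
    {ψ : GS d s t} (hψ : ψ ≠ 0) : WF hs ht ψ F = nonDecay s (powerSeriesSum c) ×ˢ {0} := by
  obtain ⟨y, hy⟩ : ∃ y, ψ.fn y ≠ 0 := by
    contrapose! hψ
    exact GS.ext_fn (funext hψ)
  have hstft : stft hs ht ψ F = windowedFourier (powerSeriesSum c) ψ.fn := by
    funext x ξ
    exact hF.stft_eq hs ht ψ x ξ
  ext ⟨x, ξ⟩
  rw [mem_WF_iff, hstft]
  exact not_locDecay_windowedFourier_iff hs ht (hc.subExpGrowth hs) (ψ.superExpDecay hs) hy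
    (hc.sndDecay_windowedFourier hs ht hst ψ)

theorem WF_diracSeries (ht : 0 < t) (hs : 0 < s) {c : MIdx d → ℂ} (hc : SmallCoeff s c)
    {u : GSDual d t s} (hu : IsDiracSeries c u) {ψ : GS d t s} (hψ : ψ ≠ 0) :
    WF ht hs ψ u = {0} ×ˢ nonDecay s (powerSeriesSum c) := by
  obtain ⟨η, hη⟩ := ψ.exists_fourier_ne_zero ht hψ
  set g : E d → ℂ := fun ξ => (fourierConst d : ℂ) * powerSeriesSum c ξ
  have hnonDecay : nonDecay s g = nonDecay s (powerSeriesSum c) :=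
    nonDecay_const_mul s (Complex.ofReal_ne_zero.2 (fourierConst_pos d).ne') _
  have hnorm (x ξ : E d) :
      ‖stft ht hs ψ u x ξ‖ = ‖windowedFourier g (fourier ψ.fn) ξ (-x)‖ := by
    rw [(hu.hasFourier ht hs hc).stft_eq, norm_mul, Complex.norm_exp]
    simp [g]
  have hN : SndDecay s t (windowedFourier g (fourier ψ.fn)) := fun r ε hr hε => by
    obtain ⟨C, hC, hbound⟩ := hu.sndDecay_stft ht hs hc ψ r ε hr hε
    refine ⟨C, hC, fun ξ y => ?_⟩
    simpa only [hnorm, neg_neg, norm_neg] using hbound ξ (-y)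
  ext ⟨x, ξ⟩
  have hz : (x, ξ) ≠ 0 ↔ (ξ, -x) ≠ 0 := by
    simp only [ne_eq, Prod.mk_eq_zero, neg_eq_zero, and_comm]
  rw [mem_WF_iff, locDecay_swap_neg_iff hnorm, hz, not_locDecay_windowedFourier_iff hs ht
    ((hc.subExpGrowth hs).const_mul _) (ψ.superExpDecay_fourier ht hs) hη hN, hnonDecay,
    neg_eq_zero, and_comm]
  rfl

end WaveFront

end GelfandShilov

end

open GelfandShilov in
theorem proposition7p4_general (d : ℕ) (s t : ℝ) (hs : 0 < s) (ht : 0 < t) (hst : 1 ≤ s + t)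
    [Nontrivial (GS d t s)] (c : MIdx d → ℂ)
    (hc : ∀ r : ℝ, 0 < r → Summable fun α => ‖c α‖ * r ^ deg α * mfact α ^ s) :
    (∀ x : E d, Summable fun α => c α * (mono x α : ℂ)) ∧
    ∃ (u : GSDual d t s) (F : GSDual d s t),
      IsDiracSeries c u ∧
      IsPowerSeries c F ∧ IsFunction F (powerSeriesSum c) ∧
      V u = nonDecay s (powerSeriesSum c) ∧
      (∀ ψ : GS d t s, ψ ≠ 0 → WF ht hs ψ u = {0} ×ˢ V u) ∧
      (∀ ψ : GS d s t, ψ ≠ 0 → WF hs ht ψ F = V u ×ˢ {0}) := by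
  have hc' : SmallCoeff s c := hc
  have hgrowth := hc'.subExpGrowth hs
  have hu := isDiracSeries_diracSeries t hc'
  have hF := isFunction_functionDual t hs hgrowth
  have hV : V (diracSeries t hc') = nonDecay s (powerSeriesSum c) := by
    rw [V_eq_nonDecay ht hs (hu.hasFourier ht hs hc'),
      nonDecay_const_mul s (Complex.ofReal_ne_zero.2 (fourierConst_pos d).ne')]
  refine ⟨(hc'.of_le hs.le).summable, diracSeries t hc', functionDual t hs hgrowth, hu,
    hF.isPowerSeries hs hc', hF, hV, fun ψ hψ => ?_, fun ψ hψ => ?_⟩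
  · rw [hV, WF_diracSeries ht hs hc' hu hψ]
  · rw [hV, WF_powerSeries hs ht hst hc' hF hψ]

open GelfandShilov in
theorem proposition7p4 (d : ℕ) (s t : ℝ) (hs : 1 < s) (ht : 0 < t)
    (c : MIdx d → ℂ)
    (hc : ∀ r : ℝ, 0 < r → Summable fun α => ‖c α‖ * r ^ deg α * mfact α ^ s) :
    (∀ x : E d, Summable fun α => c α * (mono x α : ℂ)) ∧
    ∃ (u : GSDual d t s) (F : GSDual d s t),
      IsDiracSeries c u ∧
      IsPowerSeries c F ∧ IsFunction F (powerSeriesSum c) ∧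
      V u = nonDecay s (powerSeriesSum c) ∧
      (∀ ψ : GS d t s, ψ ≠ 0 → WF ht (zero_lt_one.trans hs) ψ u = {0} ×ˢ V u) ∧
      (∀ ψ : GS d s t, ψ ≠ 0 → WF (zero_lt_one.trans hs) ht ψ F = V u ×ˢ {0}) := by
  have := GS.nontrivial d ht hs.le
  exact proposition7p4_general d s t (zero_lt_one.trans hs) ht (by linarith) c hc
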